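/- Let $\mathbb T^2=(\mathbb R/\mathbb Z)^2$ with normalised Lebesgue measure, let $K>0$, and let $g:\mathbb T^2\to\mathbb R$ be a smooth function such that the self-adjoint operator $H_g=-\Delta+K+g$ on $L^2(\mathbb T^2)$, with the domain $H^2(\mathbb T^2)$ of $-\Delta+K$, is (strictly) positive, i.e. $\langle u,H_gu\rangle>0$ for every $0\neq u\in H^2(\mathbb T^2)$. Let $\mu^{-\Delta+K}$ be the law of the Gaussian free field of mass $K$ and $\mu^{H_g}$ the centred Gaussian measure with covariance $H_g^{-1}$, i.e. the probability measures on the space $\mathcal S'(\mathbb T^2)$ of real distributions with \[ \int e^{i\langle\varphi,f\rangle}\,\mu^{-\Delta+K}(\mathrm d\varphi)=e^{-\frac12\langle(-\Delta+K)^{-1}f,f\rangle_{L^2}},\qquad \int e^{i\langle\varphi,f\rangle}\,\mu^{H_g}(\mathrm d\varphi)=e^{-\frac12\langle H_g^{-1}f,f\rangle_{L^2}}\qquad (f\in C^\infty(\mathbb T^2)). \] Let $:\!\varphi^2\!:$ be the Wick square of $\varphi$ with respect to $\mu^{-\Delta+K}$, that is, the random distribution such that, for every $f\in C^\infty(\mathbb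 T^2)$ and every sequence of smooth non-negative mollifiers $a_n$ on $\mathbb T^2$ with integral one and supports shrinking to $0$, \[ \int_{\mathbb T^2} f(x)\Big((a_n*\varphi)(x)^2-\int (a_n*\psi)(x)^2\,\mu^{-\Delta+K}(\mathrm d\psi)\Big)\mathrm dx\;\longrightarrow\;\langle :\!\varphi^2\!:,f\rangle=:\int_{\mathbb T^2} f(x):\!\varphi^2\!:(x)\,\mathrm dx \quad\text{in } L^2(\mu^{-\Delta+K}). \] Then this Wick square exists, $\mu^{H_g}$ is absolutely continuous with respect to $\mu^{-\Delta+K}$, the constant \[ \mathcal Z_{H_g}=\int \exp\Big(-\frac12\int_{\mathbb T^2} g(x):\!\varphi^2\!:(x)\,\mathrm dx\Big)\mu^{-\Delta+K}(\mathrm d\varphi) \] is finite and strictly positive, and for $\mu^{-\Delta+K}$-almost every $\varphi$ the density is finite and strictly positive, with \[ \log\Big(\frac{\mathrm d\mu^{H_g}}{\mathrm d\mu^{-\Delta+K}}(\varphi)\Big)=-\frac12\int_{\mathbb T^2} g(x):\!\varphi^2\!:(x)\,\mathrm dx-\log\mathcal Z_{H_g}. \] -/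

import Mathlib

open MeasureTheory Filter Topology
open scoped ContDiff

namespace TorusField

noncomputable section

/-- The two-dimensional torus `(ℝ/ℤ)²`. -/
abbrev T2 : Type := UnitAddTorus (Fin 2)

/-- Lebesgue (normalised Haar) measure on the torus. -/
def torusMeasure : Measure T2 := Measure.pi fun _ => AddCircle.haarAddCircle

/-- The projection `ℝ² → (ℝ/ℤ)²`. -/
def proj (x : Fin 2 → ℝ) : T2 := fun i => (x i : UnitAddCircle)

/-- A function on the torus is smooth if its periodic lift to `ℝ²` is `C^∞`. -/
def IsSmooth (f : T2 → ℝ) : Prop := ContDiff ℝ ∞ fun x : Fin 2 → ℝ => f (proj x)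

/-- The space `C^∞(𝕋²)` of real-valued smooth functions. -/
def TestFn : Submodule ℝ (T2 → ℝ) where
  carrier := {f | IsSmooth f}
  add_mem' {f h} hf hh := by
    change ContDiff ℝ ∞ _ at hf
    change ContDiff ℝ ∞ _ at hh
    exact hf.add hh
  zero_mem' := by
    change ContDiff ℝ ∞ fun _ : Fin 2 → ℝ => (0 : ℝ)
    exact contDiff_const
  smul_mem' c f hf := by
    change ContDiff ℝ ∞ _ at hf
    exact contDiff_const.smul hf

/-- A real distribution on the torus: a linear functional on `C^∞(𝕋²)` that is continuous, i.e.
bounded by a constant times finitely many of the sup-norms of derivatives. -/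
def Distr : Type :=
  {T : TestFn →ₗ[ℝ] ℝ // ∃ (n : ℕ) (C : ℝ), ∀ (f : TestFn) (M : ℝ),
    (∀ m ≤ n, ∀ x : Fin 2 → ℝ,
      ‖iteratedFDeriv ℝ m (fun y : Fin 2 → ℝ => f.1 (proj y)) x‖ ≤ M) → |T f| ≤ C * M}

/-- The pairing `⟨T, f⟩`. -/
def Distr.pair (T : Distr) (f : TestFn) : ℝ := T.1 f

/-- The σ-algebra on distributions generated by all pairings with test functions. For the dual of
the nuclear Fréchet space `C^∞(𝕋²)` this is the Borel σ-algebra of the strong topology, and every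
finite measure on it is Radon. -/
instance : MeasurableSpace Distr := ⨆ f : TestFn, MeasurableSpace.comap (fun T => T.pair f) (borel ℝ)

/-- The Laplacian of a function on the torus: the sum of the second derivatives in the two
coordinate directions. -/
def laplacian (f : T2 → ℝ) (x : T2) : ℝ :=
  ∑ i : Fin 2, iteratedDeriv 2 (fun t : ℝ => f (x + Pi.single i (t : UnitAddCircle))) 0

/-- `u` is in the domain of the operator `-Δ + V` on `L²(𝕋²)` and `(-Δ + V) u = w`: both `u` and `w`
are in `L²` and the equation holds in the sense of distributions. For bounded `V` the domain is
the Sobolev space `H²(𝕋²)`. -/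
def SchrodingerEq (V : T2 → ℝ) (u w : T2 → ℝ) : Prop :=
  MemLp u 2 torusMeasure ∧ MemLp w 2 torusMeasure ∧
    ∀ f : TestFn, ∫ x, u x * (-laplacian f.1 x + V x * f.1 x) ∂torusMeasure
      = ∫ x, w x * f.1 x ∂torusMeasure

/-- `-Δ + V` is a (strictly) positive operator: `⟨u, (-Δ + V) u⟩ > 0` for every non-zero `u` in its
domain. -/
def IsPositive (V : T2 → ℝ) : Prop :=
  ∀ u w : T2 → ℝ, SchrodingerEq V u w → ¬ u =ᵐ[torusMeasure] 0 →
    0 < ∫ x, u x * w x ∂torusMeasure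

open Classical in
/-- `(-Δ + V)⁻¹ f`: the solution `u` in the domain of `-Δ + V` of `(-Δ + V) u = f`. When `-Δ + V` is
positive and `V` is smooth, it exists and is unique up to null sets for each `f` in `L²`. -/
def greenOp (V f : T2 → ℝ) : T2 → ℝ :=
  if h : ∃ u, SchrodingerEq V u f then h.choose else 0

/-- `μ` is the centred Gaussian measure on distributions with covariance operator `(-Δ + V)⁻¹`:
its characteristic function is `f ↦ exp (-⟨(-Δ + V)⁻¹ f, f⟩ / 2)`. -/
def IsGaussianField (V : T2 → ℝ) (μ : Measure Distr) : Prop :=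
  IsProbabilityMeasure μ ∧ ∀ f : TestFn,
    ∫ φ, Complex.exp (Complex.I * (φ.pair f : ℂ)) ∂μ
      = Complex.exp (-(1 / 2 : ℂ) * ((∫ x, greenOp V f.1 x * f.1 x ∂torusMeasure : ℝ) : ℂ))

/-- The Gaussian free field of mass `K`: covariance `(-Δ + K)⁻¹`. -/
def IsFreeField (K : ℝ) (μ : Measure Distr) : Prop := IsGaussianField (fun _ => K) μ

/-- The test function `y ↦ a (x - y)`. -/
def reflTranslate (a : TestFn) (x : T2) : TestFn :=
  ⟨fun y => a.1 (x - y), by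
    obtain ⟨z, rfl⟩ : ∃ z, proj z = x :=
      ⟨fun i => (x i).out, funext fun i => Quotient.out_eq (x i)⟩
    have h : (fun y : Fin 2 → ℝ => a.1 (proj z - proj y))
        = (fun y : Fin 2 → ℝ => a.1 (proj y)) ∘ fun y => z - y := by
      funext y
      simp only [Function.comp]
      congr 1
    change ContDiff ℝ ∞ fun y : Fin 2 → ℝ => a.1 (proj z - proj y)
    rw [h]
    exact ContDiff.comp (show ContDiff ℝ ∞ _ from a.2) (contDiff_const.sub contDiff_id)⟩

/-- The regularised field `a ∗ φ`, as a function on the torus. -/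
def mollify (a : TestFn) (φ : Distr) (x : T2) : ℝ := φ.pair (reflTranslate a x)

/-- The Wick square of the regularised field, `:(a ∗ φ)²:(x) = (a ∗ φ)(x)² - E_μ[(a ∗ φ)(x)²]`. -/
def wickSqReg (μ : Measure Distr) (a : TestFn) (φ : Distr) (x : T2) : ℝ :=
  mollify a φ x ^ 2 - ∫ ψ, mollify a ψ x ^ 2 ∂μ

/-- A sequence of mollifiers: smooth, non-negative, of integral one, with supports shrinking to the
origin. -/
def IsMollifierSeq (a : ℕ → TestFn) : Prop :=
  (∀ n x, 0 ≤ (a n).1 x) ∧ (∀ n, ∫ x, (a n).1 x ∂torusMeasure = 1) ∧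
    ∀ U ∈ 𝓝 (0 : T2), ∀ᶠ n in atTop, Function.support (a n).1 ⊆ U

/-- The random distribution `Q` is the Wick square `:φ²:` of `φ` with respect to `μ`: for each
sequence of mollifiers `aₙ` and each test function `f`, the variables `∫ f :(aₙ ∗ φ)²:` converge to
`⟨Q(φ), f⟩` in `L²(μ)`. -/
def IsWickSquare (μ : Measure Distr) (Q : Distr → Distr) : Prop :=
  Measurable Q ∧ ∀ a : ℕ → TestFn, IsMollifierSeq a → ∀ f : TestFn,
    Tendsto (fun n => eLpNorm
      (fun φ => (∫ x, f.1 x * wickSqReg μ (a n) φ x ∂torusMeasure) - (Q φ).pair f) 2 μ)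
      atTop (𝓝 0)

end

end TorusField

/-!
The argument diagonalises everything in the Gaussian Hilbert space of the free field.

Let `H` be the closed subspace of `L²(μ)` generated by the variables `⟨φ, f⟩`; each of its elements
is a centred Gaussian variable. The pairing extends to a bounded map `J : L²(𝕋²) → H` with
`Jᵀ J = (-Δ + K)⁻¹` (`exists_gaussianRealization`). For a test function `f` the operator
`T = J f Jᵀ` on `H` is symmetric, and it is Hilbert–Schmidt because
`∑ (K + 4π²|n|²)⁻² < ∞` in dimension two (`summable_lam_inv_sq`, `summable_hsTerm_and_le`). Hence
`H` has an orthonormal basis `eₖ` with `T eₖ = lₖ eₖ` and `∑ lₖ² < ∞`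
(`GaussianRealization.exists_eigenbasis`).

*The Wick square.* Wick's formula `E[:h²: :k²:] = 2⟨h, k⟩²` gives the correlations of
`Φₐ = ∫ f :(a ∗ φ)²:` with itself, as a series over a trigonometric frame, and with `:eₖ²:`. As the
mollifier shrinks, these tend to `2 ∑ lₖ²` and `2 lₖ`
(`IsMollifierSeq.tendsto_tsum_regTerm`, `IsMollifierSeq.tendsto_integral_conv_sq`). So the distance
in `L²(μ)` from `Φₐ` to the finite sum `∑_{k ∈ s} lₖ :eₖ²:` tends to
`(2 ∑_{k ∉ s} lₖ²)^{1/2}`, and `Φₐ` converges to `∑ₖ lₖ :eₖ²:`, whatever the mollifiers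
(`GaussianRealization.tendsto_integral_sub_chaosSum`). The limit depends linearly on `f` and is
bounded by the `L²` norm of `f`, so its Fourier coefficients almost surely grow slowly enough to
define a distribution (`GaussianRealization.isWickSquare_wickSquare`).

*The density.* Take `f = g` and `X = ∫ g :φ²: = ∑ₖ lₖ (eₖ² - 1)`. An eigenvector `eₖ` with `lₖ ≠ 0`
gives `u = Jᵀ eₖ` with `⟨u, (-Δ + K + g) u⟩ = 1 + lₖ`, so positivity of the operator means
`1 + lₖ > 0` (`one_add_eigenvalue_pos`). Since the `eₖ` are independent standard Gaussian
variables, explicit one-dimensional integrals give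
`E[exp (i h - X / 2)] = E[exp (-X / 2)] · exp (-½ ∑ₖ ⟨eₖ, h⟩² / (1 + lₖ))` for `h ∈ H`, first for
finite sums and then, the `lₖ` being bounded away from `-1`, in the limit by uniform integrability
(`IsGaussianSpace.integral_cexp_mul_exp`). For `h = J f` the last sum is
`⟨(-Δ + K + g)⁻¹ f, f⟩` (`integral_greenOp_mul`), so the probability measure proportional to
`exp (-X / 2) μ` has the characteristic functional of `ν`, and the two measures agree
(`eq_withDensity`).
-/

namespace TorusField

noncomputable section

/-! ### Calculus on the torus -/

instance : IsProbabilityMeasure torusMeasure := by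
  unfold torusMeasure; infer_instance

instance : torusMeasure.IsAddHaarMeasure := by
  unfold torusMeasure; infer_instance

theorem isOpenQuotientMap_proj : IsOpenQuotientMap proj :=
  IsOpenQuotientMap.piMap fun _ : Fin 2 => QuotientAddGroup.isOpenQuotientMap_mk

theorem proj_add (x y : Fin 2 → ℝ) : proj (x + y) = proj x + proj y := rfl

theorem proj_sub (x y : Fin 2 → ℝ) : proj (x - y) = proj x - proj y := rfl

theorem proj_smul_single (t : ℝ) (i : Fin 2) :
    proj (t • Pi.single i 1) = Pi.single i (t : UnitAddCircle) := by
  funext k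
  by_cases h : k = i
  · subst h; simp [proj]
  · simp [proj, h]

theorem contDiff_testFn (f : TestFn) : ContDiff ℝ ∞ fun z : Fin 2 → ℝ => f.1 (proj z) := f.2

theorem continuous_testFn (f : TestFn) : Continuous f.1 :=
  isOpenQuotientMap_proj.isQuotientMap.continuous_iff.2 (contDiff_testFn f).continuous

/-- Directional derivatives of the lift of a test function are derivatives along translations of
the torus. -/
theorem hasDerivAt_translate (f : TestFn) (z : Fin 2 → ℝ) (i : Fin 2) (t : ℝ) :
    HasDerivAt (fun t : ℝ => f.1 (proj z + Pi.single i (t : UnitAddCircle)))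
      (fderiv ℝ (fun z : Fin 2 → ℝ => f.1 (proj z)) (z + t • Pi.single i 1) (Pi.single i 1)) t := by
  have h1 : (fun t : ℝ => f.1 (proj z + Pi.single i (t : UnitAddCircle)))
      = (fun z : Fin 2 → ℝ => f.1 (proj z)) ∘ fun t : ℝ => z + t • Pi.single i 1 := by
    funext t
    simp [proj_add, proj_smul_single]
  rw [h1]
  have h2 : HasDerivAt (fun t : ℝ => z + t • (Pi.single i 1 : Fin 2 → ℝ)) (Pi.single i 1) t := by
    simpa using ((hasDerivAt_id t).smul_const (Pi.single i 1 : Fin 2 → ℝ)).const_add z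
  exact (((contDiff_testFn f).differentiable (by simp)).differentiableAt.hasFDerivAt).comp_hasDerivAt t h2

/-- The partial derivative of a test function in the `i`-th coordinate direction. -/
def pderiv (i : Fin 2) (f : TestFn) : TestFn :=
  ⟨fun x => deriv (fun t : ℝ => f.1 (x + Pi.single i (t : UnitAddCircle))) 0, by
    have h : (fun z : Fin 2 → ℝ =>
        deriv (fun t : ℝ => f.1 (proj z + Pi.single i (t : UnitAddCircle))) 0)
        = fun z => fderiv ℝ (fun z : Fin 2 → ℝ => f.1 (proj z)) z (Pi.single i 1) := by
      funext z
      simpa using (hasDerivAt_translate f z i 0).deriv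
    change ContDiff ℝ ∞ _
    rw [h]
    exact ((contDiff_testFn f).fderiv_right (m := ∞) (by simp)).clm_apply contDiff_const⟩

theorem pderiv_proj (i : Fin 2) (f : TestFn) (z : Fin 2 → ℝ) :
    (pderiv i f).1 (proj z)
      = fderiv ℝ (fun z : Fin 2 → ℝ => f.1 (proj z)) z (Pi.single i 1) := by
  have h := (hasDerivAt_translate f z i 0).deriv
  rw [zero_smul, add_zero] at h
  exact h

theorem hasDerivAt_pderiv (i : Fin 2) (f : TestFn) (x : T2) (t : ℝ) :
    HasDerivAt (fun t : ℝ => f.1 (x + Pi.single i (t : UnitAddCircle)))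
      ((pderiv i f).1 (x + Pi.single i (t : UnitAddCircle))) t := by
  obtain ⟨z, rfl⟩ := isOpenQuotientMap_proj.surjective x
  have := hasDerivAt_translate f z i t
  rwa [← pderiv_proj, proj_add, proj_smul_single] at this

theorem pderiv_apply_eq {i : Fin 2} {f : TestFn} {x : T2} {d : ℝ}
    (h : HasDerivAt (fun t : ℝ => f.1 (x + Pi.single i (t : UnitAddCircle))) d 0) :
    (pderiv i f).1 x = d := h.deriv

/-- The Laplacian of a test function, as a test function. -/
def lap (f : TestFn) : TestFn := ∑ i : Fin 2, pderiv i (pderiv i f)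

theorem lap_apply (f : TestFn) (x : T2) :
    (lap f).1 x = ∑ i : Fin 2, (pderiv i (pderiv i f)).1 x := by
  simp [lap]

theorem laplacian_eq_lap (f : TestFn) : laplacian f.1 = (lap f).1 := by
  funext x
  rw [lap_apply, laplacian]
  refine Finset.sum_congr rfl fun i _ => ?_
  have h : deriv (fun t : ℝ => f.1 (x + Pi.single i (t : UnitAddCircle)))
      = fun t : ℝ => (pderiv i f).1 (x + Pi.single i (t : UnitAddCircle)) :=
    funext fun t => (hasDerivAt_pderiv i f x t).deriv
  rw [iteratedDeriv_succ, iteratedDeriv_one, h]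
  rfl

/-- The pointwise product of test functions. -/
def mulT (f h : TestFn) : TestFn :=
  ⟨fun x => f.1 x * h.1 x, (contDiff_testFn f).mul (contDiff_testFn h)⟩

theorem pderiv_mulT (i : Fin 2) (f h : TestFn) (x : T2) :
    (pderiv i (mulT f h)).1 x = (pderiv i f).1 x * h.1 x + f.1 x * (pderiv i h).1 x := by
  have := (hasDerivAt_pderiv i f x 0).mul (hasDerivAt_pderiv i h x 0)
  simp only [QuotientAddGroup.mk_zero, Pi.single_zero, add_zero] at this
  exact pderiv_apply_eq this

theorem bounded_testFn (f : TestFn) : ∃ C, ∀ x, |f.1 x| ≤ C := by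
  obtain ⟨C, hC⟩ := (isCompact_range (continuous_testFn f)).isBounded.exists_norm_le
  exact ⟨C, fun x => hC _ ⟨x, rfl⟩⟩

theorem _root_.Continuous.integrable_torus {f : T2 → ℝ} (hf : Continuous f) :
    Integrable f torusMeasure :=
  hf.integrable_of_hasCompactSupport (HasCompactSupport.of_compactSpace f)

theorem integrable_mul_testFn (f h : TestFn) :
    Integrable (fun x => f.1 x * h.1 x) torusMeasure :=
  ((continuous_testFn f).mul (continuous_testFn h)).integrable_torus

/-- Derivatives integrate to zero: the integral of a translate does not depend on the
translation. -/
theorem integral_pderiv (i : Fin 2) (f : TestFn) : ∫ x, (pderiv i f).1 x ∂torusMeasure = 0 := by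
  obtain ⟨C, hC⟩ := (bounded_testFn (pderiv i f))
  have h1 : HasDerivAt (fun t : ℝ => ∫ x, f.1 (x + Pi.single i (t : UnitAddCircle)) ∂torusMeasure)
      (∫ x, (pderiv i f).1 (x + Pi.single i ((0 : ℝ) : UnitAddCircle)) ∂torusMeasure) 0 := by
    refine (hasDerivAt_integral_of_dominated_loc_of_deriv_le (μ := torusMeasure)
      (bound := fun _ => C)
      (F := fun (t : ℝ) (x : T2) => f.1 (x + Pi.single i (t : UnitAddCircle)))
      (F' := fun (t : ℝ) (x : T2) => (pderiv i f).1 (x + Pi.single i (t : UnitAddCircle)))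
      (s := Set.univ)
      univ_mem (Eventually.of_forall fun t => ?_) ?_ ?_ ?_ (integrable_const C) ?_).2
    · exact ((continuous_testFn f).comp (continuous_add_const _)).aestronglyMeasurable
    · exact ((continuous_testFn f).comp (continuous_add_const _)).integrable_torus
    · exact ((continuous_testFn (pderiv i f)).comp (continuous_add_const _)).aestronglyMeasurable
    · exact ae_of_all _ fun x t _ => hC _
    · exact ae_of_all _ fun x t _ => hasDerivAt_pderiv i f x t
  have h2 : (fun t : ℝ => ∫ x, f.1 (x + Pi.single i (t : UnitAddCircle)) ∂torusMeasure)
      = fun _ => ∫ x, f.1 x ∂torusMeasure := by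
    funext t
    exact integral_add_right_eq_self (μ := torusMeasure) f.1 _
  rw [h2] at h1
  simpa using h1.unique (hasDerivAt_const _ _)

theorem integral_pderiv_mul (i : Fin 2) (f h : TestFn) :
    ∫ x, (pderiv i f).1 x * h.1 x ∂torusMeasure
      = -∫ x, f.1 x * (pderiv i h).1 x ∂torusMeasure := by
  have h0 := integral_pderiv i (mulT f h)
  simp only [pderiv_mulT] at h0
  rw [integral_add (integrable_mul_testFn _ _) (integrable_mul_testFn _ _)] at h0
  linarith

theorem integral_lap_mul (f h : TestFn) :
    ∫ x, (lap f).1 x * h.1 x ∂torusMeasure = ∫ x, f.1 x * (lap h).1 x ∂torusMeasure := by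
  simp only [lap_apply, Finset.sum_mul, Finset.mul_sum]
  rw [integral_finsetSum _ fun i _ => integrable_mul_testFn _ _,
    integral_finsetSum _ fun i _ => integrable_mul_testFn _ _]
  refine Finset.sum_congr rfl fun i _ => ?_
  rw [integral_pderiv_mul, integral_pderiv_mul, neg_neg]

/-! ### Trigonometric functions -/

/-- The index set of the trigonometric functions: a frequency in `ℤ²`, and a flag that selects
the cosine (`false`) or the sine (`true`). Frequencies `n` and `-n` give the same functions up to
sign, so that the family is a Parseval frame and not a basis. -/
abbrev Idx : Type := (Fin 2 → ℤ) × Bool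

/-- The phase `2π n·z`. -/
def phase (n : Fin 2 → ℤ) (z : Fin 2 → ℝ) : ℝ := 2 * Real.pi * ∑ i, n i * z i

theorem mFourier_proj (n : Fin 2 → ℤ) (z : Fin 2 → ℝ) :
    UnitAddTorus.mFourier n (proj z) = Complex.exp (phase n z * Complex.I) := by
  simp only [UnitAddTorus.mFourier, ContinuousMap.coe_mk, proj, fourier_coe_apply, phase]
  rw [← Complex.exp_sum]
  congr 1
  push_cast
  rw [Finset.mul_sum, Finset.sum_mul]
  refine Finset.sum_congr rfl fun i _ => ?_
  simp; ring

theorem re_mFourier_proj (n : Fin 2 → ℤ) (z : Fin 2 → ℝ) :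
    (UnitAddTorus.mFourier n (proj z)).re = Real.cos (phase n z) := by
  rw [mFourier_proj, Complex.exp_ofReal_mul_I_re]

theorem im_mFourier_proj (n : Fin 2 → ℤ) (z : Fin 2 → ℝ) :
    (UnitAddTorus.mFourier n (proj z)).im = Real.sin (phase n z) := by
  rw [mFourier_proj, Complex.exp_ofReal_mul_I_im]

theorem contDiff_phase (n : Fin 2 → ℤ) : ContDiff ℝ ∞ (phase n) := by
  unfold phase; fun_prop

/-- The test function `x ↦ cos (2π n·x)`. -/
def cosT (n : Fin 2 → ℤ) : TestFn :=
  ⟨fun x => (UnitAddTorus.mFourier n x).re, by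
    change ContDiff ℝ ∞ fun z : Fin 2 → ℝ => (UnitAddTorus.mFourier n (proj z)).re
    simp only [re_mFourier_proj]
    exact Real.contDiff_cos.comp (contDiff_phase n)⟩

/-- The test function `x ↦ sin (2π n·x)`. -/
def sinT (n : Fin 2 → ℤ) : TestFn :=
  ⟨fun x => (UnitAddTorus.mFourier n x).im, by
    change ContDiff ℝ ∞ fun z : Fin 2 → ℝ => (UnitAddTorus.mFourier n (proj z)).im
    simp only [im_mFourier_proj]
    exact Real.contDiff_sin.comp (contDiff_phase n)⟩

/-- The trigonometric function of index `j`. -/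
def trig (j : Idx) : TestFn := bif j.2 then sinT j.1 else cosT j.1

@[simp] theorem trig_false (n : Fin 2 → ℤ) : trig (n, false) = cosT n := rfl

@[simp] theorem trig_true (n : Fin 2 → ℤ) : trig (n, true) = sinT n := rfl

theorem cosT_proj (n : Fin 2 → ℤ) (z : Fin 2 → ℝ) :
    (cosT n).1 (proj z) = Real.cos (phase n z) := re_mFourier_proj n z

theorem sinT_proj (n : Fin 2 → ℤ) (z : Fin 2 → ℝ) :
    (sinT n).1 (proj z) = Real.sin (phase n z) := im_mFourier_proj n z

theorem phase_sub (n : Fin 2 → ℤ) (z w : Fin 2 → ℝ) :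
    phase n (z - w) = phase n z - phase n w := by
  simp only [phase, Pi.sub_apply]
  simp only [Fin.sum_univ_two]
  ring

theorem cosT_sub (n : Fin 2 → ℤ) (x y : T2) :
    (cosT n).1 (x - y) = (cosT n).1 x * (cosT n).1 y + (sinT n).1 x * (sinT n).1 y := by
  obtain ⟨z, rfl⟩ := isOpenQuotientMap_proj.surjective x
  obtain ⟨w, rfl⟩ := isOpenQuotientMap_proj.surjective y
  rw [← proj_sub]
  simp only [cosT_proj, sinT_proj, phase_sub, Real.cos_sub]

theorem sinT_sub (n : Fin 2 → ℤ) (x y : T2) :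
    (sinT n).1 (x - y) = (sinT n).1 x * (cosT n).1 y - (cosT n).1 x * (sinT n).1 y := by
  obtain ⟨z, rfl⟩ := isOpenQuotientMap_proj.surjective x
  obtain ⟨w, rfl⟩ := isOpenQuotientMap_proj.surjective y
  rw [← proj_sub]
  simp only [cosT_proj, sinT_proj, phase_sub, Real.sin_sub]

theorem abs_trig_le_one (j : Idx) (x : T2) : |(trig j).1 x| ≤ 1 := by
  obtain ⟨z, rfl⟩ := isOpenQuotientMap_proj.surjective x
  rcases j with ⟨n, _ | _⟩
  · rw [trig_false, cosT_proj]; exact Real.abs_cos_le_one _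
  · rw [trig_true, sinT_proj]; exact Real.abs_sin_le_one _

theorem hasDerivAt_phase (n : Fin 2 → ℤ) (z : Fin 2 → ℝ) (i : Fin 2) :
    HasDerivAt (fun t : ℝ => phase n (z + t • Pi.single i 1)) (2 * Real.pi * n i) 0 := by
  have h : (fun t : ℝ => phase n (z + t • Pi.single i 1))
      = fun t => phase n z + t * (2 * Real.pi * n i) := by
    funext t
    simp only [phase, Fin.sum_univ_two]
    fin_cases i <;> simp <;> ring
  rw [h]
  simpa using ((hasDerivAt_id (0 : ℝ)).mul_const (2 * Real.pi * n i)).const_add (phase n z)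

theorem pderiv_cosT (n : Fin 2 → ℤ) (i : Fin 2) :
    pderiv i (cosT n) = (-(2 * Real.pi * n i)) • sinT n := by
  refine Subtype.ext (funext fun x => ?_)
  obtain ⟨z, rfl⟩ := isOpenQuotientMap_proj.surjective x
  refine pderiv_apply_eq ?_
  have h := (hasDerivAt_phase n z i).cos
  simp only [zero_smul, add_zero] at h
  simp only [← proj_smul_single, ← proj_add, cosT_proj]
  convert h using 1
  change -(2 * Real.pi * n i) * (sinT n).1 (proj z) = _
  rw [sinT_proj]; ring

theorem pderiv_sinT (n : Fin 2 → ℤ) (i : Fin 2) :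
    pderiv i (sinT n) = (2 * Real.pi * n i) • cosT n := by
  refine Subtype.ext (funext fun x => ?_)
  obtain ⟨z, rfl⟩ := isOpenQuotientMap_proj.surjective x
  refine pderiv_apply_eq ?_
  have h := (hasDerivAt_phase n z i).sin
  simp only [zero_smul, add_zero] at h
  simp only [← proj_smul_single, ← proj_add, sinT_proj]
  convert h using 1
  change (2 * Real.pi * n i) * (cosT n).1 (proj z) = _
  rw [cosT_proj]; ring

theorem pderiv_smul (i : Fin 2) (c : ℝ) (f : TestFn) : pderiv i (c • f) = c • pderiv i f := by
  refine Subtype.ext (funext fun x => pderiv_apply_eq ?_)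
  have := (hasDerivAt_pderiv i f x 0).const_mul c
  simp only [QuotientAddGroup.mk_zero, Pi.single_zero, add_zero] at this
  exact this

theorem lap_trig (j : Idx) :
    lap (trig j) = (-(4 * Real.pi ^ 2 * ∑ i, (j.1 i : ℝ) ^ 2)) • trig j := by
  rcases j with ⟨n, _ | _⟩
  · simp only [trig_false, lap, pderiv_cosT, pderiv_smul, pderiv_sinT, smul_smul, ← Finset.sum_smul]
    congr 1
    simp only [Fin.sum_univ_two]; ring
  · simp only [trig_true, lap, pderiv_cosT, pderiv_smul, pderiv_sinT, smul_smul, ← Finset.sum_smul]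
    congr 1
    simp only [Fin.sum_univ_two]; ring

/-! ### The Hilbert space of the torus and Parseval's identity -/

/-- The real Hilbert space `L²(𝕋²)`. -/
abbrev L2T : Type := Lp ℝ 2 torusMeasure

theorem memLp_testFn (f : TestFn) : MemLp f.1 2 torusMeasure := by
  obtain ⟨C, hC⟩ := bounded_testFn f
  exact MemLp.of_bound (continuous_testFn f).aestronglyMeasurable C (ae_of_all _ hC)

/-- The inclusion of the test functions in `L²(𝕋²)`. -/
def ofT : TestFn →ₗ[ℝ] L2T where
  toFun f := (memLp_testFn f).toLp f.1
  map_add' _ _ := rfl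
  map_smul' _ _ := rfl

theorem coeFn_ofT (f : TestFn) : ofT f =ᵐ[torusMeasure] f.1 := (memLp_testFn f).coeFn_toLp

theorem inner_L2_eq {α : Type*} [MeasurableSpace α] {m : Measure α} (u v : Lp ℝ 2 m) :
    inner ℝ u v = ∫ x, u x * v x ∂m := by
  rw [L2.inner_def]
  exact integral_congr_ae (ae_of_all _ fun x => by simp [mul_comm])

theorem norm_sq_L2_eq {α : Type*} [MeasurableSpace α] {m : Measure α} (u : Lp ℝ 2 m) :
    ‖u‖ ^ 2 = ∫ x, u x ^ 2 ∂m := by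
  rw [← real_inner_self_eq_norm_sq, inner_L2_eq]
  simp only [sq]

theorem inner_ofT_right (u : L2T) (f : TestFn) :
    inner ℝ u (ofT f) = ∫ x, u x * f.1 x ∂torusMeasure := by
  rw [inner_L2_eq]
  refine integral_congr_ae ?_
  filter_upwards [coeFn_ofT f] with x hx
  rw [hx]

theorem inner_ofT_ofT (f h : TestFn) :
    inner ℝ (ofT f) (ofT h) = ∫ x, f.1 x * h.1 x ∂torusMeasure := by
  rw [inner_ofT_right]
  refine integral_congr_ae ?_
  filter_upwards [coeFn_ofT f] with x hx
  rw [hx]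

theorem inner_toLp_ofT {u : T2 → ℝ} (hu : MemLp u 2 torusMeasure) (f : TestFn) :
    inner ℝ (hu.toLp u) (ofT f) = ∫ x, u x * f.1 x ∂torusMeasure := by
  rw [inner_ofT_right]
  refine integral_congr_ae ?_
  filter_upwards [hu.coeFn_toLp] with x hx
  rw [hx]

/-- The trigonometric function of index `j` as an element of `L²(𝕋²)`. -/
def frame (j : Idx) : L2T := ofT (trig j)

theorem norm_frame_le_one (j : Idx) : ‖frame j‖ ≤ 1 := by
  have h : ‖frame j‖ ^ 2 ≤ 1 := by
    rw [← real_inner_self_eq_norm_sq, frame, inner_ofT_ofT]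
    calc ∫ x, (trig j).1 x * (trig j).1 x ∂torusMeasure ≤ ∫ _, (1 : ℝ) ∂torusMeasure := by
          refine integral_mono (integrable_mul_testFn _ _) (integrable_const _) fun x => ?_
          have := abs_le.1 (abs_trig_le_one j x)
          simp only
          nlinarith
      _ = 1 := by simp
  exact (sq_le_one_iff₀ (norm_nonneg _)).1 h

theorem hasSum_bool_prod {ι : Type*} {f : ι × Bool → ℝ} (hf : ∀ j, 0 ≤ f j) {a : ℝ}
    (h : HasSum (fun n => f (n, false) + f (n, true)) a) : HasSum f a := by
  have hs : Summable f := by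
    refine (summable_prod_of_nonneg hf).2 ⟨fun n => Summable.of_finite, ?_⟩
    simpa [add_comm] using h.summable
  have ht := hs.hasSum.prod_fiberwise fun n => (hasSum_fintype fun b => f (n, b))
  simp only [Fintype.sum_bool, add_comm] at ht
  rw [← ht.unique h]
  exact hs.hasSum

theorem mFourierCoeff_ofReal (u : L2T) (n : Fin 2 → ℤ) :
    UnitAddTorus.mFourierCoeff (fun x => (u x : ℂ)) n
      = ⟨inner ℝ u (frame (n, false)), -inner ℝ u (frame (n, true))⟩ := by
  have hi : ∀ f : TestFn, Integrable (fun x => u x * f.1 x) torusMeasure := fun f =>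
    (Lp.memLp u).integrable_mul (memLp_testFn f)
  have h1 : UnitAddTorus.mFourierCoeff (fun x => (u x : ℂ)) n
      = ∫ x, (((u x * (cosT n).1 x : ℝ) : ℂ) - ((u x * (sinT n).1 x : ℝ) : ℂ) * Complex.I)
          ∂torusMeasure := by
    refine integral_congr_ae (ae_of_all _ fun x => ?_)
    simp only [UnitAddTorus.mFourier_neg, smul_eq_mul, cosT, sinT]
    apply Complex.ext <;> simp [mul_comm]
  rw [h1, integral_sub (hi _).ofReal ((hi _).ofReal.mul_const _), integral_mul_const,
    integral_complex_ofReal, integral_complex_ofReal, frame, frame, inner_ofT_right, inner_ofT_right]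
  apply Complex.ext <;> simp

/-- **Parseval's identity** for the real trigonometric frame. -/
theorem hasSum_frame_sq (u : L2T) : HasSum (fun j => inner ℝ u (frame j) ^ 2) (‖u‖ ^ 2) := by
  refine hasSum_bool_prod (fun j => sq_nonneg _) ?_
  have hu : MemLp (fun x => (u x : ℂ)) 2 torusMeasure := (Lp.memLp u).ofReal
  have h := UnitAddTorus.hasSum_sq_mFourierCoeff (hu.toLp _)
  have h2 : ∀ n, UnitAddTorus.mFourierCoeff (hu.toLp _) n
      = UnitAddTorus.mFourierCoeff (fun x => (u x : ℂ)) n := fun n => by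
    refine integral_congr_ae ?_
    filter_upwards [hu.coeFn_toLp] with x hx
    rw [hx]
  convert h using 1
  · funext n
    refine Eq.trans ?_ (congrArg (fun z : ℂ => ‖z‖ ^ 2) (h2 n)).symm
    rw [mFourierCoeff_ofReal, ← Complex.normSq_eq_norm_sq, Complex.normSq_mk]
    ring
  · rw [norm_sq_L2_eq]
    refine integral_congr_ae ?_
    filter_upwards [hu.coeFn_toLp] with x hx
    refine Eq.trans ?_ (congrArg (fun z : ℂ => ‖z‖ ^ 2) hx).symm
    simp

theorem hasSum_frame (u v : L2T) :
    HasSum (fun j => inner ℝ u (frame j) * inner ℝ v (frame j)) (inner ℝ u v) := by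
  have h := ((hasSum_frame_sq (u + v)).sub (hasSum_frame_sq (u - v))).mul_left (1 / 4)
  have h1 : (fun j => inner ℝ u (frame j) * inner ℝ v (frame j)) = fun j =>
      1 / 4 * (inner ℝ (u + v) (frame j) ^ 2 - inner ℝ (u - v) (frame j) ^ 2) := by
    funext j
    rw [inner_add_left, inner_sub_left]; ring
  have h2 : inner ℝ u v = 1 / 4 * (‖u + v‖ ^ 2 - ‖u - v‖ ^ 2) := by
    rw [norm_add_sq_real, norm_sub_sq_real]; ring
  rw [h1, h2]
  exact h

theorem eq_zero_of_inner_frame_eq_zero {u : L2T} (h : ∀ j, inner ℝ u (frame j) = 0) : u = 0 := by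
  have h1 := hasSum_frame_sq u
  simp only [h, ne_eq, OfNat.ofNat_ne_zero, not_false_eq_true, zero_pow] at h1
  have := h1.unique hasSum_zero
  exact norm_eq_zero.1 (pow_eq_zero_iff two_ne_zero |>.1 this)

theorem denseRange_ofT : DenseRange ofT := by
  have h : (LinearMap.range ofT).topologicalClosure = ⊤ := by
    rw [Submodule.topologicalClosure_eq_top_iff, Submodule.eq_bot_iff]
    intro u hu
    refine eq_zero_of_inner_frame_eq_zero fun j => ?_
    exact Submodule.inner_left_of_mem_orthogonal (LinearMap.mem_range_self ofT (trig j)) hu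
  intro x
  have hx : x ∈ (LinearMap.range ofT).topologicalClosure := by rw [h]; trivial
  exact hx

/-! ### The operator `-Δ + K` in the trigonometric frame -/

/-- The eigenvalue `K + 4π²|n|²` of `-Δ + K` on the trigonometric functions of frequency `n`. -/
def lam (K : ℝ) (j : Idx) : ℝ := K + 4 * Real.pi ^ 2 * ∑ i, (j.1 i : ℝ) ^ 2

theorem le_lam (K : ℝ) (j : Idx) : K ≤ lam K j := by
  unfold lam
  have : 0 ≤ 4 * Real.pi ^ 2 * ∑ i, (j.1 i : ℝ) ^ 2 := by positivity
  linarith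

theorem lam_pos {K : ℝ} (hK : 0 < K) (j : Idx) : 0 < lam K j := hK.trans_le (le_lam K j)

theorem norm_sq_le_lam {K : ℝ} (hK : 0 < K) (j : Idx) : ‖j.1‖ ^ 2 ≤ lam K j := by
  have h1 : ‖j.1‖ ^ 2 ≤ ∑ i, (j.1 i : ℝ) ^ 2 := by
    obtain ⟨i, hi⟩ : ∃ i, ‖j.1‖ = ‖j.1 i‖ := by
      obtain ⟨i, -, hi⟩ := Finset.exists_mem_eq_sup' (s := (Finset.univ : Finset (Fin 2)))
        Finset.univ_nonempty (fun i => ‖j.1 i‖)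
      refine ⟨i, le_antisymm ?_ (norm_le_pi_norm _ i)⟩
      rw [← hi]
      refine (pi_norm_le_iff_of_nonempty _).2 fun k => ?_
      exact Finset.le_sup' (fun i => ‖j.1 i‖) (Finset.mem_univ k)
    rw [hi, Int.norm_eq_abs, sq_abs]
    exact Finset.single_le_sum (f := fun i => (j.1 i : ℝ) ^ 2) (fun _ _ => sq_nonneg _)
      (Finset.mem_univ i)
  have h2 : (1 : ℝ) ≤ 4 * Real.pi ^ 2 := by nlinarith [Real.pi_gt_three]
  have h3 : 0 ≤ ∑ i, (j.1 i : ℝ) ^ 2 := by positivity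
  unfold lam
  nlinarith

/-- The resolvent of the Laplacian in dimension two is Hilbert–Schmidt. -/
theorem summable_lam_inv_sq {K : ℝ} (hK : 0 < K) : Summable fun j => (lam K j)⁻¹ ^ 2 := by
  have h1 : Summable fun n : Fin 2 → ℤ => (lam K (n, false))⁻¹ ^ 2 := by
    refine Summable.of_norm_bounded_eventually
      (EisensteinSeries.summable_one_div_norm_rpow (k := 4) (by norm_num)) ?_
    have : ∀ᶠ n : Fin 2 → ℤ in cofinite, n ≠ 0 := by
      simp [Filter.eventually_cofinite]
    filter_upwards [this] with n hn
    have hn' : 0 < ‖n‖ := norm_pos_iff.2 hn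
    have h := norm_sq_le_lam hK (n, false)
    rw [Real.norm_of_nonneg (by positivity), Real.rpow_neg hn'.le]
    norm_cast
    rw [inv_pow]
    refine inv_anti₀ (by positivity) ?_
    calc ‖n‖ ^ 4 = (‖n‖ ^ 2) ^ 2 := by ring
      _ ≤ _ := by gcongr
  have h2 := h1.mul_of_nonneg (g := fun _ : Bool => (1 : ℝ)) Summable.of_finite
    (fun _ => sq_nonneg _) (fun _ => zero_le_one)
  have h3 : Summable fun j : Idx => (lam K (j.1, false))⁻¹ ^ 2 * 1 := h2
  simp only [mul_one] at h3
  exact h3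

/-- The test function `(-Δ + K) f`. -/
def massive (K : ℝ) (f : TestFn) : TestFn := K • f - lap f

theorem massive_apply (K : ℝ) (f : TestFn) (x : T2) :
    (massive K f).1 x = -laplacian f.1 x + K * f.1 x := by
  rw [laplacian_eq_lap]
  change K * f.1 x - (lap f).1 x = _
  ring

theorem massive_trig (K : ℝ) (j : Idx) : massive K (trig j) = lam K j • trig j := by
  rw [massive, lap_trig, lam]
  module

theorem inner_massive_frame (K : ℝ) (f : TestFn) (j : Idx) :
    inner ℝ (ofT (massive K f)) (frame j) = lam K j * inner ℝ (ofT f) (frame j) := by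
  have h : inner ℝ (ofT (lap f)) (ofT (trig j)) = inner ℝ (ofT f) (ofT (lap (trig j))) := by
    rw [inner_ofT_ofT, inner_ofT_ofT, integral_lap_mul]
  have h2 : massive K (trig j) = lam K j • trig j := massive_trig K j
  have h3 := congrArg (fun v => inner ℝ (ofT f) (ofT v)) h2
  simp only [massive, map_sub, map_smul, inner_sub_right, inner_smul_right] at h3
  simp only [frame, massive, map_sub, map_smul, inner_sub_left, h, inner_smul_left,
    RCLike.conj_to_real, h3]

theorem schrodingerEq_iff {V : T2 → ℝ} {u w : T2 → ℝ} (hu : MemLp u 2 torusMeasure)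
    (hw : MemLp w 2 torusMeasure) :
    SchrodingerEq V u w ↔ ∀ f : TestFn, ∫ x, u x * (-laplacian f.1 x + V x * f.1 x) ∂torusMeasure
      = ∫ x, w x * f.1 x ∂torusMeasure := by
  simp [SchrodingerEq, hu, hw]

theorem schrodingerEq_const_iff {K : ℝ} {u w : T2 → ℝ} (hu : MemLp u 2 torusMeasure)
    (hw : MemLp w 2 torusMeasure) :
    SchrodingerEq (fun _ => K) u w ↔
      ∀ f : TestFn, inner ℝ (hu.toLp u) (ofT (massive K f)) = inner ℝ (hw.toLp w) (ofT f) := by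
  simp only [schrodingerEq_iff hu hw, inner_toLp_ofT, massive_apply]

theorem exists_schrodingerEq_const {K : ℝ} (hK : 0 < K) {w : T2 → ℝ}
    (hw : MemLp w 2 torusMeasure) : ∃ u, SchrodingerEq (fun _ => K) u w := by
  set W := hw.toLp w
  have hs : Summable fun j => ((lam K j)⁻¹ * inner ℝ W (frame j)) • frame j := by
    have h1 : Summable fun j => |(lam K j)⁻¹ * inner ℝ W (frame j)| := by
      refine Summable.of_nonneg_of_le (fun _ => abs_nonneg _) (fun j => ?_)
        ((summable_lam_inv_sq hK).add (hasSum_frame_sq W).summable)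
      rw [abs_mul]
      nlinarith [sq_abs (lam K j)⁻¹, sq_abs (inner ℝ W (frame j)),
        sq_nonneg (|(lam K j)⁻¹| - |inner ℝ W (frame j)|), sq_nonneg |(lam K j)⁻¹|,
        sq_nonneg |inner ℝ W (frame j)|]
    refine Summable.of_norm_bounded h1 fun j => ?_
    rw [norm_smul, Real.norm_eq_abs]
    exact mul_le_of_le_one_right (abs_nonneg _) (norm_frame_le_one j)
  set U : L2T := ∑' j, ((lam K j)⁻¹ * inner ℝ W (frame j)) • frame j
  refine ⟨U, (schrodingerEq_const_iff (Lp.memLp U) hw).2 fun f => ?_⟩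
  have h0 : MemLp.toLp U (Lp.memLp U) = U := Lp.toLp_coeFn U _
  rw [h0]
  have h2 := hs.hasSum.mapL (innerSL ℝ (ofT (massive K f)))
  have h3 := hasSum_frame W (ofT f)
  rw [real_inner_comm]
  refine h2.unique ?_
  have h4 : (fun j => innerSL ℝ (ofT (massive K f)) (((lam K j)⁻¹ * inner ℝ W (frame j)) • frame j))
      = fun j => inner ℝ W (frame j) * inner ℝ (ofT f) (frame j) := by
    funext j
    simp only [innerSL_apply_apply, inner_smul_right, inner_massive_frame]
    have := (lam_pos hK j).ne'
    field_simp
  rw [h4]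
  exact h3

theorem SchrodingerEq.inner_frame {K : ℝ} (hK : 0 < K) {u w : T2 → ℝ}
    (h : SchrodingerEq (fun _ => K) u w) (j : Idx) :
    inner ℝ (h.1.toLp u) (frame j) = (lam K j)⁻¹ * inner ℝ (h.2.1.toLp w) (frame j) := by
  have := (schrodingerEq_const_iff h.1 h.2.1).1 h (trig j)
  rw [massive_trig, map_smul, inner_smul_right] at this
  rw [frame, ← this]
  have := (lam_pos hK j).ne'
  field_simp

theorem schrodingerEq_greenOp {V f : T2 → ℝ} (h : ∃ u, SchrodingerEq V u f) :
    SchrodingerEq V (greenOp V f) f := by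
  rw [greenOp, dif_pos h]
  exact h.choose_spec

/-- The quadratic form of the free covariance `(-Δ + K)⁻¹`. -/
theorem hasSum_greenOp_const {K : ℝ} (hK : 0 < K) (f : TestFn) :
    HasSum (fun j => (lam K j)⁻¹ * inner ℝ (ofT f) (frame j) ^ 2)
      (∫ x, greenOp (fun _ => K) f.1 x * f.1 x ∂torusMeasure) := by
  have h := schrodingerEq_greenOp (exists_schrodingerEq_const hK (memLp_testFn f))
  have h1 := hasSum_frame (h.1.toLp _) (ofT f)
  rw [inner_toLp_ofT] at h1
  convert h1 using 2 with j
  rw [h.inner_frame hK]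
  change _ = _ * inner ℝ (ofT f) (frame j) * _
  ring

/-! ### Gaussian Hilbert spaces -/

section Gaussian

open ProbabilityTheory
open scoped NNReal ENNReal

variable {Ω : Type*} [MeasurableSpace Ω] {μ : Measure Ω}

theorem integral_pow_four_gaussianReal (v : ℝ≥0) :
    ∫ x, x ^ 4 ∂(gaussianReal 0 v) = 3 * (v : ℝ) ^ 2 := by
  have h := iteratedDeriv_mgf_zero (X := id) (μ := gaussianReal 0 v)
    (by rw [integrableExpSet_id_gaussianReal]; simp) 4
  rw [mgf_id_gaussianReal] at h
  simp only [zero_mul, zero_add] at h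
  set E : ℝ → ℝ := fun t => Real.exp (v * t ^ 2 / 2) with hE
  have hd : ∀ t, HasDerivAt E (E t * (v * t)) t := fun t => by
    have h1 : HasDerivAt (fun t : ℝ => v * t ^ 2 / 2) (v * t) t := by
      have := (((hasDerivAt_id t).pow 2).const_mul (v : ℝ)).div_const 2
      refine this.congr_deriv ?_
      simp; ring
    exact h1.exp
  have hd' : ∀ (p p' : ℝ → ℝ), (∀ t, HasDerivAt p (p' t) t) →
      deriv (fun t => E t * p t) = fun t => E t * (v * t * p t + p' t) := fun p p' hp => by
    funext t
    have := ((hd t).mul (hp t)).deriv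
    exact this.trans (by ring)
  have e1 : deriv E = fun t => E t * (v * t) := funext fun t => (hd t).deriv
  have p1 : ∀ t : ℝ, HasDerivAt (fun t : ℝ => v * t) v t := fun t => by
    simpa using (hasDerivAt_id t).const_mul (v : ℝ)
  have p2 : ∀ t : ℝ, HasDerivAt (fun t : ℝ => v * t * (v * t) + v) (2 * v ^ 2 * t) t := fun t => by
    exact (((p1 t).mul (p1 t)).add_const (v : ℝ)).congr_deriv (by ring)
  have p3 : ∀ t : ℝ, HasDerivAt (fun t : ℝ => v * t * (v * t * (v * t) + v) + 2 * v ^ 2 * t)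
      (v * (v * t * (v * t) + v) + v * t * (2 * v ^ 2 * t) + 2 * v ^ 2) t := fun t => by
    exact (((p1 t).mul (p2 t)).add ((hasDerivAt_id t).const_mul (2 * (v : ℝ) ^ 2))).congr_deriv
      (by ring)
  rw [iteratedDeriv_eq_iterate] at h
  simp only [Function.iterate_succ, Function.iterate_zero, Function.comp, id, e1] at h
  rw [hd' _ _ p1, hd' _ _ p2, hd' _ _ p3] at h
  simp only [hE] at h
  rw [← show ∫ x, (id ^ 4 : ℝ → ℝ) x ∂(gaussianReal 0 v) = ∫ x, x ^ 4 ∂(gaussianReal 0 v) from rfl,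
    ← h]
  simp; ring

/-- A subspace of `L²(μ)` is Gaussian if each of its elements is a centred Gaussian variable, whose
variance is then the square of its norm. -/
def IsGaussianSpace (H : Submodule ℝ (Lp ℝ 2 μ)) : Prop :=
  ∀ h ∈ H, μ.map h = gaussianReal 0 (‖h‖₊ ^ 2)

theorem charFun_map_coeFn (h : Lp ℝ 2 μ) (t : ℝ) :
    charFun (μ.map h) t = ∫ w, Complex.exp (((t • h : Lp ℝ 2 μ) w : ℝ) * Complex.I) ∂μ := by
  rw [charFun_apply_real, integral_map (Lp.aestronglyMeasurable h).aemeasurable (by fun_prop)]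
  refine integral_congr_ae ?_
  filter_upwards [Lp.coeFn_smul t h] with w hw
  rw [hw]
  simp

variable {H : Submodule ℝ (Lp ℝ 2 μ)}

theorem IsGaussianSpace.memLp_four (hH : IsGaussianSpace H) {h : Lp ℝ 2 μ} (hh : h ∈ H) :
    MemLp h 4 μ := by
  have h1 := memLp_id_gaussianReal' (μ := 0) (v := ‖h‖₊ ^ 2) 4 (by simp)
  rw [← hH h hh] at h1
  exact (memLp_map_measure_iff h1.1 (Lp.aestronglyMeasurable h).aemeasurable).1 h1

theorem IsGaussianSpace.integral_pow_four (hH : IsGaussianSpace H) {h : Lp ℝ 2 μ} (hh : h ∈ H) :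
    ∫ w, h w ^ 4 ∂μ = 3 * ‖h‖ ^ 4 := by
  have h1 := integral_pow_four_gaussianReal (‖h‖₊ ^ 2)
  rw [← hH h hh, integral_map (Lp.aestronglyMeasurable h).aemeasurable (by fun_prop)] at h1
  rw [h1]
  push_cast; ring

theorem IsGaussianSpace.memLp_sq (hH : IsGaussianSpace H) {h : Lp ℝ 2 μ} (hh : h ∈ H) :
    MemLp (fun w => h w ^ 2) 2 μ := by
  have := (hH.memLp_four hh).mul (p := 4) (q := 4) (r := 2) (hH.memLp_four hh)
    (hpqr := ⟨by
      rw [← two_mul, show (4 : ℝ≥0∞) = 2 * 2 by norm_num, ENNReal.mul_inv (by simp) (by simp),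
        ← mul_assoc, ENNReal.mul_inv_cancel (by simp) (by simp), one_mul]⟩)
  refine this.ae_eq (ae_of_all _ fun w => ?_)
  simp [sq]

/-- Wick's formula `E[h²k²] = ‖h‖²‖k‖² + 2⟨h,k⟩²`, by polarisation of the fourth moment. -/
theorem IsGaussianSpace.integral_sq_mul_sq (hH : IsGaussianSpace H) {h k : Lp ℝ 2 μ} (hh : h ∈ H)
    (hk : k ∈ H) :
    ∫ w, h w ^ 2 * k w ^ 2 ∂μ = ‖h‖ ^ 2 * ‖k‖ ^ 2 + 2 * inner ℝ h k ^ 2 := by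
  have i4 : ∀ {h : Lp ℝ 2 μ}, h ∈ H → Integrable (fun w => h w ^ 4) μ := fun {h} hh => by
    have := (hH.memLp_sq hh).integrable_sq
    refine this.congr (ae_of_all _ fun w => ?_)
    simp only; ring
  have i22 : Integrable (fun w => h w ^ 2 * k w ^ 2) μ :=
    (hH.memLp_sq hh).integrable_mul (hH.memLp_sq hk)
  have h1 := hH.integral_pow_four (H.add_mem hh hk)
  have h2 := hH.integral_pow_four (H.sub_mem hh hk)
  have h3 : ∫ w, (h + k) w ^ 4 + (h - k) w ^ 4 ∂μ
      = ∫ w, 2 * h w ^ 4 + 12 * (h w ^ 2 * k w ^ 2) + 2 * k w ^ 4 ∂μ := by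
    refine integral_congr_ae ?_
    filter_upwards [Lp.coeFn_sub h k, Lp.coeFn_add h k] with w ha hb
    rw [ha, hb, Pi.add_apply, Pi.sub_apply]
    ring
  have j1 : Integrable (fun w => 2 * h w ^ 4 + 12 * (h w ^ 2 * k w ^ 2)) μ :=
    ((i4 hh).const_mul 2).add (i22.const_mul 12)
  rw [integral_add (i4 (H.add_mem hh hk)) (i4 (H.sub_mem hh hk)), h1, h2,
    integral_add j1 ((i4 hk).const_mul 2),
    integral_add ((i4 hh).const_mul 2) (i22.const_mul 12), integral_const_mul, integral_const_mul,
    integral_const_mul, hH.integral_pow_four hh, hH.integral_pow_four hk] at h3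
  have e1 : ‖h + k‖ ^ 4 = (‖h‖ ^ 2 + 2 * inner ℝ h k + ‖k‖ ^ 2) ^ 2 := by
    rw [← norm_add_sq_real]; ring
  have e2 : ‖h - k‖ ^ 4 = (‖h‖ ^ 2 - 2 * inner ℝ h k + ‖k‖ ^ 2) ^ 2 := by
    rw [← norm_sub_sq_real]; ring
  rw [e1, e2] at h3
  linarith

variable [IsProbabilityMeasure μ]

/-- A subspace of `L²(μ)` is Gaussian if its characteristic functional is Gaussian. -/
theorem isGaussianSpace_of_charFun
    (hH : ∀ h ∈ H, ∫ w, Complex.exp ((h w : ℝ) * Complex.I) ∂μ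
      = Complex.exp (-((‖h‖ ^ 2 / 2 : ℝ) : ℂ))) : IsGaussianSpace H := by
  intro h hh
  have := Measure.isProbabilityMeasure_map (μ := μ) (Lp.aestronglyMeasurable h).aemeasurable
  refine Measure.ext_of_charFun (funext fun t => ?_)
  rw [charFun_map_coeFn, hH _ (H.smul_mem t hh), charFun_gaussianReal]
  congr 1
  rw [norm_smul, mul_pow, Real.norm_eq_abs, sq_abs]
  push_cast
  simp; ring

theorem norm_cexp_sub_le (a b : ℝ) :
    ‖Complex.exp (a * Complex.I) - Complex.exp (b * Complex.I)‖ ≤ |a - b| := by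
  have h : Complex.exp (a * Complex.I) - Complex.exp (b * Complex.I)
      = Complex.exp (b * Complex.I) * (Complex.exp (Complex.I * ((a - b : ℝ) : ℂ)) - 1) := by
    rw [mul_sub, ← Complex.exp_add, mul_one]
    congr 2
    push_cast; ring
  rw [h, norm_mul, Complex.norm_exp_ofReal_mul_I, one_mul]
  exact Real.norm_exp_I_mul_ofReal_sub_one_le

theorem integral_abs_le_norm (h : Lp ℝ 2 μ) : ∫ w, |h w| ∂μ ≤ ‖h‖ := by
  have h1 : MemLp (fun w => |h w|) 2 μ := (Lp.memLp h).abs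
  have h0 := ProbabilityTheory.variance_nonneg (fun w => |h w|) μ
  rw [variance_eq_sub h1] at h0
  have h2 : ∫ w, |h w| ^ 2 ∂μ = ‖h‖ ^ 2 := by
    rw [norm_sq_L2_eq]; simp
  have h3 : (∫ w, |h w| ∂μ) ^ 2 ≤ ‖h‖ ^ 2 := by
    rw [← h2]
    simpa using h0
  exact le_of_sq_le_sq h3 (norm_nonneg _)

theorem integrable_cexp_coeFn (h : Lp ℝ 2 μ) :
    Integrable (fun w => Complex.exp ((h w : ℝ) * Complex.I)) μ := by
  refine Integrable.of_bound (C := 1) ?_ (ae_of_all _ fun w => ?_)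
  · have := Lp.aestronglyMeasurable h
    exact (Complex.continuous_exp.comp (by fun_prop : Continuous fun x : ℝ =>
      (x : ℂ) * Complex.I)).comp_aestronglyMeasurable this
  · rw [Complex.norm_exp_ofReal_mul_I]

theorem continuous_integral_cexp :
    Continuous fun h : Lp ℝ 2 μ => ∫ w, Complex.exp ((h w : ℝ) * Complex.I) ∂μ := by
  refine LipschitzWith.continuous (K := 1) (LipschitzWith.of_dist_le_mul fun h k => ?_)
  rw [dist_eq_norm, dist_eq_norm, NNReal.coe_one, one_mul,
    ← integral_sub (integrable_cexp_coeFn h) (integrable_cexp_coeFn k)]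
  refine (norm_integral_le_integral_norm _).trans (le_trans ?_ (integral_abs_le_norm (h - k)))
  refine integral_mono_ae ((integrable_cexp_coeFn h).sub (integrable_cexp_coeFn k)).norm
    ((Lp.memLp (h - k)).integrable one_le_two).abs ?_
  filter_upwards [Lp.coeFn_sub h k] with w hw
  simp only [hw, Pi.sub_apply]
  exact norm_cexp_sub_le _ _

/-- The closure of a subspace with Gaussian characteristic functional is Gaussian. -/
theorem isGaussianSpace_topologicalClosure
    (hH : ∀ h ∈ H, ∫ w, Complex.exp ((h w : ℝ) * Complex.I) ∂μ
      = Complex.exp (-((‖h‖ ^ 2 / 2 : ℝ) : ℂ))) : IsGaussianSpace H.topologicalClosure := by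
  refine isGaussianSpace_of_charFun fun h hh => ?_
  have hc : IsClosed {h : Lp ℝ 2 μ | ∫ w, Complex.exp ((h w : ℝ) * Complex.I) ∂μ
      = Complex.exp (-((‖h‖ ^ 2 / 2 : ℝ) : ℂ))} :=
    isClosed_eq continuous_integral_cexp (by fun_prop)
  exact closure_minimal hH hc hh

/-- The Wick square `:h²: = h² - ‖h‖²`. -/
def wick (h : Lp ℝ 2 μ) (w : Ω) : ℝ := h w ^ 2 - ‖h‖ ^ 2

theorem IsGaussianSpace.memLp_wick (hH : IsGaussianSpace H) {h : Lp ℝ 2 μ} (hh : h ∈ H) :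
    MemLp (wick h) 2 μ := (hH.memLp_sq hh).sub (memLp_const _)

theorem IsGaussianSpace.integral_wick_mul_wick (hH : IsGaussianSpace H) {h k : Lp ℝ 2 μ}
    (hh : h ∈ H) (hk : k ∈ H) : ∫ w, wick h w * wick k w ∂μ = 2 * inner ℝ h k ^ 2 := by
  have i2 : ∀ {h : Lp ℝ 2 μ}, h ∈ H → Integrable (fun w => h w ^ 2) μ := fun {h} hh =>
    (hH.memLp_sq hh).integrable one_le_two
  have i22 : Integrable (fun w => h w ^ 2 * k w ^ 2) μ :=
    (hH.memLp_sq hh).integrable_mul (hH.memLp_sq hk)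
  have h1 : ∀ w, wick h w * wick k w = h w ^ 2 * k w ^ 2 - ‖k‖ ^ 2 * h w ^ 2 - ‖h‖ ^ 2 * k w ^ 2
      + ‖h‖ ^ 2 * ‖k‖ ^ 2 := fun w => by unfold wick; ring
  simp only [h1]
  have j1 : Integrable (fun w => h w ^ 2 * k w ^ 2 - ‖k‖ ^ 2 * h w ^ 2) μ :=
    i22.sub ((i2 hh).const_mul _)
  have j2 : Integrable (fun w => h w ^ 2 * k w ^ 2 - ‖k‖ ^ 2 * h w ^ 2 - ‖h‖ ^ 2 * k w ^ 2) μ :=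
    j1.sub ((i2 hk).const_mul _)
  rw [integral_add j2 (integrable_const _), integral_sub j1 ((i2 hk).const_mul _),
    integral_sub i22 ((i2 hh).const_mul _), integral_const_mul, integral_const_mul,
    hH.integral_sq_mul_sq hh hk, ← norm_sq_L2_eq, ← norm_sq_L2_eq]
  simp; ring

theorem IsGaussianSpace.iIndepFun (hH : IsGaussianSpace H) {ι : Type*} [Fintype ι]
    {e : ι → Lp ℝ 2 μ} (he : Orthonormal ℝ e) (heH : ∀ i, e i ∈ H) :
    iIndepFun (fun i => (e i : Ω → ℝ)) μ := by
  have hm : ∀ i, AEMeasurable (e i) μ := fun i => (Lp.aestronglyMeasurable (e i)).aemeasurable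
  refine (iIndepFun_iff_charFun_pi hm).2 fun t => ?_
  have hmem : ∑ i, t i • e i ∈ H := H.sum_mem fun i _ => H.smul_mem _ (heH i)
  have h1 : charFun (μ.map fun w => WithLp.toLp 2 fun i => e i w) t
      = charFun (μ.map (∑ i, t i • e i : Lp ℝ 2 μ)) 1 := by
    rw [charFun_map_coeFn, charFun_apply, integral_map (by fun_prop) (by fun_prop), one_smul]
    refine integral_congr_ae ?_
    have hs := Lp.coeFn_finsetSum (p := 2) (μ := μ) Finset.univ fun i => t i • e i
    have ha : ∀ᵐ w ∂μ, ∀ i, (t i • e i : Lp ℝ 2 μ) w = t i * e i w := by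
      rw [ae_all_iff]
      exact fun i => Lp.coeFn_smul (t i) (e i)
    filter_upwards [hs, ha] with w h1 h2
    rw [h1, Finset.sum_apply]
    simp only [h2]
    simp [PiLp.inner_apply]
  rw [h1, hH _ hmem, charFun_gaussianReal]
  simp only [hH _ (heH _), charFun_gaussianReal, ← Complex.exp_sum]
  congr 1
  have h2 : ‖∑ i, t i • e i‖ ^ 2 = ∑ i, t i ^ 2 := by
    rw [← real_inner_self_eq_norm_sq, he.inner_sum]
    simp [sq]
  have h3 : ((‖∑ i, t i • e i‖ : ℝ) : ℂ) ^ 2 = ∑ i, (t i : ℂ) ^ 2 := by exact_mod_cast h2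
  simp [he.1, h3, Finset.sum_div]

end Gaussian

section Density

open ProbabilityTheory
open scoped NNReal ENNReal

/-! ### Exponentials of Wick squares -/

/-- The normalisation `E[exp (-l (ξ² - 1) / 2)]` for a standard Gaussian variable `ξ`. -/
def wickFactor (l : ℝ) : ℝ := Real.exp (l / 2) * (√(1 + l))⁻¹

theorem wickFactor_pos {l : ℝ} (hl : 0 < 1 + l) : 0 < wickFactor l := by
  unfold wickFactor; positivity

/-- The renormalisation makes the factor quadratic in `l` near `0`; this is why products of such
factors converge for square summable `l`. -/
theorem wickFactor_le {l d : ℝ} (hd : 0 < d) (hl : d ≤ 1 + l) :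
    wickFactor l ≤ Real.exp (l ^ 2 / (2 * d)) := by
  have h1 : 0 < 1 + l := hd.trans_le hl
  have h2 : (√(1 + l))⁻¹ = Real.exp (-(Real.log (1 + l) / 2)) := by
    rw [Real.exp_neg, Real.exp_half, Real.exp_log h1]
  rw [wickFactor, h2, ← Real.exp_add, Real.exp_le_exp]
  have h3 := Real.one_sub_inv_le_log_of_pos h1
  have h4 : l - (1 - (1 + l)⁻¹) = l ^ 2 / (1 + l) := by field_simp; ring
  have h5 : l ^ 2 / (1 + l) ≤ l ^ 2 / d := by gcongr
  have h6 : l ^ 2 / (2 * d) = l ^ 2 / d / 2 := by field_simp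
  rw [h6]
  linarith

theorem integral_cexp_mul_exp_gaussianReal (a : ℝ) {l : ℝ} (hl : 0 < 1 + l) :
    ∫ x : ℝ, Complex.exp ((a * x : ℝ) * Complex.I) * (Real.exp (-(1 / 2) * (l * (x ^ 2 - 1))) : ℂ)
        ∂(gaussianReal 0 1)
      = ((wickFactor l * Real.exp (-(1 / 2) * (a ^ 2 / (1 + l))) : ℝ) : ℂ) := by
  rw [integral_gaussianReal_eq_integral_smul one_ne_zero]
  have hb : (-((1 + l) / 2 : ℝ) : ℂ).re < 0 := by
    rw [Complex.neg_re, Complex.ofReal_re]; linarith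
  have h1 : ∀ x : ℝ, gaussianPDFReal 0 1 x • (Complex.exp ((a * x : ℝ) * Complex.I)
      * (Real.exp (-(1 / 2) * (l * (x ^ 2 - 1))) : ℂ))
      = (((√(2 * Real.pi))⁻¹ : ℝ) : ℂ) * Complex.exp
        ((-((1 + l) / 2 : ℝ) : ℂ) * x ^ 2 + (a * Complex.I) * x + (l / 2 : ℝ)) := fun x => by
    rw [gaussianPDFReal, Complex.real_smul, Complex.ofReal_mul, mul_assoc, Complex.ofReal_exp,
      Complex.ofReal_exp, ← Complex.exp_add, ← Complex.exp_add]
    congr 2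
    · simp
    · push_cast; ring
  simp only [h1]
  rw [integral_const_mul, integral_cexp_quadratic hb]
  have h2 : (Real.pi / -(-((1 + l) / 2 : ℝ) : ℂ)) ^ (1 / 2 : ℂ)
      = ((√(Real.pi / ((1 + l) / 2)) : ℝ) : ℂ) := by
    rw [neg_neg, Real.sqrt_eq_rpow, Complex.ofReal_cpow (by positivity)]
    push_cast; rfl
  have h3 : ((l / 2 : ℝ) : ℂ) - (a * Complex.I) ^ 2 / (4 * (-((1 + l) / 2 : ℝ) : ℂ))
      = ((l / 2 + -(1 / 2) * (a ^ 2 / (1 + l)) : ℝ) : ℂ) := by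
    have : (1 + l : ℂ) ≠ 0 := by exact_mod_cast hl.ne'
    push_cast
    rw [mul_pow, Complex.I_sq]
    field_simp
    ring
  rw [h2, h3, ← Complex.ofReal_exp, ← Complex.ofReal_mul, ← Complex.ofReal_mul, Real.exp_add,
    wickFactor]
  congr 1
  have h4 : √(Real.pi / ((1 + l) / 2)) = √(2 * Real.pi) * (√(1 + l))⁻¹ := by
    rw [← Real.sqrt_inv, ← Real.sqrt_mul (by positivity)]
    congr 1
    field_simp
  rw [h4]
  have : √(2 * Real.pi) ≠ 0 := by positivity
  field_simp

variable {Ω : Type*} [MeasurableSpace Ω] {μ : Measure Ω}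

/-- A sequence that is bounded in `L^p` for some `p > 1` is uniformly integrable, so that almost sure
convergence implies convergence of the integrals. -/
theorem tendsto_integral_of_bounded_rpow [IsFiniteMeasure μ] {W : ℕ → Ω → ℂ} {W' : Ω → ℂ} {p B : ℝ}
    (hp : 1 < p)
    (hm : ∀ n, AEStronglyMeasurable (W n) μ) (hi : ∀ n, Integrable (fun x => ‖W n x‖ ^ p) μ)
    (hB : ∀ n, ∫ x, ‖W n x‖ ^ p ∂μ ≤ B)
    (hW : ∀ᵐ x ∂μ, Tendsto (fun n => W n x) atTop (𝓝 (W' x))) :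
    Integrable W' μ ∧ Tendsto (fun n => ∫ x, W n x ∂μ) atTop (𝓝 (∫ x, W' x ∂μ)) := by
  have hB0 : 0 ≤ B := (integral_nonneg fun x => by positivity).trans (hB 0)
  have hpl : ∀ n, ∫⁻ x, ENNReal.ofReal (‖W n x‖ ^ p) ∂μ ≤ ENNReal.ofReal B := fun n => by
    rw [← ofReal_integral_eq_lintegral_ofReal (hi n) (ae_of_all _ fun x => by positivity)]
    exact ENNReal.ofReal_le_ofReal (hB n)
  -- Markov's inequality in the form `r 1_{r ≥ C} ≤ C^{1-p} r^p`.
  have key : ∀ (C : ℝ), 0 < C → ∀ n x, {x | C.toNNReal ≤ ‖W n x‖₊}.indicator (fun x => ‖W n x‖ₑ) x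
      ≤ ENNReal.ofReal (C ^ (1 - p)) * ENNReal.ofReal (‖W n x‖ ^ p) := fun C hC n x => by
    by_cases hx : x ∈ {x | C.toNNReal ≤ ‖W n x‖₊}
    · rw [Set.indicator_of_mem hx]
      have hx' : C ≤ ‖W n x‖ := by
        have : C.toNNReal ≤ ‖W n x‖₊ := hx
        rwa [← NNReal.coe_le_coe, Real.coe_toNNReal _ hC.le, coe_nnnorm] at this
      rw [← ofReal_norm, ← ENNReal.ofReal_mul (by positivity)]
      refine ENNReal.ofReal_le_ofReal ?_
      have hr : 0 < ‖W n x‖ := hC.trans_le hx'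
      have h1 : ‖W n x‖ ^ (1 - p) ≤ C ^ (1 - p) :=
        Real.rpow_le_rpow_of_nonpos hC hx' (by linarith)
      calc ‖W n x‖ = ‖W n x‖ ^ (1 - p) * ‖W n x‖ ^ p := by
            rw [← Real.rpow_add hr]; simp
        _ ≤ _ := by gcongr
    · rw [Set.indicator_of_notMem hx]; exact zero_le
  have key2 : ∀ (C : ℝ), 0 < C → ∀ n,
      eLpNorm ({x | C.toNNReal ≤ ‖W n x‖₊}.indicator (W n)) 1 μ
        ≤ ENNReal.ofReal (C ^ (1 - p) * B) := fun C hC n => by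
    rw [eLpNorm_one_eq_lintegral_enorm, ENNReal.ofReal_mul (by positivity)]
    simp only [enorm_indicator_eq_indicator_enorm]
    calc _ ≤ ∫⁻ x, ENNReal.ofReal (C ^ (1 - p)) * ENNReal.ofReal (‖W n x‖ ^ p) ∂μ :=
          lintegral_mono (key C hC n)
      _ = ENNReal.ofReal (C ^ (1 - p)) * ∫⁻ x, ENNReal.ofReal (‖W n x‖ ^ p) ∂μ :=
          lintegral_const_mul' _ _ ENNReal.ofReal_ne_top
      _ ≤ _ := by gcongr; exact hpl n
  have hui : UnifIntegrable W 1 μ := by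
    refine unifIntegrable_of le_rfl ENNReal.one_ne_top hm fun ε hε => ?_
    have ht : Tendsto (fun C : ℝ => C ^ (1 - p) * B) atTop (𝓝 (0 * B)) := by
      have := tendsto_rpow_neg_atTop (y := p - 1) (by linarith)
      simp only [neg_sub] at this
      exact this.mul_const B
    rw [zero_mul] at ht
    obtain ⟨C, hC, hC0⟩ := ((ht.eventually (ge_mem_nhds hε)).and (eventually_gt_atTop 0)).exists
    exact ⟨C.toNNReal, fun n => (key2 C hC0 n).trans (ENNReal.ofReal_le_ofReal hC)⟩
  have hbd : ∀ n, eLpNorm (W n) 1 μ ≤ μ Set.univ + ENNReal.ofReal B := fun n => by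
    rw [eLpNorm_one_eq_lintegral_enorm]
    calc _ ≤ ∫⁻ x, 1 + ENNReal.ofReal (‖W n x‖ ^ p) ∂μ := by
          refine lintegral_mono fun x => ?_
          by_cases hx : x ∈ {x | (1 : ℝ).toNNReal ≤ ‖W n x‖₊}
          · have := key 1 one_pos n x
            rw [Set.indicator_of_mem hx] at this
            simp only [Real.one_rpow, ENNReal.ofReal_one, one_mul] at this
            exact this.trans le_add_self
          · have : ‖W n x‖ₑ ≤ 1 := by
              simp only [Real.toNNReal_one, Set.mem_ofPred_eq, not_le] at hx
              rw [enorm_eq_nnnorm]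
              exact_mod_cast hx.le
            exact this.trans le_self_add
      _ = μ Set.univ + ∫⁻ x, ENNReal.ofReal (‖W n x‖ ^ p) ∂μ := by
          rw [lintegral_add_left measurable_const]; simp
      _ ≤ _ := by gcongr; exact hpl n
  have hW'm : AEStronglyMeasurable W' μ := aestronglyMeasurable_of_tendsto_ae atTop hm hW
  have hW' : MemLp W' 1 μ := ⟨hW'm, (Lp.eLpNorm_le_of_ae_tendsto
    (Eventually.of_forall hbd) hm hW).trans_lt (by simp [measure_lt_top])⟩
  have hWn : ∀ n, Integrable (W n) μ := fun n =>
    memLp_one_iff_integrable.1 ⟨hm n, (hbd n).trans_lt (by simp [measure_lt_top])⟩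
  refine ⟨memLp_one_iff_integrable.1 hW', ?_⟩
  exact tendsto_integral_of_L1' _ hW'm (Eventually.of_forall hWn)
    (tendsto_Lp_finite_of_tendsto_ae le_rfl ENNReal.one_ne_top hm hW' hui hW)

/-- Three series over an index set of arbitrary cardinality can be summed along a common sequence of
finite sets. Dominated convergence and its variants need such a sequence. -/
theorem exists_seq_tendsto_of_hasSum {ι : Type*} {f₁ f₂ f₃ : ι → ℝ} {a₁ a₂ a₃ : ℝ}
    (h₁ : HasSum f₁ a₁) (h₂ : HasSum f₂ a₂) (h₃ : HasSum f₃ a₃) :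
    ∃ s : ℕ → Finset ι, Tendsto (fun n => ∑ i ∈ s n, f₁ i) atTop (𝓝 a₁) ∧
      Tendsto (fun n => ∑ i ∈ s n, f₂ i) atTop (𝓝 a₂) ∧
      Tendsto (fun n => ∑ i ∈ s n, f₃ i) atTop (𝓝 a₃) := by
  have h : ∀ n : ℕ, ∃ s : Finset ι, |∑ i ∈ s, f₁ i - a₁| < 1 / ((n : ℝ) + 1) ∧
      |∑ i ∈ s, f₂ i - a₂| < 1 / ((n : ℝ) + 1) ∧ |∑ i ∈ s, f₃ i - a₃| < 1 / ((n : ℝ) + 1) := by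
    intro n
    have hn : 0 < 1 / ((n : ℝ) + 1) := by positivity
    have e : ∀ {f : ι → ℝ} {a : ℝ}, HasSum f a →
        ∀ᶠ s : Finset ι in atTop, |∑ i ∈ s, f i - a| < 1 / ((n : ℝ) + 1) := fun hf =>
      (Metric.tendsto_nhds.1 hf) _ hn
    exact ((e h₁).and ((e h₂).and (e h₃))).exists
  choose s hs using h
  have e : ∀ {u : ℕ → ℝ} {a : ℝ}, (∀ n, |u n - a| < 1 / ((n : ℝ) + 1)) →
      Tendsto u atTop (𝓝 a) := fun h =>
    tendsto_iff_dist_tendsto_zero.2 (squeeze_zero (fun _ => dist_nonneg) (fun n => (h n).le)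
      tendsto_one_div_add_atTop_nhds_zero_nat)
  exact ⟨s, e fun n => (hs n).1, e fun n => (hs n).2.1, e fun n => (hs n).2.2⟩

/-- The finite chaos sum `∑ i ∈ s, l i (e i ² - 1)`. -/
def chaosSum {ι : Type*} (e : ι → Lp ℝ 2 μ) (l : ι → ℝ) (s : Finset ι) (w : Ω) : ℝ :=
  ∑ i ∈ s, l i * (e i w ^ 2 - 1)

variable {H : Submodule ℝ (Lp ℝ 2 μ)} {ι : Type*} {e : ι → Lp ℝ 2 μ}

theorem aestronglyMeasurable_chaosSum (l : ι → ℝ) (s : Finset ι) :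
    AEStronglyMeasurable (chaosSum e l s) μ := by
  refine Finset.aestronglyMeasurable_fun_sum s fun i _ => ?_
  exact (((Lp.aestronglyMeasurable (e i)).pow 2).sub aestronglyMeasurable_const).const_mul _

theorem IsGaussianSpace.memLp_chaosSum [IsProbabilityMeasure μ] (hH : IsGaussianSpace H)
    (heH : ∀ i, e i ∈ H) (l : ι → ℝ) (s : Finset ι) : MemLp (chaosSum e l s) 2 μ :=
  memLp_finsetSum s fun i _ => ((hH.memLp_sq (heH i)).sub (memLp_const 1)).const_mul (l i)

/-- The joint Laplace–Fourier transform of linear and diagonal quadratic functionals of finitely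
many independent standard Gaussian variables. -/
theorem IsGaussianSpace.integral_cexp_mul_exp_chaosSum [IsProbabilityMeasure μ]
    (hH : IsGaussianSpace H) (he : Orthonormal ℝ e) (heH : ∀ i, e i ∈ H) (a : ι → ℝ) {l : ι → ℝ}
    (hl : ∀ i, 0 < 1 + l i) (s : Finset ι) :
    ∫ w, Complex.exp ((∑ i ∈ s, a i * e i w : ℝ) * Complex.I)
        * (Real.exp (-(1 / 2) * chaosSum e l s w) : ℂ) ∂μ
      = (((∏ i ∈ s, wickFactor (l i)) * Real.exp (-(1 / 2) * ∑ i ∈ s, a i ^ 2 / (1 + l i)) : ℝ)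
          : ℂ) := by
  have hind := hH.iIndepFun (e := fun i : s => e i) (he.comp _ Subtype.val_injective)
    fun i => heH i
  have h := hind.integral_fun_prod_comp (𝕜 := ℂ) (f := fun (i : s) (x : ℝ) =>
      Complex.exp ((a i * x : ℝ) * Complex.I)
        * (Real.exp (-(1 / 2) * (l i * (x ^ 2 - 1))) : ℂ))
    (fun i => (Lp.aestronglyMeasurable (e i)).aemeasurable) fun i => by
      refine Continuous.aestronglyMeasurable ?_
      fun_prop
  have h1 : ∀ w, Complex.exp ((∑ i ∈ s, a i * e i w : ℝ) * Complex.I)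
        * (Real.exp (-(1 / 2) * chaosSum e l s w) : ℂ)
      = ∏ i : s, Complex.exp ((a i * e i w : ℝ) * Complex.I)
        * (Real.exp (-(1 / 2) * (l i * (e i w ^ 2 - 1))) : ℂ) := fun w => by
    rw [Finset.prod_coe_sort s fun i => Complex.exp ((a i * e i w : ℝ) * Complex.I)
        * (Real.exp (-(1 / 2) * (l i * (e i w ^ 2 - 1))) : ℂ), Finset.prod_mul_distrib,
      ← Complex.exp_sum, ← Complex.ofReal_prod, ← Real.exp_sum, chaosSum, Finset.mul_sum,
      ← Finset.sum_mul, ← Complex.ofReal_sum]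
  have h2 : ∀ i : s, ∫ w, Complex.exp ((a i * e i w : ℝ) * Complex.I)
        * (Real.exp (-(1 / 2) * (l i * (e i w ^ 2 - 1))) : ℂ) ∂μ
      = ((wickFactor (l i) * Real.exp (-(1 / 2) * (a i ^ 2 / (1 + l i))) : ℝ) : ℂ) := fun i => by
    rw [← integral_cexp_mul_exp_gaussianReal (a i) (hl i)]
    have hmap := hH _ (heH i)
    rw [show ‖e i‖₊ = 1 from NNReal.eq (he.1 i), one_pow] at hmap
    rw [← hmap, integral_map (Lp.aestronglyMeasurable (e i)).aemeasurable]
    refine Continuous.aestronglyMeasurable ?_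
    fun_prop
  simp only [h1, h, h2]
  rw [Finset.prod_coe_sort s fun i =>
    ((wickFactor (l i) * Real.exp (-(1 / 2) * (a i ^ 2 / (1 + l i))) : ℝ) : ℂ),
    ← Complex.ofReal_prod, Finset.prod_mul_distrib, ← Real.exp_sum, Finset.mul_sum]

/-- Integrability is read off from the value of the integral, which is not zero. -/
theorem IsGaussianSpace.integrable_exp_chaosSum [IsProbabilityMeasure μ]
    (hH : IsGaussianSpace H) (he : Orthonormal ℝ e) (heH : ∀ i, e i ∈ H) {l : ι → ℝ}
    (hl : ∀ i, 0 < 1 + l i) (s : Finset ι) :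
    Integrable (fun w => Real.exp (-(1 / 2) * chaosSum e l s w)) μ ∧
      ∫ w, Real.exp (-(1 / 2) * chaosSum e l s w) ∂μ = ∏ i ∈ s, wickFactor (l i) := by
  have h := hH.integral_cexp_mul_exp_chaosSum he heH (fun _ => 0) hl s
  simp only [zero_mul, Finset.sum_const_zero, Complex.ofReal_zero, Complex.exp_zero, one_mul,
    ne_eq, OfNat.ofNat_ne_zero, not_false_eq_true, zero_pow, zero_div, mul_zero, Real.exp_zero,
    mul_one] at h
  rw [integral_complex_ofReal, Complex.ofReal_inj] at h
  refine ⟨?_, h⟩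
  by_contra hi
  rw [integral_undef hi] at h
  exact (Finset.prod_pos fun i _ => wickFactor_pos (hl i)).ne h

/-- A square summable family of numbers larger than `-1` is bounded away from `-1`. -/
theorem exists_spectral_gap {l : ι → ℝ} (hl : Summable fun i => l i ^ 2) (hl1 : ∀ i, 0 < 1 + l i) :
    ∃ c, 0 < c ∧ ∀ i, c ≤ 1 + l i := by
  have hf : {i | ¬ l i ^ 2 < 1 / 4}.Finite :=
    hl.tendsto_cofinite_zero.eventually (gt_mem_nhds (by norm_num : (0 : ℝ) < 1 / 4))
  have hout : ∀ i, i ∉ hf.toFinset → 1 / 2 ≤ 1 + l i := fun i hi => by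
    have : l i ^ 2 < 1 / 4 := by simpa using hi
    nlinarith
  by_cases hne : hf.toFinset.Nonempty
  · obtain ⟨k, -, hk⟩ := hf.toFinset.exists_min_image (fun i => 1 + l i) hne
    refine ⟨min (1 / 2) (1 + l k), lt_min (by norm_num) (hl1 k), fun i => ?_⟩
    by_cases hi : i ∈ hf.toFinset
    · exact (min_le_right _ _).trans (hk i hi)
    · exact (min_le_left _ _).trans (hout i hi)
  · exact ⟨1 / 2, by norm_num, fun i => hout i fun hi => hne ⟨i, hi⟩⟩

theorem exists_seq_tendsto_ae_of_integral {Z : ℕ → Ω → ℝ} (hZ : ∀ n, Integrable (Z n) μ)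
    (h0 : ∀ n w, 0 ≤ Z n w) (h : Tendsto (fun n => ∫ w, Z n w ∂μ) atTop (𝓝 0)) :
    ∃ ns : ℕ → ℕ, StrictMono ns ∧ ∀ᵐ w ∂μ, Tendsto (fun n => Z (ns n) w) atTop (𝓝 0) := by
  refine TendstoInMeasure.exists_seq_tendsto_ae (g := fun _ => (0 : ℝ))
    (tendstoInMeasure_of_tendsto_eLpNorm one_ne_zero (fun n => (hZ n).1)
      aestronglyMeasurable_const ?_)
  have e : ∀ n, eLpNorm (Z n - fun _ => (0 : ℝ)) 1 μ = ENNReal.ofReal (∫ w, Z n w ∂μ) := fun n => by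
    rw [show (Z n - fun _ => (0 : ℝ)) = Z n from sub_zero (Z n), eLpNorm_one_eq_lintegral_enorm,
      ofReal_integral_eq_lintegral_ofReal (hZ n) (ae_of_all _ (h0 n))]
    exact lintegral_congr fun w => Real.enorm_of_nonneg (h0 n w)
  simp only [e]
  simpa [Function.comp_def] using (ENNReal.continuous_ofReal.tendsto 0).comp h

/-- The Fourier transform of the density `exp (-X / 2)`, for a random variable `X` in the second
chaos with eigenvalues `l i > -1`. The finite chaos sums give explicit Gaussian integrals, and they
are bounded in some `L^p` with `p > 1`, because the `l i` are bounded away from `-1`; hence one may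
pass to the limit. The normalisation does not have to be computed. -/
theorem IsGaussianSpace.integral_cexp_mul_exp [IsProbabilityMeasure μ] (hH : IsGaussianSpace H)
    (he : Orthonormal ℝ e) (heH : ∀ i, e i ∈ H) {l : ι → ℝ} (hl : Summable fun i => l i ^ 2)
    (hl1 : ∀ i, 0 < 1 + l i) {X : Ω → ℝ} (hX : MemLp X 2 μ)
    (hXs : ∀ s : Finset ι, ∫ w, (X w - chaosSum e l s w) ^ 2 ∂μ
      ≤ 2 * (∑' i, l i ^ 2 - ∑ i ∈ s, l i ^ 2))
    {h : Lp ℝ 2 μ} (hh : HasSum (fun i => inner ℝ (e i) h ^ 2) (‖h‖ ^ 2)) :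
    Integrable (fun w => Real.exp (-(1 / 2) * X w)) μ ∧
    ∫ w, Complex.exp ((h w : ℝ) * Complex.I) * (Real.exp (-(1 / 2) * X w) : ℂ) ∂μ
      = ((∫ w, Real.exp (-(1 / 2) * X w) ∂μ : ℝ) : ℂ)
        * (Real.exp (-(1 / 2) * ∑' i, inner ℝ (e i) h ^ 2 / (1 + l i)) : ℂ) := by
  obtain ⟨c, hc, hcl⟩ := exists_spectral_gap hl hl1
  set a : ι → ℝ := fun i => inner ℝ (e i) h
  have hs3 : Summable fun i => a i ^ 2 / (1 + l i) := by
    refine Summable.of_nonneg_of_le (fun i => div_nonneg (sq_nonneg _) (hl1 i).le) (fun i => ?_)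
      (hh.summable.mul_left c⁻¹)
    rw [div_eq_inv_mul]
    exact mul_le_mul_of_nonneg_right (inv_anti₀ hc (hcl i)) (sq_nonneg _)
  obtain ⟨s, hsl, hsa, hsq⟩ := exists_seq_tendsto_of_hasSum hl.hasSum hh hs3.hasSum
  set hn : ℕ → Lp ℝ 2 μ := fun n => ∑ i ∈ s n, a i • e i
  have hnorm : ∀ n, ‖h - hn n‖ ^ 2 = ‖h‖ ^ 2 - ∑ i ∈ s n, a i ^ 2 := fun n => by
    have h1 : inner ℝ h (hn n) = ∑ i ∈ s n, a i ^ 2 := by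
      simp only [hn, inner_sum, inner_smul_right]
      refine Finset.sum_congr rfl fun i _ => ?_
      rw [real_inner_comm, sq]
    have h2 : ‖hn n‖ ^ 2 = ∑ i ∈ s n, a i ^ 2 := by
      rw [← real_inner_self_eq_norm_sq, he.inner_sum]
      simp [sq]
    rw [norm_sub_sq_real, h1, h2]; ring
  -- A single sequence of nonnegative variables controls both convergences.
  set Z : ℕ → Ω → ℝ := fun n w => (h - hn n) w ^ 2 + (X w - chaosSum e l (s n) w) ^ 2
  have hZ1 : ∀ n, Integrable (fun w => (h - hn n) w ^ 2) μ := fun n =>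
    (Lp.memLp (h - hn n)).integrable_sq
  have hZ2 : ∀ n, Integrable (fun w => (X w - chaosSum e l (s n) w) ^ 2) μ := fun n =>
    (hX.sub (hH.memLp_chaosSum heH l (s n))).integrable_sq
  have hZt : Tendsto (fun n => ∫ w, Z n w ∂μ) atTop (𝓝 0) := by
    refine squeeze_zero (fun n => integral_nonneg fun w => by positivity) (fun n => ?_)
      (g := fun n => (‖h‖ ^ 2 - ∑ i ∈ s n, a i ^ 2)
        + 2 * (∑' i, l i ^ 2 - ∑ i ∈ s n, l i ^ 2)) ?_
    · rw [integral_add (hZ1 n) (hZ2 n), ← norm_sq_L2_eq, hnorm]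
      linarith [hXs (s n)]
    · have := (hsa.const_sub (‖h‖ ^ 2)).add ((hsl.const_sub (∑' i, l i ^ 2)).const_mul 2)
      simpa using this
  obtain ⟨ns, hns, hae⟩ := exists_seq_tendsto_ae_of_integral (Z := Z)
    (fun n => (hZ1 n).add (hZ2 n)) (fun n w => by positivity) hZt
  have hnt := hns.tendsto_atTop
  have hcoe : ∀ᵐ w ∂μ, ∀ n, (h - hn n) w = h w - ∑ i ∈ s n, a i * e i w := by
    rw [ae_all_iff]
    intro n
    have ha : ∀ᵐ w ∂μ, ∀ i ∈ s n, (a i • e i : Lp ℝ 2 μ) w = a i * e i w := by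
      refine (ae_ball_iff (s n).countable_toSet).2 ?_
      exact fun i _ => Lp.coeFn_smul (a i) (e i)
    filter_upwards [Lp.coeFn_sub h (hn n), Lp.coeFn_finsetSum (p := 2) (μ := μ) (s n)
      fun i => a i • e i, ha] with w h1 h2 h3
    rw [h1, Pi.sub_apply, h2, Finset.sum_apply, Finset.sum_congr rfl h3]
  have hconv : ∀ᵐ w ∂μ, Tendsto (fun n => ∑ i ∈ s (ns n), a i * e i w) atTop (𝓝 (h w)) ∧
      Tendsto (fun n => chaosSum e l (s (ns n)) w) atTop (𝓝 (X w)) := by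
    filter_upwards [hae, hcoe] with w h1 h2
    have e1 : ∀ {u : ℕ → ℝ} {x : ℝ}, (∀ n, (x - u n) ^ 2 ≤ Z (ns n) w) →
        Tendsto u atTop (𝓝 x) := fun {u x} hu => by
      have h3 : Tendsto (fun n => (x - u n) ^ 2) atTop (𝓝 0) :=
        squeeze_zero (fun _ => sq_nonneg _) hu h1
      have h4 : Tendsto (fun n => |x - u n|) atTop (𝓝 0) := by
        have := (Real.continuous_sqrt.tendsto 0).comp h3
        simpa [Function.comp_def, Real.sqrt_sq_eq_abs] using this
      rw [tendsto_iff_dist_tendsto_zero]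
      simpa [Real.dist_eq, abs_sub_comm] using h4
    refine ⟨e1 fun n => ?_, e1 fun n => ?_⟩
    · simp only [Z, h2]
      linarith [sq_nonneg (X w - chaosSum e l (s (ns n)) w)]
    · simp only [Z]
      linarith [sq_nonneg ((h - hn (ns n)) w)]
  -- The exponent `p = 1 + c` keeps `1 + p l i` bounded below by `c²`.
  set p : ℝ := 1 + c
  have hpl : ∀ i, c ^ 2 ≤ 1 + p * l i := fun i => by
    have := hcl i
    simp only [p]
    nlinarith
  have hpl0 : ∀ i, 0 < 1 + p * l i := fun i => (by positivity : (0 : ℝ) < c ^ 2).trans_le (hpl i)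
  have hbound : ∀ (b : ℕ → Ω → ℝ),
      (∀ n, AEStronglyMeasurable (b n) μ) → ∀ {b' : Ω → ℝ},
      (∀ᵐ w ∂μ, Tendsto (fun n => b n w) atTop (𝓝 (b' w))) →
      Integrable (fun w => Complex.exp ((b' w : ℝ) * Complex.I)
        * (Real.exp (-(1 / 2) * X w) : ℂ)) μ ∧
      Tendsto (fun n => ∫ w, Complex.exp ((b n w : ℝ) * Complex.I)
          * (Real.exp (-(1 / 2) * chaosSum e l (s (ns n)) w) : ℂ) ∂μ) atTop
        (𝓝 (∫ w, Complex.exp ((b' w : ℝ) * Complex.I) * (Real.exp (-(1 / 2) * X w) : ℂ) ∂μ)) := by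
    intro b hb b' hbb
    have hn1 : ∀ n w, ‖Complex.exp ((b n w : ℝ) * Complex.I)
          * (Real.exp (-(1 / 2) * chaosSum e l (s (ns n)) w) : ℂ)‖ ^ p
        = Real.exp (-(1 / 2) * chaosSum e (fun i => p * l i) (s (ns n)) w) := fun n w => by
      rw [norm_mul, Complex.norm_exp_ofReal_mul_I, one_mul, Complex.norm_real, Real.norm_eq_abs,
        Real.abs_exp, ← Real.exp_mul]
      congr 1
      simp only [chaosSum, mul_assoc, ← Finset.mul_sum]
      ring
    have hint := fun n => hH.integrable_exp_chaosSum he heH hpl0 (s (ns n))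
    refine tendsto_integral_of_bounded_rpow (p := p)
      (B := Real.exp (∑' i, (p * l i) ^ 2 / (2 * c ^ 2))) (by simp [p, hc]) (fun n => ?_)
      (fun n => ?_) (fun n => ?_) ?_
    · refine AEStronglyMeasurable.mul ?_ ?_
      · exact (by fun_prop : Continuous fun x : ℝ =>
          Complex.exp ((x : ℂ) * Complex.I)).comp_aestronglyMeasurable (hb n)
      · exact (by fun_prop : Continuous fun x : ℝ =>
          (Real.exp (-(1 / 2) * x) : ℂ)).comp_aestronglyMeasurable
            (aestronglyMeasurable_chaosSum l (s (ns n)))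
    · simp only [hn1]
      exact (hint n).1
    · simp only [hn1]
      rw [(hint n).2]
      calc _ ≤ ∏ i ∈ s (ns n), Real.exp ((p * l i) ^ 2 / (2 * c ^ 2)) :=
            Finset.prod_le_prod (fun i _ => (wickFactor_pos (hpl0 i)).le)
              fun i _ => wickFactor_le (by positivity) (hpl i)
        _ = Real.exp (∑ i ∈ s (ns n), (p * l i) ^ 2 / (2 * c ^ 2)) := (Real.exp_sum _ _).symm
        _ ≤ _ := by
            refine Real.exp_le_exp.2 (Summable.sum_le_tsum _ (fun i _ => by positivity) ?_)
            simp only [mul_pow, mul_div_right_comm]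
            exact hl.mul_left _
    · filter_upwards [hconv, hbb] with w h1 h2
      exact ((by fun_prop : Continuous fun x : ℝ => Complex.exp ((x : ℂ) * Complex.I)).tendsto
        _ |>.comp h2).mul ((by fun_prop : Continuous fun x : ℝ =>
          (Real.exp (-(1 / 2) * x) : ℂ)).tendsto _ |>.comp h1.2)
  have hA := hbound (fun n w => ∑ i ∈ s (ns n), a i * e i w) (fun n =>
    Finset.aestronglyMeasurable_fun_sum _ fun i _ => (Lp.aestronglyMeasurable (e i)).const_mul _)
    (hconv.mono fun w hw => hw.1)
  have hB := hbound (fun _ _ => 0) (fun n => aestronglyMeasurable_const) (b' := fun _ => 0)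
    (ae_of_all _ fun w => tendsto_const_nhds)
  simp only [Complex.ofReal_zero, zero_mul, Complex.exp_zero, one_mul, integral_complex_ofReal] at hB
  refine ⟨hB.1.re, ?_⟩
  have hlim : Tendsto (fun n => (Real.exp (-(1 / 2) * ∑ i ∈ s (ns n), a i ^ 2 / (1 + l i)) : ℂ))
      atTop (𝓝 (Real.exp (-(1 / 2) * ∑' i, a i ^ 2 / (1 + l i)) : ℂ)) :=
    (by fun_prop : Continuous fun x : ℝ => (Real.exp (-(1 / 2) * x) : ℂ)).tendsto _
      |>.comp (hsq.comp hnt)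
  refine tendsto_nhds_unique hA.2 ((hB.2.mul hlim).congr fun n => ?_)
  rw [hH.integral_cexp_mul_exp_chaosSum he heH a hl1, (hH.integrable_exp_chaosSum he heH hl1 _).2]
  push_cast; rfl

end Density

/-! ### Hilbert–Schmidt operators and the spectral theorem -/

section Spectral

variable {E : Type*} [NormedAddCommGroup E] [InnerProductSpace ℝ E]
  {F : Type*} [NormedAddCommGroup F] [InnerProductSpace ℝ F] {ι : Type*}

theorem hasSum_inner_sq (b : HilbertBasis ι ℝ E) (v : E) :
    HasSum (fun i => inner ℝ (b i) v ^ 2) (‖v‖ ^ 2) := by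
  have h := b.hasSum_inner_mul_inner v v
  rw [real_inner_self_eq_norm_sq] at h
  have e : (fun i => inner ℝ (b i) v ^ 2) = fun i => inner ℝ v (b i) * inner ℝ (b i) v :=
    funext fun i => by rw [real_inner_comm (b i) v, sq]
  rw [e]
  exact h

/-- The operator norm is bounded by the Hilbert–Schmidt norm. -/
theorem norm_sq_apply_le_of_hasSum (b : HilbertBasis ι ℝ E) (A : E →L[ℝ] F) {R : ℝ}
    (hR : HasSum (fun i => ‖A (b i)‖ ^ 2) R) (v : E) : ‖A v‖ ^ 2 ≤ R * ‖v‖ ^ 2 := by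
  have h1 : HasSum (fun i => inner ℝ (b i) v • A (b i)) (A v) := by
    have := (b.hasSum_repr v).mapL A
    simpa [b.repr_apply_apply] using this
  have h2 := hasSum_inner_sq b v
  refine le_of_tendsto (((continuous_norm.pow 2).tendsto _).comp h1)
    (Eventually.of_forall fun s => ?_)
  have h3 : ‖∑ i ∈ s, inner ℝ (b i) v • A (b i)‖ ≤ ∑ i ∈ s, ‖A (b i)‖ * |inner ℝ (b i) v| :=
    (norm_sum_le _ _).trans (Finset.sum_le_sum fun i _ => by
      rw [norm_smul, Real.norm_eq_abs, mul_comm])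
  calc ‖∑ i ∈ s, inner ℝ (b i) v • A (b i)‖ ^ 2
      ≤ (∑ i ∈ s, ‖A (b i)‖ * |inner ℝ (b i) v|) ^ 2 := by gcongr
    _ ≤ (∑ i ∈ s, ‖A (b i)‖ ^ 2) * ∑ i ∈ s, |inner ℝ (b i) v| ^ 2 :=
        Finset.sum_mul_sq_le_sq_mul_sq _ _ _
    _ ≤ R * ‖v‖ ^ 2 := by
        simp only [sq_abs]
        exact mul_le_mul (sum_le_hasSum s (fun _ _ => sq_nonneg _) hR)
          (sum_le_hasSum s (fun _ _ => sq_nonneg _) h2) (Finset.sum_nonneg fun _ _ => sq_nonneg _)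
          (hR.nonneg fun _ => sq_nonneg _)

/-- A Hilbert–Schmidt operator is a limit of operators of finite rank, hence compact. -/
theorem isCompactOperator_of_summable_sq [CompleteSpace F] (b : HilbertBasis ι ℝ E)
    (A : E →L[ℝ] F) (hA : Summable fun i => ‖A (b i)‖ ^ 2) : IsCompactOperator A := by
  classical
  set T : Finset ι → E →L[ℝ] F := fun s => ∑ i ∈ s, (innerSL ℝ (b i)).smulRight (A (b i))
  have hTb : ∀ s i, T s (b i) = if i ∈ s then A (b i) else 0 := fun s i => by
    simp only [T, sum_apply, ContinuousLinearMap.smulRight_apply,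
      innerSL_apply_apply, orthonormal_iff_ite.1 b.orthonormal]
    simp
  have hcomp : ∀ s, IsCompactOperator (T s) := fun s => by
    have h1 : ∀ i, IsCompactOperator ((innerSL ℝ (b i)).smulRight (A (b i))) := fun i => by
      have h2 : IsCompactOperator (ContinuousLinearMap.toSpanSingleton ℝ (A (b i))) :=
        isCompactOperator_of_locallyCompactSpace_rng _
      exact h2.comp_clm (innerSL ℝ (b i))
    exact Submodule.sum_mem (compactOperator (RingHom.id ℝ) E F) fun i _ => h1 i
  have hlim : Tendsto T atTop (𝓝 A) := by
    rw [tendsto_iff_norm_sub_tendsto_zero]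
    have hb : ∀ s, ‖T s - A‖ ≤ √(∑' i, ‖A (b i)‖ ^ 2 - ∑ i ∈ s, ‖A (b i)‖ ^ 2) := fun s => by
      refine ContinuousLinearMap.opNorm_le_bound _ (Real.sqrt_nonneg _) fun v => ?_
      have h1 : HasSum (fun i => ‖(T s - A) (b i)‖ ^ 2)
          (∑' i, ‖A (b i)‖ ^ 2 - ∑ i ∈ s, ‖A (b i)‖ ^ 2) := by
        have h2 := hasSum_sum_of_ne_finset_zero (s := s)
          (L := SummationFilter.unconditional ι)
          (f := fun i => if i ∈ s then ‖A (b i)‖ ^ 2 else 0) fun i hi => if_neg hi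
        rw [Finset.sum_congr rfl fun i hi => if_pos hi] at h2
        have h3 := hA.hasSum.sub h2
        have e : (fun i => ‖(T s - A) (b i)‖ ^ 2)
            = fun i => ‖A (b i)‖ ^ 2 - if i ∈ s then ‖A (b i)‖ ^ 2 else 0 := by
          funext i
          rw [sub_apply, hTb]
          split_ifs <;> simp
        rw [e]
        exact h3
      have h4 := norm_sq_apply_le_of_hasSum b _ h1 v
      rw [← Real.sqrt_sq (norm_nonneg v), ← Real.sqrt_mul (h1.nonneg fun _ => sq_nonneg _)]
      exact Real.le_sqrt_of_sq_le h4
    refine squeeze_zero (fun _ => norm_nonneg _) hb ?_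
    have h1 : Tendsto (fun s => ∑' i, ‖A (b i)‖ ^ 2 - ∑ i ∈ s, ‖A (b i)‖ ^ 2) atTop (𝓝 0) := by
      have : Tendsto (fun s => ∑ i ∈ s, ‖A (b i)‖ ^ 2) atTop (𝓝 (∑' i, ‖A (b i)‖ ^ 2)) := hA.hasSum
      rw [← sub_self (∑' i, ‖A (b i)‖ ^ 2)]
      exact this.const_sub _
    simpa using h1.sqrt
  exact isCompactOperator_of_tendsto hlim (Eventually.of_forall hcomp)

/-- A compact symmetric operator has a Hilbert basis of eigenvectors. -/
theorem exists_hilbertBasis_eigenvectors {E : Type} [NormedAddCommGroup E] [InnerProductSpace ℝ E]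
    [CompleteSpace E] (T : E →L[ℝ] E) (hT : IsCompactOperator T)
    (hs : (T : E →ₗ[ℝ] E).IsSymmetric) :
    ∃ (ι : Type) (b : HilbertBasis ι ℝ E) (l : ι → ℝ), ∀ i, T (b i) = l i • b i := by
  have hcl : ∀ m : ℝ, CompleteSpace (Module.End.eigenspace (T : Module.End ℝ E) m) := fun m => by
    have : IsClosed (Module.End.eigenspace (T : Module.End ℝ E) m : Set E) := by
      have h : (Module.End.eigenspace (T : Module.End ℝ E) m : Set E) = {x | T x = m • x} := by
        ext x
        simp
      rw [h]
      exact isClosed_eq T.continuous (continuous_const_smul m)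
    exact this.completeSpace_coe
  choose w c hc using fun m : ℝ =>
    exists_hilbertBasis ℝ (Module.End.eigenspace (T : Module.End ℝ E) m)
  have ho : Orthonormal ℝ fun a : Σ m : ℝ, w m => ((c a.1 a.2 :
      Module.End.eigenspace (T : Module.End ℝ E) a.1) : E) :=
    hs.orthogonalFamily_eigenspaces.orthonormal_sigma_orthonormal
      (v_family := fun m (i : w m) => c m i) fun m => (c m).orthonormal
  have hsp : (Submodule.span ℝ (Set.range fun a : Σ m : ℝ, w m => ((c a.1 a.2 :
      Module.End.eigenspace (T : Module.End ℝ E) a.1) : E)))ᗮ = ⊥ := by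
    rw [eq_bot_iff, ← ContinuousLinearMap.orthogonalComplement_iSup_eigenspaces_eq_bot hT hs]
    intro x hx
    rw [Submodule.mem_orthogonal] at hx ⊢
    intro y hy
    refine Submodule.iSup_induction (fun m => Module.End.eigenspace (T : Module.End ℝ E) m)
      (motive := fun y => inner ℝ y x = 0) hy (fun m y hy => ?_) (inner_zero_left _)
      fun y z hy hz => by rw [inner_add_left, hy, hz, add_zero]
    have h1 := ((c m).hasSum_repr ⟨y, hy⟩).mapL
      (innerSL ℝ x ∘L (Module.End.eigenspace (T : Module.End ℝ E) m).subtypeL)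
    have h2 : ∀ i, innerSL ℝ x ((c m i : Module.End.eigenspace (T : Module.End ℝ E) m) : E) = 0 :=
      fun i => by
        rw [innerSL_apply_apply, real_inner_comm]
        exact hx _ (Submodule.subset_span ⟨⟨m, i⟩, rfl⟩)
    have h3 := h1.unique (by
      convert hasSum_zero using 2 with i
      simp only [ContinuousLinearMap.comp_apply, map_smul, Submodule.subtypeL_apply, h2, smul_zero])
    rw [real_inner_comm]
    simpa using h3
  refine ⟨Σ m : ℝ, w m, HilbertBasis.mkOfOrthogonalEqBot ho hsp, fun a => a.1, fun a => ?_⟩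
  rw [HilbertBasis.coe_mkOfOrthogonalEqBot]
  exact Module.End.mem_eigenspace_iff.1 (c a.1 a.2).2

end Spectral

/-- Tonelli's theorem for double series. -/
theorem hasSum_swap_of_nonneg {α β : Type*} {f : α → β → ℝ} (hf : ∀ a b, 0 ≤ f a b) {g : β → ℝ}
    {h : α → ℝ} {D : ℝ} (h1 : ∀ b, HasSum (fun a => f a b) (g b)) (h2 : HasSum g D)
    (h3 : ∀ a, HasSum (fun b => f a b) (h a)) : HasSum h D := by
  have hs : Summable fun p : β × α => f p.2 p.1 :=
    (summable_prod_of_nonneg fun p => hf _ _).2 ⟨fun b => (h1 b).summable, by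
      simpa only [(h1 _).tsum_eq] using h2.summable⟩
  have e1 := hs.hasSum.prod_fiberwise h1
  have hs' : HasSum (fun p : α × β => f p.1 p.2) (∑' p : β × α, f p.2 p.1) :=
    (Equiv.prodComm α β).hasSum_iff.2 hs.hasSum
  rw [h2.unique e1]
  exact hs'.prod_fiberwise h3

/-! ### Multiplication operators and the Hilbert–Schmidt norm -/

theorem memLp_mul_testFn (f : TestFn) (u : L2T) :
    MemLp (fun x => f.1 x * u x) 2 torusMeasure :=
  (Lp.memLp u).of_le_mul (c := (bounded_testFn f).choose)
    ((continuous_testFn f).aestronglyMeasurable.mul (Lp.aestronglyMeasurable u))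
    (ae_of_all _ fun x => by
      rw [norm_mul]
      exact mul_le_mul_of_nonneg_right ((bounded_testFn f).choose_spec x) (norm_nonneg _))

/-- Multiplication by a test function on `L²(𝕋²)`. -/
def mulOp (f : TestFn) : L2T →L[ℝ] L2T :=
  LinearMap.mkContinuous
    { toFun := fun u => (memLp_mul_testFn f u).toLp _
      map_add' := fun u v => by
        rw [← MemLp.toLp_add]
        refine MemLp.toLp_congr _ _ ?_
        filter_upwards [Lp.coeFn_add u v] with x hx
        rw [hx, Pi.add_apply, Pi.add_apply, mul_add]
      map_smul' := fun c u => by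
        rw [RingHom.id_apply, ← MemLp.toLp_const_smul]
        refine MemLp.toLp_congr _ _ ?_
        filter_upwards [Lp.coeFn_smul c u] with x hx
        rw [hx, Pi.smul_apply, Pi.smul_apply, smul_eq_mul, smul_eq_mul]; ring }
    (bounded_testFn f).choose fun u => by
      refine Lp.norm_le_mul_norm_of_ae_le_mul ?_
      filter_upwards [(memLp_mul_testFn f u).coeFn_toLp] with x hx
      simp only [LinearMap.coe_mk, AddHom.coe_mk, hx, norm_mul]
      exact mul_le_mul_of_nonneg_right ((bounded_testFn f).choose_spec x) (norm_nonneg _)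

theorem coeFn_mulOp (f : TestFn) (u : L2T) :
    mulOp f u =ᵐ[torusMeasure] fun x => f.1 x * u x :=
  (memLp_mul_testFn f u).coeFn_toLp

theorem inner_mulOp (f : TestFn) (u v : L2T) :
    inner ℝ (mulOp f u) v = ∫ x, f.1 x * u x * v x ∂torusMeasure := by
  rw [inner_L2_eq]
  refine integral_congr_ae ?_
  filter_upwards [coeFn_mulOp f u] with x hx
  rw [hx]

theorem inner_mulOp_comm (f : TestFn) (u v : L2T) :
    inner ℝ (mulOp f u) v = inner ℝ u (mulOp f v) := by
  rw [real_inner_comm (mulOp f v), inner_mulOp, inner_mulOp]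
  exact integral_congr_ae (ae_of_all _ fun x => by ring)

theorem mulOp_ofT (f h : TestFn) : mulOp f (ofT h) = ofT (mulT f h) := by
  refine Lp.ext ?_
  filter_upwards [coeFn_mulOp f (ofT h), coeFn_ofT h, coeFn_ofT (mulT f h)] with x h1 h2 h3
  rw [h1, h2, h3]
  rfl

theorem norm_mulOp_frame_le (f : TestFn) (j : Idx) : ‖mulOp f (frame j)‖ ≤ ‖ofT f‖ := by
  refine Lp.norm_le_norm_of_ae_le ?_
  filter_upwards [coeFn_mulOp f (frame j), coeFn_ofT f, coeFn_ofT (trig j)] with x h1 h2 h3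
  rw [h1, frame, h3, h2, norm_mul]
  exact mul_le_of_le_one_right (norm_nonneg _) (abs_trig_le_one j x)

/-- The summands of the squared Hilbert–Schmidt norm of `(-Δ+K)^{-1/2} f (-Δ+K)^{-1/2}`, computed in
the trigonometric frame. -/
def hsTerm (K : ℝ) (f : TestFn) (p : Idx × Idx) : ℝ :=
  (lam K p.1)⁻¹ * ((lam K p.2)⁻¹ * inner ℝ (mulOp f (frame p.1)) (frame p.2) ^ 2)

/-- The squared Hilbert–Schmidt norm of `(-Δ+K)^{-1/2} f (-Δ+K)^{-1/2}`. -/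
def hsNormSq (K : ℝ) (f : TestFn) : ℝ := ∑' p, hsTerm K f p

theorem hsTerm_nonneg {K : ℝ} (hK : 0 < K) (f : TestFn) (p : Idx × Idx) : 0 ≤ hsTerm K f p :=
  mul_nonneg (inv_nonneg.2 (lam_pos hK _).le)
    (mul_nonneg (inv_nonneg.2 (lam_pos hK _).le) (sq_nonneg _))

/-- Since `λᵢ⁻¹ λⱼ⁻¹ ≤ (λᵢ⁻² + λⱼ⁻²) / 2` and the frame is bounded by `1` pointwise, the Hilbert–Schmidt
norm is controlled by the `L²` norm of `f`. -/
theorem summable_hsTerm_and_le {K : ℝ} (hK : 0 < K) (f : TestFn) :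
    Summable (hsTerm K f) ∧
      hsNormSq K f ≤ (∑' j, (lam K j)⁻¹ ^ 2) * ‖ofT f‖ ^ 2 := by
  set F : Idx × Idx → ℝ := fun p =>
    (lam K p.1)⁻¹ ^ 2 * inner ℝ (mulOp f (frame p.1)) (frame p.2) ^ 2
  have hrow : ∀ i, HasSum (fun j => F (i, j)) ((lam K i)⁻¹ ^ 2 * ‖mulOp f (frame i)‖ ^ 2) := fun i =>
    (hasSum_frame_sq (mulOp f (frame i))).mul_left _
  have hle : ∀ i, (lam K i)⁻¹ ^ 2 * ‖mulOp f (frame i)‖ ^ 2 ≤ (lam K i)⁻¹ ^ 2 * ‖ofT f‖ ^ 2 :=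
    fun i => by
      gcongr
      exact norm_mulOp_frame_le f i
  have hsum := (summable_lam_inv_sq hK).mul_right (‖ofT f‖ ^ 2)
  have hrs : Summable fun i => (lam K i)⁻¹ ^ 2 * ‖mulOp f (frame i)‖ ^ 2 :=
    Summable.of_nonneg_of_le (fun i => by positivity) hle hsum
  have hF : Summable F := (summable_prod_of_nonneg fun p => by positivity).2
    ⟨fun i => (hrow i).summable, by simpa only [(hrow _).tsum_eq] using hrs⟩
  have hFle : ∑' p, F p ≤ (∑' j, (lam K j)⁻¹ ^ 2) * ‖ofT f‖ ^ 2 := by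
    rw [hF.tsum_prod, ← tsum_mul_right]
    simp only [(hrow _).tsum_eq]
    exact hrs.tsum_le_tsum hle hsum
  have hF' : HasSum (fun p : Idx × Idx => F p.swap) (∑' p, F p) :=
    (Equiv.prodComm Idx Idx).hasSum_iff (f := F) |>.2 hF.hasSum
  have hG := (hF.hasSum.add hF').mul_left (1 / 2)
  have hpt : ∀ p, hsTerm K f p ≤ 1 / 2 * (F p + F p.swap) := fun p => by
    have h1 : inner ℝ (mulOp f (frame p.2)) (frame p.1)
        = inner ℝ (mulOp f (frame p.1)) (frame p.2) := by
      rw [inner_mulOp_comm, real_inner_comm]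
    simp only [F, hsTerm, Prod.fst_swap, Prod.snd_swap, h1]
    nlinarith [mul_nonneg (sq_nonneg ((lam K p.1)⁻¹ - (lam K p.2)⁻¹))
      (sq_nonneg (inner ℝ (mulOp f (frame p.1)) (frame p.2)))]
  have hs : Summable (hsTerm K f) :=
    Summable.of_nonneg_of_le (hsTerm_nonneg hK f) hpt hG.summable
  refine ⟨hs, ?_⟩
  calc hsNormSq K f ≤ ∑' p, 1 / 2 * (F p + F p.swap) := hs.tsum_le_tsum hpt hG.summable
    _ = ∑' p, F p := by rw [hG.tsum_eq]; ring
    _ ≤ _ := hFle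

section HS

variable {K : ℝ} {E : Type*} [NormedAddCommGroup E] [InnerProductSpace ℝ E] [CompleteSpace E]

/-- `J : L²(𝕋²) → E` realises the free covariance if `‖J u‖² = ⟨(-Δ + K)⁻¹ u, u⟩`, the right-hand side
being expanded in the trigonometric frame. -/
def RealizesCovariance (K : ℝ) (J : L2T →L[ℝ] E) : Prop :=
  ∀ u, HasSum (fun j => (lam K j)⁻¹ * inner ℝ u (frame j) ^ 2) (‖J u‖ ^ 2)

/-- The operator `J f Jᵀ`. It represents multiplication by `f` on the Cameron–Martin space. -/
def sandwich (J : L2T →L[ℝ] E) (f : TestFn) : E →L[ℝ] E := J ∘L mulOp f ∘L J.adjoint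

theorem inner_sandwich (J : L2T →L[ℝ] E) (f : TestFn) (u v : E) :
    inner ℝ (sandwich J f u) v = inner ℝ (mulOp f (J.adjoint u)) (J.adjoint v) := by
  rw [sandwich, ContinuousLinearMap.comp_apply, ContinuousLinearMap.comp_apply,
    ← ContinuousLinearMap.adjoint_inner_right]

theorem isSymmetric_sandwich (J : L2T →L[ℝ] E) (f : TestFn) :
    (sandwich J f : E →ₗ[ℝ] E).IsSymmetric := fun u v => by
  change inner ℝ (sandwich J f u) v = inner ℝ u (sandwich J f v)
  rw [real_inner_comm (sandwich J f v) u, inner_sandwich, inner_sandwich, inner_mulOp_comm,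
    real_inner_comm]

/-- The Hilbert–Schmidt norm of `J f Jᵀ` does not depend on the Hilbert basis, and may be computed in
the trigonometric frame. -/
theorem RealizesCovariance.hasSum_norm_sq_sandwich (hK : 0 < K) {J : L2T →L[ℝ] E}
    (hJ : RealizesCovariance K J) (f : TestFn) {ι : Type*} (b : HilbertBasis ι ℝ E) :
    HasSum (fun k => ‖sandwich J f (b k)‖ ^ 2) (hsNormSq K f) := by
  have hs := (summable_hsTerm_and_le hK f).1
  have hadj : ∀ k j, inner ℝ (mulOp f (J.adjoint (b k))) (frame j)
      = inner ℝ (b k) (J (mulOp f (frame j))) := fun k j => by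
    rw [inner_mulOp_comm, ContinuousLinearMap.adjoint_inner_left]
  refine hasSum_swap_of_nonneg
    (f := fun k j => (lam K j)⁻¹ * inner ℝ (b k) (J (mulOp f (frame j))) ^ 2)
    (g := fun j => (lam K j)⁻¹ * ‖J (mulOp f (frame j))‖ ^ 2)
    (fun k j => mul_nonneg (inv_nonneg.2 (lam_pos hK j).le) (sq_nonneg _))
    (fun j => (hasSum_inner_sq b _).mul_left _) ?_ fun k => ?_
  · exact hs.hasSum.prod_fiberwise fun i => (hJ (mulOp f (frame i))).mul_left _
  · have := hJ (mulOp f (J.adjoint (b k)))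
    simp only [hadj] at this
    exact this

end HS

/-! ### The Gaussian Hilbert space of the free field -/

theorem measurable_pair (f : TestFn) : Measurable fun φ : Distr => φ.pair f := by
  intro s hs
  exact le_iSup (fun f : TestFn => MeasurableSpace.comap (fun T : Distr => T.pair f) (borel ℝ)) f _
    ⟨s, by rwa [← BorelSpace.measurable_eq (α := ℝ)], rfl⟩

theorem measurable_distr_iff {α : Type*} [MeasurableSpace α] {Q : α → Distr}
    (h : ∀ f : TestFn, Measurable fun x => (Q x).pair f) : Measurable Q := by
  rw [measurable_iff_comap_le]
  refine (MeasurableSpace.comap_iSup).le.trans (iSup_le fun f => ?_)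
  rw [MeasurableSpace.comap_comp, ← measurable_iff_comap_le, ← BorelSpace.measurable_eq (α := ℝ)]
  exact h f

theorem pair_add (φ : Distr) (f h : TestFn) : φ.pair (f + h) = φ.pair f + φ.pair h :=
  map_add φ.1 f h

theorem pair_smul (φ : Distr) (c : ℝ) (f : TestFn) : φ.pair (c • f) = c * φ.pair f :=
  map_smul φ.1 c f

theorem pair_sub (φ : Distr) (f h : TestFn) : φ.pair (f - h) = φ.pair f - φ.pair h :=
  map_sub φ.1 f h

open ProbabilityTheory in
theorem map_pair_eq_gaussianReal {V : T2 → ℝ} {μ : Measure Distr} (hμ : IsGaussianField V μ)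
    {q : TestFn → ℝ} (hq : ∀ f, ∫ x, greenOp V f.1 x * f.1 x ∂torusMeasure = q f)
    (hq0 : ∀ f, 0 ≤ q f) (hq2 : ∀ (c : ℝ) f, q (c • f) = c ^ 2 * q f) (f : TestFn) :
    μ.map (fun φ => φ.pair f) = gaussianReal 0 (q f).toNNReal := by
  have := hμ.1
  have := Measure.isProbabilityMeasure_map (μ := μ) (measurable_pair f).aemeasurable
  refine Measure.ext_of_charFun (funext fun t => ?_)
  have h := hμ.2 (t • f)
  rw [hq, hq2] at h
  rw [charFun_apply_real, integral_map (measurable_pair f).aemeasurable (by fun_prop),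
    charFun_gaussianReal]
  refine Eq.trans (integral_congr_ae (ae_of_all _ fun φ => ?_)) (h.trans ?_)
  · simp only [pair_smul]
    push_cast
    ring_nf
  · congr 1
    rw [Real.coe_toNNReal _ (hq0 f)]
    push_cast
    ring

/-- The variance `⟨(-Δ + K)⁻¹ f, f⟩` of the free field tested against `f`. -/
def freeVar (K : ℝ) (f : TestFn) : ℝ := ∑' j, (lam K j)⁻¹ * inner ℝ (ofT f) (frame j) ^ 2

section

variable {K : ℝ} (hK : 0 < K)
include hK

theorem hasSum_freeVar (f : TestFn) :
    HasSum (fun j => (lam K j)⁻¹ * inner ℝ (ofT f) (frame j) ^ 2) (freeVar K f) :=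
  (hasSum_greenOp_const hK f).summable.hasSum

theorem freeVar_nonneg (f : TestFn) : 0 ≤ freeVar K f :=
  tsum_nonneg fun j => mul_nonneg (inv_nonneg.2 (lam_pos hK j).le) (sq_nonneg _)

theorem freeVar_le (f : TestFn) : freeVar K f ≤ K⁻¹ * ‖ofT f‖ ^ 2 := by
  refine hasSum_le (fun j => ?_) (hasSum_freeVar hK f) ((hasSum_frame_sq (ofT f)).mul_left K⁻¹)
  exact mul_le_mul_of_nonneg_right (inv_anti₀ hK (le_lam K j)) (sq_nonneg _)

omit hK in
theorem freeVar_smul (c : ℝ) (f : TestFn) : freeVar K (c • f) = c ^ 2 * freeVar K f := by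
  rw [freeVar, freeVar, ← tsum_mul_left]
  refine tsum_congr fun j => ?_
  rw [map_smul, inner_smul_left]
  simp only [RCLike.conj_to_real]
  ring

/-- Polarisation of the variance, against an eigenfunction of `-Δ + K`. -/
theorem freeVar_polar (f : TestFn) (j : Idx) :
    (freeVar K (f + trig j) - freeVar K (f - trig j)) / 4
      = (lam K j)⁻¹ * inner ℝ (ofT f) (frame j) := by
  have h := schrodingerEq_greenOp (exists_schrodingerEq_const hK (memLp_testFn f))
  have h1 := ((hasSum_freeVar hK (f + trig j)).sub (hasSum_freeVar hK (f - trig j))).div_const 4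
  have h2 := hasSum_frame (h.1.toLp _) (frame j)
  rw [h.inner_frame hK] at h2
  refine h1.unique (Eq.mp ?_ h2)
  congr 1
  funext i
  rw [h.inner_frame hK, map_add, map_sub, inner_add_left, inner_sub_left]
  change _ * inner ℝ (ofT f) (frame i) * inner ℝ (ofT (trig j)) (frame i) = _
  ring

theorem map_pair_freeField {μ : Measure Distr} (hμ : IsFreeField K μ) (f : TestFn) :
    μ.map (fun φ => φ.pair f)
      = ProbabilityTheory.gaussianReal 0 (freeVar K f).toNNReal :=
  map_pair_eq_gaussianReal hμ (fun f => (hasSum_greenOp_const hK f).unique (hasSum_freeVar hK f))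
    (freeVar_nonneg hK) freeVar_smul f

theorem memLp_pair {μ : Measure Distr} (hμ : IsFreeField K μ) (f : TestFn) :
    MemLp (fun φ : Distr => φ.pair f) 2 μ := by
  have h1 := ProbabilityTheory.memLp_id_gaussianReal' (μ := 0)
    (v := (freeVar K f).toNNReal) 2 (by simp)
  rw [← map_pair_freeField hK hμ f] at h1
  exact (memLp_map_measure_iff h1.1 (measurable_pair f).aemeasurable).1 h1

theorem integral_pair_sq {μ : Measure Distr} (hμ : IsFreeField K μ) (f : TestFn) :
    ∫ φ, φ.pair f ^ 2 ∂μ = freeVar K f := by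
  have h1 := ProbabilityTheory.variance_of_integral_eq_zero (X := id) (μ :=
    ProbabilityTheory.gaussianReal 0 (freeVar K f).toNNReal) aemeasurable_id
    (by simp only [id]; exact ProbabilityTheory.integral_id_gaussianReal)
  rw [ProbabilityTheory.variance_id_gaussianReal, ← map_pair_freeField hK hμ f,
    integral_map (measurable_pair f).aemeasurable (by fun_prop),
    Real.coe_toNNReal _ (freeVar_nonneg hK f)] at h1
  exact h1.symm

end

/-- A realisation of the field `μ` in a Gaussian Hilbert space: a closed Gaussian subspace `H` of
`L²(μ)`, and the continuous extension `J : L²(𝕋²) → H` of the map `f ↦ ⟨φ, f⟩`. The pairing of the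
field with test functions has the covariance `(-Δ + K)⁻¹`, that is `Jᵀ J = (-Δ + K)⁻¹`. -/
structure GaussianRealization (K : ℝ) (μ : Measure Distr) where
  /-- The Gaussian Hilbert space. -/
  H : Submodule ℝ (Lp ℝ 2 μ)
  complete : CompleteSpace H
  gaussian : IsGaussianSpace H
  /-- The extension of the pairing to `L²(𝕋²)`. -/
  J : L2T →L[ℝ] H
  cov : RealizesCovariance K J
  pair : ∀ f : TestFn, ((J (ofT f) : Lp ℝ 2 μ) : Distr → ℝ) =ᵐ[μ] fun φ => φ.pair f

/-- The pairing of the field with `f` has variance at most `K⁻¹ ‖f‖²`, so it extends from test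
functions to `L²(𝕋²)` by density. -/
theorem exists_gaussianRealization {K : ℝ} (hK : 0 < K) {μ : Measure Distr}
    (hμ : IsFreeField K μ) : Nonempty (GaussianRealization K μ) := by
  have hprob := hμ.1
  let P : TestFn →ₗ[ℝ] Lp ℝ 2 μ :=
    { toFun := fun f => (memLp_pair hK hμ f).toLp _
      map_add' := fun f h => by
        rw [← MemLp.toLp_add]
        exact MemLp.toLp_congr _ _ (ae_of_all _ fun φ => pair_add φ f h)
      map_smul' := fun c f => by
        rw [RingHom.id_apply, ← MemLp.toLp_const_smul]
        exact MemLp.toLp_congr _ _ (ae_of_all _ fun φ => pair_smul φ c f) }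
  have hP : ∀ f, P f =ᵐ[μ] fun φ => φ.pair f := fun f => (memLp_pair hK hμ f).coeFn_toLp
  have hPn : ∀ f, ‖P f‖ ^ 2 = freeVar K f := fun f => by
    rw [norm_sq_L2_eq, ← integral_pair_sq hK hμ f]
    refine integral_congr_ae ?_
    filter_upwards [hP f] with φ hφ
    rw [hφ]
  set H := (LinearMap.range P).topologicalClosure
  have hcomplete : CompleteSpace H :=
    (Submodule.isClosed_topologicalClosure _).completeSpace_coe
  have hgauss : IsGaussianSpace H := by
    refine isGaussianSpace_topologicalClosure ?_
    rintro _ ⟨f, rfl⟩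
    have h := hμ.2 f
    rw [(hasSum_greenOp_const hK f).unique (hasSum_freeVar hK f)] at h
    rw [hPn]
    refine Eq.trans (integral_congr_ae ?_) (h.trans ?_)
    · filter_upwards [hP f] with φ hφ
      rw [hφ, mul_comm]
    · push_cast
      ring_nf
  let P' : TestFn →ₗ[ℝ] H := P.codRestrict H fun f =>
    Submodule.le_topologicalClosure _ (LinearMap.mem_range_self P f)
  have hP'n : ∀ f, ‖P' f‖ ^ 2 = freeVar K f := hPn
  have hbd : ∀ f, ‖P' f‖ ≤ √K⁻¹ * ‖ofT f‖ := fun f => by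
    refine le_of_sq_le_sq ?_ (by positivity)
    rw [hP'n, mul_pow, Real.sq_sqrt (by positivity)]
    exact freeVar_le hK f
  let J : L2T →L[ℝ] H := P'.extendOfNorm ofT
  have hJ : ∀ f, J (ofT f) = P' f := LinearMap.extendOfNorm_eq denseRange_ofT ⟨_, hbd⟩
  have hJJ : ∀ (j : Idx) (u : L2T), inner ℝ (J u) (J (frame j))
      = (lam K j)⁻¹ * inner ℝ u (frame j) := fun j => by
    have hc : IsClosed {u : L2T | inner ℝ (J u) (J (frame j))
        = (lam K j)⁻¹ * inner ℝ u (frame j)} :=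
      isClosed_eq (by fun_prop) (by fun_prop)
    refine fun u => denseRange_ofT.induction_on u hc fun f => ?_
    rw [frame, hJ, hJ, ← frame, ← freeVar_polar hK, ← hP'n, ← hP'n, map_add, map_sub,
      norm_add_sq_real, norm_sub_sq_real]
    ring
  refine ⟨⟨H, hcomplete, hgauss, J, fun u => ?_, fun f => ?_⟩⟩
  · have h := hasSum_frame (J.adjoint (J u)) u
    rw [ContinuousLinearMap.adjoint_inner_left, real_inner_self_eq_norm_sq] at h
    simp only [ContinuousLinearMap.adjoint_inner_left, hJJ] at h
    refine Eq.mp ?_ h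
    congr 1
    funext j
    ring
  · rw [hJ]
    exact hP f

/-! ### Mollification in `L²(𝕋²)` -/

instance : torusMeasure.IsNegInvariant := by
  have : torusMeasure.Regular := inferInstance
  infer_instance

/-- The function `y ↦ a (x - y)` as an element of `L²(𝕋²)`. -/
def translate (a : TestFn) (x : T2) : L2T := ofT (reflTranslate a x)

theorem reflTranslate_apply (a : TestFn) (x y : T2) : (reflTranslate a x).1 y = a.1 (x - y) := rfl

theorem norm_ofT_le {f : TestFn} {C : ℝ} (hC : 0 ≤ C) (h : ∀ x, |f.1 x| ≤ C) : ‖ofT f‖ ≤ C := by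
  have := Lp.norm_le_of_ae_bound (f := ofT f) hC (by
    filter_upwards [coeFn_ofT f] with x hx
    rw [hx]
    exact h x)
  have h1 : measureUnivNNReal torusMeasure = 1 := by
    rw [measureUnivNNReal, measure_univ, ENNReal.toNNReal_one]
  simpa [h1] using this

theorem continuous_translate (a : TestFn) : Continuous (translate a) := by
  have hu := CompactSpace.uniformContinuous_of_continuous (continuous_testFn a)
  rw [Metric.continuous_iff]
  intro x ε hε
  obtain ⟨δ, hδ, h⟩ := Metric.uniformContinuous_iff.1 hu (ε / 2) (half_pos hε)
  refine ⟨δ, hδ, fun y hy => ?_⟩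
  rw [dist_eq_norm, translate, translate, ← map_sub]
  refine (norm_ofT_le (half_pos hε).le fun z => ?_).trans_lt (half_lt_self hε)
  have h1 := h (a := y - z) (b := x - z) (by rwa [dist_sub_right])
  exact h1.le

/-- The convolution `a ∗ u`, as a continuous function. -/
def conv (a : TestFn) (u : L2T) (x : T2) : ℝ := inner ℝ (translate a x) u

theorem continuous_conv (a : TestFn) (u : L2T) : Continuous (conv a u) :=
  (continuous_translate a).inner continuous_const

theorem memLp_of_continuous {f : T2 → ℝ} (hf : Continuous f) : MemLp f 2 torusMeasure := by
  obtain ⟨C, hC⟩ := (isCompact_range hf).isBounded.exists_norm_le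
  exact MemLp.of_bound hf.aestronglyMeasurable C (ae_of_all _ fun x => hC _ ⟨x, rfl⟩)

theorem phase_add (n : Fin 2 → ℤ) (z w : Fin 2 → ℝ) :
    phase n (z + w) = phase n z + phase n w := by
  have := phase_sub n (z + w) w
  rw [add_sub_cancel_right] at this
  linarith

theorem cosT_add (n : Fin 2 → ℤ) (x y : T2) :
    (cosT n).1 (x + y) = (cosT n).1 x * (cosT n).1 y - (sinT n).1 x * (sinT n).1 y := by
  obtain ⟨z, rfl⟩ := isOpenQuotientMap_proj.surjective x
  obtain ⟨w, rfl⟩ := isOpenQuotientMap_proj.surjective y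
  rw [← proj_add]
  simp only [cosT_proj, sinT_proj, phase_add, Real.cos_add]

theorem sinT_add (n : Fin 2 → ℤ) (x y : T2) :
    (sinT n).1 (x + y) = (sinT n).1 x * (cosT n).1 y + (cosT n).1 x * (sinT n).1 y := by
  obtain ⟨z, rfl⟩ := isOpenQuotientMap_proj.surjective x
  obtain ⟨w, rfl⟩ := isOpenQuotientMap_proj.surjective y
  rw [← proj_add]
  simp only [cosT_proj, sinT_proj, phase_add, Real.sin_add]

/-- The index of the other trigonometric function of the same frequency. -/
def flipIdx : Idx ≃ Idx := Equiv.prodCongr (Equiv.refl _) Equiv.boolNot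

/-- The sign `1` for cosines and `-1` for sines. -/
def sgn (j : Idx) : ℝ := bif j.2 then -1 else 1

theorem sgn_sq (j : Idx) : sgn j ^ 2 = 1 := by
  rcases j with ⟨n, _ | _⟩ <;> simp [sgn]

@[simp] theorem lam_flipIdx (K : ℝ) (j : Idx) : lam K (flipIdx j) = lam K j := rfl

/-- The Fourier coefficient `∫ a cos (2π n·x)`. -/
def cosCoeff (a : TestFn) (j : Idx) : ℝ := ∫ x, a.1 x * (cosT j.1).1 x ∂torusMeasure

/-- The Fourier coefficient `∫ a sin (2π n·x)`. -/
def sinCoeff (a : TestFn) (j : Idx) : ℝ := ∫ x, a.1 x * (sinT j.1).1 x ∂torusMeasure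

/-- Convolution acts on each frequency by a rotation and dilation. -/
theorem conv_frame (a : TestFn) (j : Idx) (x : T2) :
    conv a (frame j) x = cosCoeff a j * (trig j).1 x
      + sgn j * sinCoeff a j * (trig (flipIdx j)).1 x := by
  rw [conv, translate, frame, inner_ofT_ofT]
  simp only [reflTranslate_apply]
  have h := integral_sub_left_eq_self (μ := torusMeasure)
    (fun y => a.1 y * (trig j).1 (x - y)) x
  simp only [sub_sub_cancel] at h
  rw [h]
  rcases j with ⟨n, _ | _⟩
  · simp only [trig_false, cosT_sub, cosCoeff, sinCoeff, flipIdx, sgn]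
    simp only [Equiv.prodCongr_apply, Prod.map, Equiv.refl_apply, Equiv.boolNot_apply, Bool.not_false,
      trig_true, cond_false, one_mul]
    rw [← integral_mul_const, ← integral_mul_const, ← integral_add
      ((integrable_mul_testFn _ _).mul_const _) ((integrable_mul_testFn _ _).mul_const _)]
    exact integral_congr_ae (ae_of_all _ fun y => by ring)
  · simp only [trig_true, sinT_sub, cosCoeff, sinCoeff, flipIdx, sgn]
    simp only [Equiv.prodCongr_apply, Prod.map, Equiv.refl_apply, Equiv.boolNot_apply, Bool.not_true,
      trig_false, cond_true, neg_mul, one_mul]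
    rw [← integral_mul_const, ← integral_mul_const, ← sub_eq_add_neg, ← integral_sub
      ((integrable_mul_testFn _ _).mul_const _) ((integrable_mul_testFn _ _).mul_const _)]
    exact integral_congr_ae (ae_of_all _ fun y => by ring)

theorem integral_translate_mul_trig (a : TestFn) (j : Idx) (y : T2) :
    ∫ x, a.1 (x - y) * (trig j).1 x ∂torusMeasure = cosCoeff a j * (trig j).1 y
      - sgn j * sinCoeff a j * (trig (flipIdx j)).1 y := by
  have h := integral_sub_right_eq_self (μ := torusMeasure)
    (fun z => a.1 z * (trig j).1 (z + y)) y
  simp only [sub_add_cancel] at h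
  rw [h]
  rcases j with ⟨n, _ | _⟩
  · simp only [trig_false, cosT_add, cosCoeff, sinCoeff, flipIdx, sgn]
    simp only [Equiv.prodCongr_apply, Prod.map, Equiv.refl_apply, Equiv.boolNot_apply, Bool.not_false,
      trig_true, cond_false, one_mul]
    rw [← integral_mul_const, ← integral_mul_const, ← integral_sub
      ((integrable_mul_testFn _ _).mul_const _) ((integrable_mul_testFn _ _).mul_const _)]
    exact integral_congr_ae (ae_of_all _ fun y => by ring)
  · simp only [trig_true, sinT_add, cosCoeff, sinCoeff, flipIdx, sgn]
    simp only [Equiv.prodCongr_apply, Prod.map, Equiv.refl_apply, Equiv.boolNot_apply, Bool.not_true,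
      trig_false, cond_true, neg_mul, one_mul, sub_neg_eq_add]
    rw [← integral_mul_const, ← integral_mul_const, add_comm, ← integral_add
      ((integrable_mul_testFn _ _).mul_const _) ((integrable_mul_testFn _ _).mul_const _)]
    exact integral_congr_ae (ae_of_all _ fun y => by ring)

/-- The Fourier coefficients of `a ∗ u`. -/
theorem inner_conv_frame (a : TestFn) (u : L2T) (j : Idx) :
    inner ℝ ((memLp_of_continuous (continuous_conv a u)).toLp _) (frame j)
      = cosCoeff a j * inner ℝ u (frame j)
        - sgn j * sinCoeff a j * inner ℝ u (frame (flipIdx j)) := by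
  have hu : Integrable u torusMeasure := (Lp.memLp u).integrable one_le_two
  have hui : ∀ h : TestFn, Integrable (fun x => u x * h.1 x) torusMeasure := fun h =>
    (Lp.memLp u).integrable_mul (memLp_testFn h)
  have hprod : Integrable (Function.uncurry fun x y => a.1 (x - y) * u y * (trig j).1 x)
      (torusMeasure.prod torusMeasure) := by
    obtain ⟨C, hC⟩ := bounded_testFn a
    have h1 : Continuous fun p : T2 × T2 => a.1 (p.1 - p.2) * (trig j).1 p.1 :=
      ((continuous_testFn a).comp (continuous_fst.sub continuous_snd)).mul
        ((continuous_testFn _).comp continuous_fst)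
    have h2 := (hu.comp_snd torusMeasure).bdd_mul (c := C * 1) h1.aestronglyMeasurable
      (ae_of_all _ fun p => by
        rw [norm_mul]
        exact mul_le_mul (hC _) (abs_trig_le_one _ _) (norm_nonneg _) ((abs_nonneg _).trans (hC 0)))
    refine h2.congr (ae_of_all _ fun p => ?_)
    simp only [Function.uncurry]
    ring
  rw [frame, inner_toLp_ofT, inner_ofT_right, frame, inner_ofT_right, ← integral_const_mul,
    ← integral_const_mul, ← integral_sub ((hui _).const_mul _) ((hui _).const_mul _)]
  calc ∫ x, conv a u x * (trig j).1 x ∂torusMeasure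
      = ∫ x, ∫ y, a.1 (x - y) * u y * (trig j).1 x ∂torusMeasure ∂torusMeasure := by
        refine integral_congr_ae (ae_of_all _ fun x => ?_)
        simp only
        rw [conv, real_inner_comm, translate, inner_ofT_right, ← integral_mul_const]
        refine integral_congr_ae (ae_of_all _ fun y => ?_)
        simp only [reflTranslate_apply]
        ring
    _ = ∫ y, ∫ x, a.1 (x - y) * u y * (trig j).1 x ∂torusMeasure ∂torusMeasure :=
        integral_integral_swap hprod
    _ = _ := by
        refine integral_congr_ae (ae_of_all _ fun y => ?_)
        simp only
        have : ∀ x, a.1 (x - y) * u y * (trig j).1 x = u y * (a.1 (x - y) * (trig j).1 x) :=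
          fun x => by ring
        simp only [this]
        rw [integral_const_mul, integral_translate_mul_trig]
        ring

/-! ### Mollifier sequences -/

theorem IsMollifierSeq.tendsto_integral {a : ℕ → TestFn} (ha : IsMollifierSeq a) {f : T2 → ℝ}
    (hf : Continuous f) :
    Tendsto (fun n => ∫ x, (a n).1 x * f x ∂torusMeasure) atTop (𝓝 (f 0)) := by
  rw [Metric.tendsto_nhds]
  intro ε hε
  have hU : f ⁻¹' Metric.ball (f 0) (ε / 2) ∈ 𝓝 (0 : T2) :=
    hf.continuousAt.preimage_mem_nhds (Metric.ball_mem_nhds _ (half_pos hε))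
  filter_upwards [ha.2.2 _ hU] with n hn
  have hi1 : Integrable (a n).1 torusMeasure := (continuous_testFn (a n)).integrable_torus
  have hi : Integrable (fun x => (a n).1 x * f x) torusMeasure :=
    ((continuous_testFn (a n)).mul hf).integrable_torus
  have h1 : ∫ x, (a n).1 x * f x ∂torusMeasure - f 0
      = ∫ x, (a n).1 x * (f x - f 0) ∂torusMeasure := by
    simp only [mul_sub]
    rw [integral_sub hi (hi1.mul_const _), integral_mul_const, ha.2.1 n, one_mul]
  rw [Real.dist_eq, h1]
  calc |∫ x, (a n).1 x * (f x - f 0) ∂torusMeasure|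
      ≤ ∫ x, (a n).1 x * (ε / 2) ∂torusMeasure := by
        rw [← Real.norm_eq_abs]
        refine norm_integral_le_of_norm_le (hi1.mul_const _) (ae_of_all _ fun x => ?_)
        rw [norm_mul, Real.norm_of_nonneg (ha.1 n x)]
        by_cases hx : (a n).1 x = 0
        · simp [hx]
        · refine mul_le_mul_of_nonneg_left ?_ (ha.1 n x)
          have : f x ∈ Metric.ball (f 0) (ε / 2) := hn hx
          exact (Metric.mem_ball.1 this).le
    _ = ε / 2 := by rw [integral_mul_const, ha.2.1 n, one_mul]
    _ < ε := half_lt_self hε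

theorem abs_integral_mul_le_one {a : TestFn} (h0 : ∀ x, 0 ≤ a.1 x)
    (h1 : ∫ x, a.1 x ∂torusMeasure = 1) {f : T2 → ℝ} (hf : ∀ x, |f x| ≤ 1) :
    |∫ x, a.1 x * f x ∂torusMeasure| ≤ 1 := by
  refine le_of_le_of_eq (b := ∫ x, a.1 x ∂torusMeasure) ?_ h1
  rw [← Real.norm_eq_abs]
  refine norm_integral_le_of_norm_le (continuous_testFn a).integrable_torus (ae_of_all _ fun x => ?_)
  rw [norm_mul, Real.norm_of_nonneg (h0 x)]
  exact mul_le_of_le_one_right (h0 x) (hf x)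

theorem abs_cosCoeff_le_one {a : TestFn} (h0 : ∀ x, 0 ≤ a.1 x)
    (h1 : ∫ x, a.1 x ∂torusMeasure = 1) (j : Idx) : |cosCoeff a j| ≤ 1 :=
  abs_integral_mul_le_one h0 h1 fun x => abs_trig_le_one (j.1, false) x

theorem abs_sinCoeff_le_one {a : TestFn} (h0 : ∀ x, 0 ≤ a.1 x)
    (h1 : ∫ x, a.1 x ∂torusMeasure = 1) (j : Idx) : |sinCoeff a j| ≤ 1 :=
  abs_integral_mul_le_one h0 h1 fun x => abs_trig_le_one (j.1, true) x

theorem proj_zero : proj 0 = 0 := rfl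

theorem IsMollifierSeq.tendsto_cosCoeff {a : ℕ → TestFn} (ha : IsMollifierSeq a) (j : Idx) :
    Tendsto (fun n => cosCoeff (a n) j) atTop (𝓝 1) := by
  have h := ha.tendsto_integral (continuous_testFn (cosT j.1))
  rwa [← proj_zero, cosT_proj, show phase j.1 0 = 0 by simp [phase], Real.cos_zero] at h

theorem IsMollifierSeq.tendsto_sinCoeff {a : ℕ → TestFn} (ha : IsMollifierSeq a) (j : Idx) :
    Tendsto (fun n => sinCoeff (a n) j) atTop (𝓝 0) := by
  have h := ha.tendsto_integral (continuous_testFn (sinT j.1))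
  rwa [← proj_zero, sinT_proj, show phase j.1 0 = 0 by simp [phase], Real.sin_zero] at h

/-- Mollification converges to the identity strongly on `L²(𝕋²)`. -/
theorem IsMollifierSeq.tendsto_conv {a : ℕ → TestFn} (ha : IsMollifierSeq a) (u : L2T) :
    Tendsto (fun n => (memLp_of_continuous (continuous_conv (a n) u)).toLp (conv (a n) u)) atTop
      (𝓝 u) := by
  rw [tendsto_iff_norm_sub_tendsto_zero]
  set v : ℕ → L2T := fun n => (memLp_of_continuous (continuous_conv (a n) u)).toLp (conv (a n) u)
  have hc : ∀ n j, inner ℝ (v n - u) (frame j) = (cosCoeff (a n) j - 1) * inner ℝ u (frame j)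
      - sgn j * sinCoeff (a n) j * inner ℝ u (frame (flipIdx j)) := fun n j => by
    rw [inner_sub_left, inner_conv_frame]; ring
  have hs := hasSum_frame_sq u
  have hs' : Summable fun j => inner ℝ u (frame (flipIdx j)) ^ 2 := flipIdx.summable_iff.2 hs.summable
  have h0 : Tendsto (fun n => ∑' j, inner ℝ (v n - u) (frame j) ^ 2) atTop
      (𝓝 (∑' _ : Idx, (0 : ℝ))) := by
    refine tendsto_tsum_of_dominated_convergence
      (bound := fun j => 8 * inner ℝ u (frame j) ^ 2 + 2 * inner ℝ u (frame (flipIdx j)) ^ 2)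
      ((hs.summable.mul_left 8).add (hs'.mul_left 2)) (fun j => ?_)
      (Eventually.of_forall fun n j => ?_)
    · simp only [hc]
      have h1 := (((ha.tendsto_cosCoeff j).sub_const 1).mul_const (inner ℝ u (frame j))).sub
        (((ha.tendsto_sinCoeff j).const_mul (sgn j)).mul_const (inner ℝ u (frame (flipIdx j))))
      simpa using h1.pow 2
    · rw [hc, Real.norm_of_nonneg (sq_nonneg _)]
      have h1 := abs_le.1 (abs_cosCoeff_le_one (ha.1 n) (ha.2.1 n) j)
      have h2 := abs_le.1 (abs_sinCoeff_le_one (ha.1 n) (ha.2.1 n) j)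
      have h3 : (cosCoeff (a n) j - 1) ^ 2 ≤ 4 := by nlinarith
      have h4 : (sgn j * sinCoeff (a n) j) ^ 2 ≤ 1 := by rw [mul_pow, sgn_sq]; nlinarith
      set x := inner ℝ u (frame j)
      set y := inner ℝ u (frame (flipIdx j))
      calc ((cosCoeff (a n) j - 1) * x - sgn j * sinCoeff (a n) j * y) ^ 2
          ≤ 2 * ((cosCoeff (a n) j - 1) ^ 2 * x ^ 2) + 2 * ((sgn j * sinCoeff (a n) j) ^ 2 * y ^ 2) := by
            nlinarith [sq_nonneg ((cosCoeff (a n) j - 1) * x + sgn j * sinCoeff (a n) j * y)]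
        _ ≤ 2 * (4 * x ^ 2) + 2 * (1 * y ^ 2) := by gcongr
        _ = _ := by ring
  have e : ∀ n, ∑' j, inner ℝ (v n - u) (frame j) ^ 2 = ‖v n - u‖ ^ 2 := fun n =>
    (hasSum_frame_sq (v n - u)).tsum_eq
  simp only [e, tsum_zero] at h0
  have := h0.sqrt
  simpa [Real.sqrt_sq (norm_nonneg _)] using this

theorem IsMollifierSeq.tendsto_integral_conv_sq {a : ℕ → TestFn} (ha : IsMollifierSeq a)
    (f : TestFn) (u : L2T) :
    Tendsto (fun n => ∫ x, f.1 x * conv (a n) u x ^ 2 ∂torusMeasure) atTop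
      (𝓝 (inner ℝ (mulOp f u) u)) := by
  have h := ha.tendsto_conv u
  have h1 := Tendsto.inner (𝕜 := ℝ) (((mulOp f).continuous.tendsto u).comp h) h
  refine h1.congr fun n => ?_
  rw [Function.comp, inner_mulOp]
  refine integral_congr_ae ?_
  filter_upwards [(memLp_of_continuous (continuous_conv (a n) u)).coeFn_toLp] with x hx
  rw [hx]
  ring

/-! ### Regularity of the mollified field -/

/-- The derivatives of a periodic function are periodic, so they come from continuous functions on
the torus, which are uniformly continuous by compactness. -/
theorem exists_continuous_iteratedFDeriv (f : TestFn) (m : ℕ) :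
    ∃ G : T2 → ContinuousMultilinearMap ℝ (fun _ : Fin m => Fin 2 → ℝ) ℝ, Continuous G ∧
      ∀ y, iteratedFDeriv ℝ m (fun z : Fin 2 → ℝ => f.1 (proj z)) y = G (proj y) := by
  set B : (Fin 2 → ℝ) → ℝ := fun z => f.1 (proj z)
  have hper : ∀ y y', proj y = proj y' → iteratedFDeriv ℝ m B y = iteratedFDeriv ℝ m B y' := by
    intro y y' h
    have hB : (fun z => B (z + (y - y'))) = B := by
      funext z
      simp only [B]
      rw [proj_add, proj_sub, h, sub_self, add_zero]
    have h1 := iteratedFDeriv_comp_add_right (𝕜 := ℝ) (f := B) m (y - y') y'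
    rw [hB, add_sub_cancel] at h1
    exact h1.symm
  choose s hs using isOpenQuotientMap_proj.surjective
  have hG : ∀ y, iteratedFDeriv ℝ m B y = iteratedFDeriv ℝ m B (s (proj y)) := fun y =>
    hper _ _ (hs _).symm
  refine ⟨fun x => iteratedFDeriv ℝ m B (s x), ?_, hG⟩
  rw [isOpenQuotientMap_proj.isQuotientMap.continuous_iff]
  refine Continuous.congr ?_ hG
  exact (contDiff_testFn f).continuous_iteratedFDeriv (by exact_mod_cast le_top)

/-- The mollified field is continuous: translates of `a` converge uniformly with each of their
derivatives, and a distribution is bounded by finitely many of these. -/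
theorem continuous_mollify (a : TestFn) (φ : Distr) : Continuous fun x => mollify a φ x := by
  obtain ⟨n, C, hφ⟩ := φ.2
  choose G hGc hG using exists_continuous_iteratedFDeriv (reflTranslate a 0)
  have hd : ∀ m x y, iteratedFDeriv ℝ m (fun z : Fin 2 → ℝ => (reflTranslate a x).1 (proj z)) y
      = G m (proj y - x) := by
    intro m x y
    obtain ⟨w, rfl⟩ := isOpenQuotientMap_proj.surjective x
    have h1 : (fun z : Fin 2 → ℝ => (reflTranslate a (proj w)).1 (proj z))
        = fun z => (reflTranslate a 0).1 (proj (z - w)) := by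
      funext z
      simp only [reflTranslate_apply, proj_sub, zero_sub, neg_sub]
    rw [h1, ← proj_sub, ← hG]
    exact iteratedFDeriv_comp_sub (𝕜 := ℝ)
      (f := fun z : Fin 2 → ℝ => (reflTranslate a 0).1 (proj z)) m w y
  rw [continuous_iff_continuousAt]
  intro x₀
  rw [ContinuousAt, Metric.tendsto_nhds]
  intro ε hε
  set δ := ε / (2 * (|C| + 1))
  have hδ : 0 < δ := by positivity
  have hev : ∀ᶠ x in 𝓝 x₀, ∀ m ∈ Finset.range (n + 1), ∀ y,
      ‖G m (y - x) - G m (y - x₀)‖ ≤ δ := by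
    rw [eventually_all_finset]
    intro m _
    have hu := CompactSpace.uniformContinuous_of_continuous (hGc m)
    obtain ⟨r, hr, h⟩ := Metric.uniformContinuous_iff.1 hu δ hδ
    filter_upwards [Metric.ball_mem_nhds x₀ hr] with x hx y
    rw [← dist_eq_norm]
    refine (h ?_).le
    rwa [dist_sub_left]
  filter_upwards [hev] with x hx
  rw [Real.dist_eq, mollify, mollify, ← pair_sub]
  refine (hφ _ δ fun m hm y => ?_).trans_lt ?_
  · have h1 := iteratedFDeriv_sub_apply (𝕜 := ℝ) (i := m) (x := y)
      (((contDiff_testFn (reflTranslate a x)).of_le (by exact_mod_cast le_top)).contDiffAt)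
      (((contDiff_testFn (reflTranslate a x₀)).of_le (by exact_mod_cast le_top)).contDiffAt)
    rw [hd, hd] at h1
    change ‖iteratedFDeriv ℝ m ((fun z : Fin 2 → ℝ => (reflTranslate a x).1 (proj z))
      - fun z : Fin 2 → ℝ => (reflTranslate a x₀).1 (proj z)) y‖ ≤ δ
    rw [h1]
    exact hx m (Finset.mem_range.2 (by omega)) _
  · have : δ * (2 * (|C| + 1)) = ε := div_mul_cancel₀ _ (by positivity)
    nlinarith [le_abs_self C, abs_nonneg C]

/-! ### The smeared Wick square of the mollified field -/

/-- The variable `∫ f :(a ∗ φ)²:`. -/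
def wickInt (μ : Measure Distr) (a f : TestFn) (φ : Distr) : ℝ :=
  ∫ x, f.1 x * wickSqReg μ a φ x ∂torusMeasure

namespace GaussianRealization

attribute [instance] GaussianRealization.complete

variable {K : ℝ} {μ : Measure Distr} (R : GaussianRealization K μ)
include R

/-- The value `(a ∗ φ)(x)` of the mollified field, as an element of the Gaussian space. -/
def point (a : TestFn) (x : T2) : R.H := R.J (translate a x)

theorem continuous_point (a : TestFn) : Continuous (R.point a) :=
  R.J.continuous.comp (continuous_translate a)

theorem coeFn_point (a : TestFn) (x : T2) :
    ((R.point a x : Lp ℝ 2 μ) : Distr → ℝ) =ᵐ[μ] fun φ => mollify a φ x :=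
  R.pair (reflTranslate a x)

theorem integral_mollify_sq (a : TestFn) (x : T2) :
    ∫ φ, mollify a φ x ^ 2 ∂μ = ‖R.point a x‖ ^ 2 := by
  change _ = ‖(R.point a x : Lp ℝ 2 μ)‖ ^ 2
  rw [norm_sq_L2_eq]
  refine integral_congr_ae ?_
  filter_upwards [R.coeFn_point a x] with φ hφ
  rw [hφ]

theorem wickSqReg_eq (a : TestFn) (φ : Distr) (x : T2) :
    wickSqReg μ a φ x = mollify a φ x ^ 2 - ‖R.point a x‖ ^ 2 := by
  rw [wickSqReg, R.integral_mollify_sq]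

theorem wickSqReg_ae (a : TestFn) (x : T2) :
    (fun φ => wickSqReg μ a φ x) =ᵐ[μ] wick (R.point a x : Lp ℝ 2 μ) := by
  filter_upwards [R.coeFn_point a x] with φ hφ
  rw [R.wickSqReg_eq, wick, hφ]
  rfl

theorem continuous_wickSqReg (a : TestFn) (φ : Distr) : Continuous fun x => wickSqReg μ a φ x := by
  simp only [R.wickSqReg_eq]
  exact ((continuous_mollify a φ).pow 2).sub ((R.continuous_point a).norm.pow 2)

/-- Joint measurability, since the function is continuous in `x` and measurable in `φ`. -/
theorem measurable_wickSqReg (a f : TestFn) :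
    Measurable (Function.uncurry fun (x : T2) φ => f.1 x * wickSqReg μ a φ x) := by
  refine measurable_uncurry_of_continuous_of_measurable
    (fun φ => (continuous_testFn f).mul (R.continuous_wickSqReg a φ)) fun x => ?_
  simp only [R.wickSqReg_eq, mollify]
  exact (((measurable_pair _).pow_const 2).sub_const _).const_mul _

theorem inner_point (a : TestFn) (x : T2) (h : R.H) :
    inner ℝ (R.point a x) h = conv a (R.J.adjoint h) x := by
  rw [point, conv, ContinuousLinearMap.adjoint_inner_right]

variable [IsProbabilityMeasure μ]

theorem integral_wickSqReg_mul_wick (a : TestFn) (x : T2) (h : R.H) :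
    ∫ φ, wickSqReg μ a φ x * wick (h : Lp ℝ 2 μ) φ ∂μ = 2 * inner ℝ (R.point a x) h ^ 2 := by
  rw [Submodule.coe_inner, ← R.gaussian.integral_wick_mul_wick (R.point a x).2 h.2]
  refine integral_congr_ae ?_
  filter_upwards [R.wickSqReg_ae a x] with φ hφ
  rw [hφ]

theorem integral_wickSqReg_mul_wickSqReg (a : TestFn) (x y : T2) :
    ∫ φ, wickSqReg μ a φ x * wickSqReg μ a φ y ∂μ
      = 2 * inner ℝ (R.point a x) (R.point a y) ^ 2 := by
  rw [← R.integral_wickSqReg_mul_wick]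
  refine integral_congr_ae ?_
  filter_upwards [R.wickSqReg_ae a y] with φ hφ
  rw [hφ]

theorem memLp_wickSqReg (a : TestFn) (x : T2) : MemLp (fun φ => wickSqReg μ a φ x) 2 μ :=
  (R.gaussian.memLp_wick (R.point a x).2).ae_eq (R.wickSqReg_ae a x).symm

theorem memLp_wickSqReg_prod (a f : TestFn) :
    MemLp (Function.uncurry fun (x : T2) φ => f.1 x * wickSqReg μ a φ x) 2
      (torusMeasure.prod μ) := by
  have hm := (R.measurable_wickSqReg a f).aestronglyMeasurable (μ := torusMeasure.prod μ)
  rw [memLp_two_iff_integrable_sq hm]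
  refine (integrable_prod_iff (hm.pow 2)).2 ?_
  simp only [Pi.pow_apply, Function.uncurry_apply_pair, mul_pow]
  refine ⟨ae_of_all _ fun x => ((R.memLp_wickSqReg a x).integrable_sq).const_mul _, ?_⟩
  have h1 : ∀ x, ∫ φ, ‖f.1 x ^ 2 * wickSqReg μ a φ x ^ 2‖ ∂μ
      = f.1 x ^ 2 * (2 * (‖R.point a x‖ ^ 2) ^ 2) := fun x => by
    rw [← real_inner_self_eq_norm_sq, ← R.integral_wickSqReg_mul_wickSqReg, ← integral_const_mul]
    refine integral_congr_ae (ae_of_all _ fun φ => ?_)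
    simp only
    rw [Real.norm_of_nonneg (by positivity)]
    ring
  simp only [h1]
  exact (((continuous_testFn f).pow 2).mul
    (((R.continuous_point a).norm.pow 2).pow 2 |>.const_mul 2)).integrable_torus

theorem memLp_wickInt (a f : TestFn) : MemLp (wickInt μ a f) 2 μ := by
  have hm : AEStronglyMeasurable (wickInt μ a f) μ :=
    ((R.measurable_wickSqReg a f).stronglyMeasurable.integral_prod_left).aestronglyMeasurable
  rw [memLp_two_iff_integrable_sq hm]
  have h1 := (R.memLp_wickSqReg_prod a f).integrable_sq.integral_prod_right
  refine h1.mono' (hm.pow 2) (ae_of_all _ fun φ => ?_)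
  rw [Real.norm_of_nonneg (sq_nonneg _)]
  have h2 : MemLp (fun x => f.1 x * wickSqReg μ a φ x) 2 torusMeasure :=
    memLp_of_continuous ((continuous_testFn f).mul (R.continuous_wickSqReg a φ))
  -- Jensen's inequality in the form of a nonnegative variance.
  have h3 := ProbabilityTheory.variance_nonneg (fun x => f.1 x * wickSqReg μ a φ x) torusMeasure
  rw [ProbabilityTheory.variance_eq_sub h2] at h3
  exact sub_nonneg.1 h3

theorem integral_wickInt_mul (a f : TestFn) {Y : Distr → ℝ} (hY : MemLp Y 2 μ) :
    ∫ φ, wickInt μ a f φ * Y φ ∂μ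
      = ∫ x, f.1 x * ∫ φ, wickSqReg μ a φ x * Y φ ∂μ ∂torusMeasure := by
  have h1 := (R.memLp_wickSqReg_prod a f).integrable_mul (hY.comp_snd torusMeasure)
  have h2 := integral_integral_swap (f := fun (x : T2) φ => f.1 x * wickSqReg μ a φ x * Y φ) h1
  simp only [integral_mul_const] at h2
  rw [show ∫ φ, wickInt μ a f φ * Y φ ∂μ
    = ∫ φ, (∫ x, f.1 x * wickSqReg μ a φ x ∂torusMeasure) * Y φ ∂μ from rfl, ← h2]
  refine integral_congr_ae (ae_of_all _ fun x => ?_)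
  simp only [mul_assoc]
  rw [integral_const_mul]

theorem integral_wickInt_mul_wick (a f : TestFn) (h : R.H) :
    ∫ φ, wickInt μ a f φ * wick (h : Lp ℝ 2 μ) φ ∂μ
      = 2 * ∫ x, f.1 x * conv a (R.J.adjoint h) x ^ 2 ∂torusMeasure := by
  rw [R.integral_wickInt_mul a f (R.gaussian.memLp_wick h.2), ← integral_const_mul]
  refine integral_congr_ae (ae_of_all _ fun x => ?_)
  simp only
  rw [R.integral_wickSqReg_mul_wick, R.inner_point]
  ring

theorem integral_wickInt_sq (a f : TestFn) :
    ∫ φ, wickInt μ a f φ ^ 2 ∂μ = 2 * ∫ p : T2 × T2, f.1 p.1 * f.1 p.2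
      * inner ℝ (R.point a p.1) (R.point a p.2) ^ 2 ∂(torusMeasure.prod torusMeasure) := by
  have hi : Integrable (fun p : T2 × T2 => f.1 p.1 * f.1 p.2
      * inner ℝ (R.point a p.1) (R.point a p.2) ^ 2) (torusMeasure.prod torusMeasure) := by
    have hc : Continuous (fun p : T2 × T2 => f.1 p.1 * f.1 p.2
        * inner ℝ (R.point a p.1) (R.point a p.2) ^ 2) :=
      (((continuous_testFn f).comp continuous_fst).mul ((continuous_testFn f).comp continuous_snd)).mul
      ((((R.continuous_point a).comp continuous_fst).inner
        ((R.continuous_point a).comp continuous_snd)).pow 2)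
    exact hc.integrable_of_hasCompactSupport (HasCompactSupport.of_compactSpace _)
  rw [integral_prod _ hi, ← integral_const_mul]
  simp only [sq (wickInt μ a f _)]
  rw [R.integral_wickInt_mul a f (R.memLp_wickInt a f)]
  refine integral_congr_ae (ae_of_all _ fun x => ?_)
  simp only [mul_comm (wickSqReg μ a _ x)]
  rw [R.integral_wickInt_mul a f (R.memLp_wickSqReg a x), ← integral_const_mul, ← integral_const_mul]
  refine integral_congr_ae (ae_of_all _ fun y => ?_)
  simp only [R.integral_wickSqReg_mul_wickSqReg]
  rw [real_inner_comm]
  ring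

end GaussianRealization

/-! ### The second moment of the smeared Wick square -/

theorem RealizesCovariance.hasSum_inner {K : ℝ} {E : Type*} [NormedAddCommGroup E]
    [InnerProductSpace ℝ E] {J : L2T →L[ℝ] E} (hJ : RealizesCovariance K J) (u v : L2T) :
    HasSum (fun j => (lam K j)⁻¹ * (inner ℝ u (frame j) * inner ℝ v (frame j)))
      (inner ℝ (J u) (J v)) := by
  have h := ((hJ (u + v)).sub (hJ (u - v))).div_const 4
  rw [map_add, map_sub, norm_add_sq_real, norm_sub_sq_real] at h
  refine Eq.mp ?_ h
  congr 1
  · funext j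
    rw [inner_add_left, inner_sub_left]
    ring
  · ring

theorem cosCoeff_sq_add_sinCoeff_sq (a : TestFn) (j : Idx) :
    cosCoeff a j ^ 2 + sinCoeff a j ^ 2
      = inner ℝ (ofT a) (frame j) ^ 2 + inner ℝ (ofT a) (frame (flipIdx j)) ^ 2 := by
  rcases j with ⟨n, _ | _⟩ <;>
    simp [frame, inner_ofT_ofT, cosCoeff, sinCoeff, flipIdx, add_comm]

/-- A uniform bound for the convolution of `a` with an element of the frame. -/
def convBound (a : TestFn) (j : Idx) : ℝ := |cosCoeff a j| + |sinCoeff a j|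

theorem abs_conv_frame_le (a : TestFn) (j : Idx) (x : T2) :
    |conv a (frame j) x| ≤ convBound a j := by
  have hs : |sgn j| = 1 := by rw [← sq_eq_sq₀ (abs_nonneg _) zero_le_one, sq_abs, sgn_sq, one_pow]
  rw [conv_frame]
  refine (abs_add_le _ _).trans ?_
  rw [abs_mul, abs_mul, abs_mul, hs, one_mul]
  exact add_le_add (mul_le_of_le_one_right (abs_nonneg _) (abs_trig_le_one _ _))
    (mul_le_of_le_one_right (abs_nonneg _) (abs_trig_le_one _ _))

theorem summable_convBound_sq {K : ℝ} (hK : 0 < K) (a : TestFn) :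
    Summable fun j => (lam K j)⁻¹ * convBound a j ^ 2 := by
  have h1 := (hasSum_frame_sq (ofT a)).summable
  have h2 : Summable fun j => inner ℝ (ofT a) (frame (flipIdx j)) ^ 2 := flipIdx.summable_iff.2 h1
  refine Summable.of_nonneg_of_le (fun j => ?_) (fun j => ?_) ((h1.add h2).mul_left (K⁻¹ * 2))
  · exact mul_nonneg (inv_nonneg.2 (lam_pos hK j).le) (sq_nonneg _)
  · rw [← cosCoeff_sq_add_sinCoeff_sq, mul_assoc]
    refine mul_le_mul (inv_anti₀ hK (le_lam K j)) ?_ (sq_nonneg _) (inv_nonneg.2 hK.le)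
    rw [convBound, ← sq_abs (cosCoeff a j), ← sq_abs (sinCoeff a j)]
    nlinarith [sq_nonneg (|cosCoeff a j| - |sinCoeff a j|)]

/-- The summands of the squared Hilbert–Schmidt norm of `(-Δ+K)^{-1/2} Aᵀ f A (-Δ+K)^{-1/2}`, with `A`
the convolution with `a`. -/
def regTerm (K : ℝ) (a f : TestFn) (p : Idx × Idx) : ℝ :=
  (lam K p.1)⁻¹ * ((lam K p.2)⁻¹
    * (∫ x, f.1 x * (conv a (frame p.1) x * conv a (frame p.2) x) ∂torusMeasure) ^ 2)

theorem Continuous.integrable_torus_prod {f : T2 × T2 → ℝ} (hf : Continuous f) :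
    Integrable f (torusMeasure.prod torusMeasure) :=
  hf.integrable_of_hasCompactSupport (HasCompactSupport.of_compactSpace _)

/-- The second moment of the smeared Wick square as a Hilbert–Schmidt norm. The frame expansion of
the covariance converges absolutely because the Fourier coefficients of `a` are square summable. -/
theorem GaussianRealization.hasSum_regTerm {K : ℝ} (hK : 0 < K) {μ : Measure Distr}
    (R : GaussianRealization K μ) (a f : TestFn) :
    HasSum (regTerm K a f) (∫ p : T2 × T2, f.1 p.1 * f.1 p.2
      * inner ℝ (R.point a p.1) (R.point a p.2) ^ 2 ∂(torusMeasure.prod torusMeasure)) := by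
  obtain ⟨C, hC⟩ := bounded_testFn f
  have hC0 : 0 ≤ C := (abs_nonneg _).trans (hC 0)
  have hl : ∀ j, 0 ≤ (lam K j)⁻¹ := fun j => inv_nonneg.2 (lam_pos hK j).le
  have hm : ∀ j, 0 ≤ convBound a j := fun j => add_nonneg (abs_nonneg _) (abs_nonneg _)
  set c : Idx → T2 → ℝ := fun j => conv a (frame j)
  have hcc : ∀ j, Continuous (c j) := fun j => continuous_conv a (frame j)
  set F : Idx × Idx → T2 × T2 → ℝ := fun p z => ((lam K p.1)⁻¹ * (lam K p.2)⁻¹)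
    * ((f.1 z.1 * (c p.1 z.1 * c p.2 z.1)) * (f.1 z.2 * (c p.1 z.2 * c p.2 z.2)))
  have hgc : ∀ p : Idx × Idx, Continuous fun x => f.1 x * (c p.1 x * c p.2 x) := fun p =>
    (continuous_testFn f).mul ((hcc _).mul (hcc _))
  have hFc : ∀ p, Continuous (F p) := fun p => continuous_const.mul
    (((hgc p).comp continuous_fst).mul ((hgc p).comp continuous_snd))
  have hgb : ∀ (p : Idx × Idx) x, |f.1 x * (c p.1 x * c p.2 x)|
      ≤ C * (convBound a p.1 * convBound a p.2) := fun p x => by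
    rw [abs_mul, abs_mul]
    exact mul_le_mul (hC x) (mul_le_mul (abs_conv_frame_le a _ x) (abs_conv_frame_le a _ x)
      (abs_nonneg _) (hm _)) (mul_nonneg (abs_nonneg _) (abs_nonneg _)) hC0
  have hFb : ∀ p z, ‖F p z‖ ≤ C ^ 2 * (((lam K p.1)⁻¹ * convBound a p.1 ^ 2)
      * ((lam K p.2)⁻¹ * convBound a p.2 ^ 2)) := fun p z => by
    rw [Real.norm_eq_abs, abs_mul, abs_mul (f.1 z.1 * _), abs_of_nonneg (mul_nonneg (hl _) (hl _))]
    calc _ ≤ ((lam K p.1)⁻¹ * (lam K p.2)⁻¹) * ((C * (convBound a p.1 * convBound a p.2))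
          * (C * (convBound a p.1 * convBound a p.2))) := by
          refine mul_le_mul_of_nonneg_left ?_ (mul_nonneg (hl _) (hl _))
          exact mul_le_mul (hgb p _) (hgb p _) (abs_nonneg _)
            (mul_nonneg hC0 (mul_nonneg (hm _) (hm _)))
      _ = _ := by ring
  have hsb := summable_convBound_sq hK a
  have hbs : Summable fun p : Idx × Idx => C ^ 2 * (((lam K p.1)⁻¹ * convBound a p.1 ^ 2)
      * ((lam K p.2)⁻¹ * convBound a p.2 ^ 2)) :=
    (hsb.mul_of_nonneg hsb (fun j => mul_nonneg (hl j) (sq_nonneg _))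
      fun j => mul_nonneg (hl j) (sq_nonneg _)).mul_left _
  have hsum : Summable fun p => ∫ z, ‖F p z‖ ∂(torusMeasure.prod torusMeasure) := by
    refine Summable.of_nonneg_of_le (fun p => integral_nonneg fun z => norm_nonneg _) (fun p => ?_) hbs
    calc ∫ z, ‖F p z‖ ∂(torusMeasure.prod torusMeasure)
        ≤ ∫ _ : T2 × T2, C ^ 2 * (((lam K p.1)⁻¹ * convBound a p.1 ^ 2)
          * ((lam K p.2)⁻¹ * convBound a p.2 ^ 2)) ∂(torusMeasure.prod torusMeasure) :=
          integral_mono (Continuous.integrable_torus_prod (hFc p)).norm (integrable_const _) (hFb p)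
      _ = _ := by simp
  have h1 := hasSum_integral_of_summable_integral_norm
    (fun p => Continuous.integrable_torus_prod (hFc p)) hsum
  refine Eq.mp ?_ h1
  congr 1
  · funext p
    simp only [F, regTerm]
    rw [integral_const_mul, integral_prod_mul (fun x => f.1 x * (c p.1 x * c p.2 x))
      (fun x => f.1 x * (c p.1 x * c p.2 x))]
    ring
  · refine integral_congr_ae (ae_of_all _ fun z => ?_)
    have h2 := R.cov.hasSum_inner (translate a z.1) (translate a z.2)
    have h3 : Summable fun j => ‖(lam K j)⁻¹ * (inner ℝ (translate a z.1) (frame j)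
        * inner ℝ (translate a z.2) (frame j))‖ := by
      refine Summable.of_nonneg_of_le (fun j => norm_nonneg _) (fun j => ?_) hsb
      rw [Real.norm_eq_abs, abs_mul, abs_mul, abs_of_nonneg (hl j), sq]
      exact mul_le_mul_of_nonneg_left (mul_le_mul (abs_conv_frame_le a j _)
        (abs_conv_frame_le a j _) (abs_nonneg _) (hm j)) (hl j)
    have h4 := (h2.mul h2 (summable_mul_of_summable_norm h3 h3)).mul_left (f.1 z.1 * f.1 z.2)
    simp only
    rw [GaussianRealization.point, GaussianRealization.point, sq]
    refine Eq.trans (tsum_congr fun p => ?_) h4.tsum_eq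
    simp only [F, c, conv]
    ring

theorem regTerm_eq (K : ℝ) (a f : TestFn) (p : Idx × Idx) :
    regTerm K a f p = (lam K p.1)⁻¹ * ((lam K p.2)⁻¹
      * inner ℝ (mulOp f ((memLp_of_continuous (continuous_conv a (frame p.1))).toLp _))
        ((memLp_of_continuous (continuous_conv a (frame p.2))).toLp _) ^ 2) := by
  rw [regTerm, inner_mulOp]
  congr 3
  refine integral_congr_ae ?_
  filter_upwards [(memLp_of_continuous (continuous_conv a (frame p.1))).coeFn_toLp,
    (memLp_of_continuous (continuous_conv a (frame p.2))).coeFn_toLp] with x h1 h2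
  rw [h1, h2, mul_assoc]

theorem toLp_conv_frame (a : TestFn) (j : Idx) :
    (memLp_of_continuous (continuous_conv a (frame j))).toLp _
      = cosCoeff a j • frame j + (sgn j * sinCoeff a j) • frame (flipIdx j) := by
  refine Lp.ext ?_
  filter_upwards [(memLp_of_continuous (continuous_conv a (frame j))).coeFn_toLp,
    Lp.coeFn_add (cosCoeff a j • frame j) ((sgn j * sinCoeff a j) • frame (flipIdx j)),
    Lp.coeFn_smul (cosCoeff a j) (frame j),
    Lp.coeFn_smul (sgn j * sinCoeff a j) (frame (flipIdx j)),
    coeFn_ofT (trig j), coeFn_ofT (trig (flipIdx j))] with x h1 h2 h3 h4 h5 h6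
  rw [h1, h2, Pi.add_apply, h3, h4, Pi.smul_apply, Pi.smul_apply, frame, frame, h5, h6, ← frame,
    conv_frame]
  rfl

/-- A summable bound for the summands `regTerm`, uniform over mollifiers. -/
def regBound (K : ℝ) (f : TestFn) (p : Idx × Idx) : ℝ :=
  4 * (hsTerm K f p + hsTerm K f (flipIdx p.1, p.2) + hsTerm K f (p.1, flipIdx p.2)
    + hsTerm K f (flipIdx p.1, flipIdx p.2))

theorem summable_regBound {K : ℝ} (hK : 0 < K) (f : TestFn) : Summable (regBound K f) := by
  have h := (summable_hsTerm_and_le hK f).1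
  have h1 : Summable fun p : Idx × Idx => hsTerm K f (flipIdx p.1, p.2) :=
    (Equiv.prodCongr flipIdx (Equiv.refl _)).summable_iff.2 h
  have h2 : Summable fun p : Idx × Idx => hsTerm K f (p.1, flipIdx p.2) :=
    (Equiv.prodCongr (Equiv.refl _) flipIdx).summable_iff.2 h
  have h3 : Summable fun p : Idx × Idx => hsTerm K f (flipIdx p.1, flipIdx p.2) :=
    (Equiv.prodCongr flipIdx flipIdx).summable_iff.2 h
  exact (((h.add h1).add h2).add h3).mul_left 4

/-- Convolution with a mollifier mixes a trigonometric function with the one of index `flipIdx`, with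
coefficients of absolute value at most `1`. -/
theorem abs_regTerm_le {K : ℝ} (hK : 0 < K) {a : TestFn} (h0 : ∀ x, 0 ≤ a.1 x)
    (h1 : ∫ x, a.1 x ∂torusMeasure = 1) (f : TestFn) (p : Idx × Idx) :
    |regTerm K a f p| ≤ regBound K f p := by
  have hl : ∀ j, 0 ≤ (lam K j)⁻¹ := fun j => inv_nonneg.2 (lam_pos hK j).le
  have hc : ∀ j, cosCoeff a j ^ 2 ≤ 1 := fun j => (sq_le_one_iff_abs_le_one _).2
    (abs_cosCoeff_le_one h0 h1 j)
  have hs : ∀ j, (sgn j * sinCoeff a j) ^ 2 ≤ 1 := fun j => by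
    rw [mul_pow, sgn_sq, one_mul]
    exact (sq_le_one_iff_abs_le_one _).2 (abs_sinCoeff_le_one h0 h1 j)
  have key : ∀ α β γ δ x y z w : ℝ, α ^ 2 ≤ 1 → β ^ 2 ≤ 1 → γ ^ 2 ≤ 1 → δ ^ 2 ≤ 1 →
      (α * (γ * x) + α * (δ * y) + (β * (γ * z) + β * (δ * w))) ^ 2
        ≤ 4 * (x ^ 2 + z ^ 2 + y ^ 2 + w ^ 2) := by
    intro α β γ δ x y z w hα hβ hγ hδ
    have e : ∀ s t r : ℝ, s ^ 2 ≤ 1 → t ^ 2 ≤ 1 → (s * (t * r)) ^ 2 ≤ r ^ 2 := fun s t r h h' => by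
      rw [mul_pow, mul_pow]
      calc s ^ 2 * (t ^ 2 * r ^ 2) ≤ 1 * (1 * r ^ 2) := by gcongr
        _ = r ^ 2 := by ring
    have a1 := e α γ x hα hγ
    have a2 := e α δ y hα hδ
    have a3 := e β γ z hβ hγ
    have a4 := e β δ w hβ hδ
    generalize α * (γ * x) = X at *
    generalize α * (δ * y) = Y at *
    generalize β * (γ * z) = Z at *
    generalize β * (δ * w) = W at *
    nlinarith [sq_nonneg (X - Y), sq_nonneg (X - Z), sq_nonneg (X - W), sq_nonneg (Y - Z),
      sq_nonneg (Y - W), sq_nonneg (Z - W)]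
  rw [regTerm_eq, toLp_conv_frame, toLp_conv_frame, abs_of_nonneg (mul_nonneg (hl _)
    (mul_nonneg (hl _) (sq_nonneg _))), regBound]
  simp only [hsTerm, lam_flipIdx, map_add, map_smul, inner_add_left, inner_add_right,
    inner_smul_left, inner_smul_right, RCLike.conj_to_real]
  have := mul_le_mul_of_nonneg_left (key _ _ _ _ (inner ℝ (mulOp f (frame p.1)) (frame p.2))
    (inner ℝ (mulOp f (frame p.1)) (frame (flipIdx p.2)))
    (inner ℝ (mulOp f (frame (flipIdx p.1))) (frame p.2))
    (inner ℝ (mulOp f (frame (flipIdx p.1))) (frame (flipIdx p.2)))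
    (hc p.1) (hs p.1) (hc p.2) (hs p.2)) (mul_nonneg (hl p.1) (hl p.2))
  refine le_of_eq_of_le ?_ (this.trans_eq ?_) <;> ring

theorem IsMollifierSeq.tendsto_tsum_regTerm {K : ℝ} (hK : 0 < K) {a : ℕ → TestFn}
    (ha : IsMollifierSeq a) (f : TestFn) :
    Tendsto (fun n => ∑' p, regTerm K (a n) f p) atTop (𝓝 (hsNormSq K f)) := by
  refine tendsto_tsum_of_dominated_convergence (summable_regBound hK f) (fun p => ?_)
    (Eventually.of_forall fun n p => abs_regTerm_le hK (ha.1 n) (ha.2.1 n) f p)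
  simp only [regTerm_eq]
  have h1 := Tendsto.inner (𝕜 := ℝ) (((mulOp f).continuous.tendsto _).comp
    (ha.tendsto_conv (frame p.1))) (ha.tendsto_conv (frame p.2))
  exact ((h1.pow 2).const_mul _).const_mul _

/-! ### Convergence of the smeared Wick squares -/

theorem inner_smul_basis_self {E ι : Type*} [NormedAddCommGroup E] [InnerProductSpace ℝ E]
    (b : HilbertBasis ι ℝ E) (c : ℝ) (i : ι) : inner ℝ (c • b i) (b i) = c := by
  rw [real_inner_smul_left, real_inner_self_eq_norm_sq, b.orthonormal.1 i, one_pow, mul_one]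

namespace GaussianRealization

variable {K : ℝ} (hK : 0 < K) {μ : Measure Distr} [IsProbabilityMeasure μ]
  (R : GaussianRealization K μ)
include hK R

omit [IsProbabilityMeasure μ] in
/-- The operator `J f Jᵀ` has a Hilbert basis of eigenvectors, with square summable eigenvalues. -/
theorem exists_eigenbasis (f : TestFn) :
    ∃ (ι : Type) (b : HilbertBasis ι ℝ R.H) (l : ι → ℝ),
      (∀ i, sandwich R.J f (b i) = l i • b i) ∧ HasSum (fun i => l i ^ 2) (hsNormSq K f) := by
  obtain ⟨w, b₀, -⟩ := exists_hilbertBasis ℝ R.H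
  obtain ⟨ι, b, l, hb⟩ := exists_hilbertBasis_eigenvectors (sandwich R.J f)
    (isCompactOperator_of_summable_sq b₀ _ (R.cov.hasSum_norm_sq_sandwich hK f b₀).summable)
    (isSymmetric_sandwich R.J f)
  refine ⟨ι, b, l, hb, ?_⟩
  have h := R.cov.hasSum_norm_sq_sandwich hK f b
  have e : ∀ i, ‖sandwich R.J f (b i)‖ ^ 2 = l i ^ 2 := fun i => by
    rw [hb, norm_smul, b.orthonormal.1 i, mul_one, Real.norm_eq_abs, sq_abs]
  simpa only [e] using h

/-- The distance of the smeared Wick square to the chaos sums over an eigenbasis of `J f Jᵀ`, as the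
mollifier shrinks. -/
theorem tendsto_integral_sub_chaosSum {a : ℕ → TestFn} (ha : IsMollifierSeq a) (f : TestFn)
    {ι : Type} (b : HilbertBasis ι ℝ R.H) (l : ι → ℝ)
    (hb : ∀ i, sandwich R.J f (b i) = l i • b i) (s : Finset ι) :
    Tendsto (fun n => ∫ φ, (wickInt μ (a n) f φ
        - chaosSum (fun i => (b i : Lp ℝ 2 μ)) l s φ) ^ 2 ∂μ) atTop
      (𝓝 (2 * (hsNormSq K f - ∑ i ∈ s, l i ^ 2))) := by
  have ho : ∀ i, ‖(b i : Lp ℝ 2 μ)‖ = 1 := fun i => b.orthonormal.1 i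
  have hX : ∀ φ, chaosSum (fun i => (b i : Lp ℝ 2 μ)) l s φ
      = ∑ i ∈ s, l i * wick (b i : Lp ℝ 2 μ) φ := fun φ => by
    simp only [chaosSum, wick, ho, one_pow]
  have hw : ∀ i, MemLp (wick (b i : Lp ℝ 2 μ)) 2 μ := fun i => R.gaussian.memLp_wick (b i).2
  have hXm : MemLp (chaosSum (fun i => (b i : Lp ℝ 2 μ)) l s) 2 μ :=
    R.gaussian.memLp_chaosSum (fun i => (b i).2) l s
  have hmul : ∀ Y : Distr → ℝ, MemLp Y 2 μ →
      ∫ φ, Y φ * chaosSum (fun i => (b i : Lp ℝ 2 μ)) l s φ ∂μ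
        = ∑ i ∈ s, l i * ∫ φ, Y φ * wick (b i : Lp ℝ 2 μ) φ ∂μ := fun Y hY => by
    have e : ∀ φ, Y φ * chaosSum (fun i => (b i : Lp ℝ 2 μ)) l s φ
        = ∑ i ∈ s, l i * (Y φ * wick (b i : Lp ℝ 2 μ) φ) := fun φ => by
      rw [hX, Finset.mul_sum]
      exact Finset.sum_congr rfl fun i _ => by ring
    simp only [e]
    have hi : ∀ i ∈ s, Integrable (fun φ => l i * (Y φ * wick (b i : Lp ℝ 2 μ) φ)) μ := fun i _ =>
      (hY.integrable_mul (hw i)).const_mul _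
    rw [integral_finsetSum _ hi]
    simp only [integral_const_mul]
  have hXX : ∫ φ, chaosSum (fun i => (b i : Lp ℝ 2 μ)) l s φ ^ 2 ∂μ = 2 * ∑ i ∈ s, l i ^ 2 := by
    simp only [sq (chaosSum _ _ _ _)]
    rw [hmul _ hXm, Finset.mul_sum]
    refine Finset.sum_congr rfl fun i hi => ?_
    simp only [mul_comm (chaosSum _ _ _ _)]
    rw [hmul _ (hw i), Finset.sum_eq_single_of_mem i hi fun j _ hj => ?_]
    · rw [R.gaussian.integral_wick_mul_wick (b i).2 (b i).2, real_inner_self_eq_norm_sq, ho]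
      ring
    · rw [R.gaussian.integral_wick_mul_wick (b i).2 (b j).2, ← Submodule.coe_inner,
        b.orthonormal.2 (Ne.symm hj)]
      ring
  have hexp : ∀ n, ∫ φ, (wickInt μ (a n) f φ - chaosSum (fun i => (b i : Lp ℝ 2 μ)) l s φ) ^ 2 ∂μ
      = 2 * (∑' p, regTerm K (a n) f p)
        - 2 * (∑ i ∈ s, l i * (2 * ∫ x, f.1 x * conv (a n) (R.J.adjoint (b i)) x ^ 2 ∂torusMeasure))
        + 2 * ∑ i ∈ s, l i ^ 2 := fun n => by
    have hΦ := R.memLp_wickInt (a n) f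
    have i1 : Integrable (fun φ => wickInt μ (a n) f φ ^ 2) μ := hΦ.integrable_sq
    have i2 : Integrable (fun φ => 2 * (wickInt μ (a n) f φ
        * chaosSum (fun i => (b i : Lp ℝ 2 μ)) l s φ)) μ := (hΦ.integrable_mul hXm).const_mul 2
    have i3 : Integrable (fun φ => chaosSum (fun i => (b i : Lp ℝ 2 μ)) l s φ ^ 2) μ :=
      hXm.integrable_sq
    have i12 : Integrable (fun φ => wickInt μ (a n) f φ ^ 2 - 2 * (wickInt μ (a n) f φ
        * chaosSum (fun i => (b i : Lp ℝ 2 μ)) l s φ)) μ := i1.sub i2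
    simp only [sub_sq, mul_assoc]
    rw [integral_add i12 i3, integral_sub i1 i2, integral_const_mul, hmul _ hΦ, hXX,
      R.integral_wickInt_sq, (R.hasSum_regTerm hK (a n) f).tsum_eq]
    simp only [R.integral_wickInt_mul_wick]
  simp only [hexp]
  have hconv : ∀ i, Tendsto
      (fun n => ∫ x, f.1 x * conv (a n) (R.J.adjoint (b i)) x ^ 2 ∂torusMeasure) atTop (𝓝 (l i)) :=
    fun i => by
    have h := ha.tendsto_integral_conv_sq f (R.J.adjoint (b i))
    rwa [← inner_sandwich, hb, inner_smul_basis_self] at h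
  have h1 := (((ha.tendsto_tsum_regTerm hK f).const_mul 2).sub
    ((tendsto_finsetSum s fun i _ => ((hconv i).const_mul 2).const_mul (l i)).const_mul 2)).add_const
      (2 * ∑ i ∈ s, l i ^ 2)
  refine Eq.mp ?_ h1
  congr 2
  rw [Finset.sum_congr rfl fun i _ => show l i * (2 * l i) = 2 * l i ^ 2 by ring, ← Finset.mul_sum]
  ring

end GaussianRealization

/-! ### Existence of mollifiers -/

/-- A smooth bump at the origin, supported where `∑ᵢ cos (2π xᵢ) > 2 - ε`. -/
def bump (ε : ℝ) : TestFn :=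
  ⟨fun x => Real.smoothTransition ((cosT (Pi.single 0 1)).1 x + (cosT (Pi.single 1 1)).1 x - 2 + ε),
    Real.smoothTransition.contDiff.comp ((((contDiff_testFn (cosT (Pi.single 0 1))).add
      (contDiff_testFn (cosT (Pi.single 1 1)))).sub contDiff_const).add contDiff_const)⟩

theorem bump_nonneg (ε : ℝ) (x : T2) : 0 ≤ (bump ε).1 x := Real.smoothTransition.nonneg _

theorem cosT_single_proj (i : Fin 2) (z : Fin 2 → ℝ) :
    (cosT (Pi.single i 1)).1 (proj z) = Real.cos (2 * Real.pi * z i) := by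
  rw [cosT_proj]
  fin_cases i <;> simp [phase]

theorem integral_bump_pos {ε : ℝ} (hε : 0 < ε) : 0 < ∫ x, (bump ε).1 x ∂torusMeasure := by
  refine (continuous_testFn (bump ε)).integral_pos_of_hasCompactSupport_nonneg_nonzero
    (HasCompactSupport.of_compactSpace _) (bump_nonneg ε) (x := proj 0) ?_
  simp only [bump, cosT_single_proj]
  refine (Real.smoothTransition.pos_of_pos ?_).ne'
  simp only [Pi.zero_apply, mul_zero, Real.cos_zero]
  linarith

theorem eq_zero_of_two_le_cosT {x : T2}
    (h : 2 ≤ (cosT (Pi.single 0 1)).1 x + (cosT (Pi.single 1 1)).1 x) : x = 0 := by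
  obtain ⟨z, rfl⟩ := isOpenQuotientMap_proj.surjective x
  rw [cosT_single_proj, cosT_single_proj] at h
  have h0 : ∀ i, Real.cos (2 * Real.pi * z i) = 1 := by
    have h1 := Real.cos_le_one (2 * Real.pi * z 0)
    have h2 := Real.cos_le_one (2 * Real.pi * z 1)
    exact Fin.forall_fin_two.2 ⟨le_antisymm h1 (by linarith), le_antisymm h2 (by linarith)⟩
  funext i
  obtain ⟨n, hn⟩ := (Real.cos_eq_one_iff _).1 (h0 i)
  have h3 : z i = n := by
    have : (n : ℝ) * (2 * Real.pi) = z i * (2 * Real.pi) := by rw [hn]; ring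
    exact (mul_right_cancel₀ Real.two_pi_pos.ne' this).symm
  have h4 : ((z i : ℝ) : UnitAddCircle) = 0 := by
    rw [h3, AddCircle.coe_eq_zero_iff]
    exact ⟨n, by simp⟩
  exact h4

theorem exists_isMollifierSeq : ∃ a : ℕ → TestFn, IsMollifierSeq a := by
  set ε : ℕ → ℝ := fun n => 1 / ((n : ℝ) + 1)
  have hε : ∀ n, 0 < ε n := fun n => by positivity
  refine ⟨fun n => (∫ x, (bump (ε n)).1 x ∂torusMeasure)⁻¹ • bump (ε n), fun n x => ?_, fun n => ?_,
    fun U hU => ?_⟩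
  · exact mul_nonneg (inv_nonneg.2 (integral_bump_pos (hε n)).le) (bump_nonneg _ _)
  · change ∫ x, (∫ x, (bump (ε n)).1 x ∂torusMeasure)⁻¹ * (bump (ε n)).1 x ∂torusMeasure = 1
    rw [integral_const_mul]
    exact inv_mul_cancel₀ (integral_bump_pos (hε n)).ne'
  · -- On the compact complement of the interior of `U` the sum of the cosines stays below `2`.
    set G : T2 → ℝ := fun x => (cosT (Pi.single 0 1)).1 x + (cosT (Pi.single 1 1)).1 x
    have hG : Continuous G := (continuous_testFn _).add (continuous_testFn _)
    have hev : ∃ δ > 0, ∀ x, x ∉ U → G x ≤ 2 - δ := by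
      rcases (interior U)ᶜ.eq_empty_or_nonempty with he | hne
      · refine ⟨1, one_pos, fun x hx => ?_⟩
        have : x ∈ (interior U)ᶜ := fun h => hx (interior_subset h)
        rw [he] at this
        exact this.elim
      · obtain ⟨x₀, hx₀, hmax⟩ := isOpen_interior.isClosed_compl.isCompact.exists_isMaxOn hne
          hG.continuousOn
        refine ⟨2 - G x₀, ?_, fun x hx => ?_⟩
        · by_contra! h
          have h0 := eq_zero_of_two_le_cosT (x := x₀) (by simpa [G] using h)
          exact hx₀ (h0 ▸ mem_interior_iff_mem_nhds.2 hU)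
        · rw [sub_sub_cancel]
          exact hmax fun h => hx (interior_subset h)
    obtain ⟨δ, hδ, h⟩ := hev
    filter_upwards [(tendsto_one_div_add_atTop_nhds_zero_nat (𝕜 := ℝ)).eventually_lt_const hδ]
      with n hn x hx
    by_contra hxU
    refine hx (mul_eq_zero_of_right _ (Real.smoothTransition.zero_of_nonpos ?_))
    have := h x hxU
    simp only [G] at this
    linarith

/-! ### The limit of the smeared Wick squares -/

theorem norm_toLp_sub_toLp_sq {Ω : Type*} [MeasurableSpace Ω] {μ : Measure Ω} {f h : Ω → ℝ}
    (hf : MemLp f 2 μ) (hh : MemLp h 2 μ) :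
    ‖hf.toLp f - hh.toLp h‖ ^ 2 = ∫ w, (f w - h w) ^ 2 ∂μ := by
  rw [norm_sq_L2_eq, ← MemLp.toLp_sub]
  refine integral_congr_ae ?_
  filter_upwards [(hf.sub hh).coeFn_toLp] with w hw
  rw [hw, Pi.sub_apply]

namespace GaussianRealization

variable {K : ℝ} (hK : 0 < K) {μ : Measure Distr} [IsProbabilityMeasure μ]
  (R : GaussianRealization K μ)

/-- The smeared Wick square of the mollified field, as an element of `L²(μ)`. -/
def wickLp (a f : TestFn) : Lp ℝ 2 μ := (R.memLp_wickInt a f).toLp _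

theorem wickLp_add (a f h : TestFn) : R.wickLp a (f + h) = R.wickLp a f + R.wickLp a h := by
  rw [wickLp, wickLp, wickLp, ← MemLp.toLp_add]
  refine MemLp.toLp_congr _ _ (ae_of_all _ fun φ => ?_)
  have hi : ∀ f : TestFn, Integrable (fun x => f.1 x * wickSqReg μ a φ x) torusMeasure := fun f =>
    ((continuous_testFn f).mul (R.continuous_wickSqReg a φ)).integrable_torus
  rw [Pi.add_apply, wickInt, wickInt, wickInt, ← integral_add (hi f) (hi h)]
  refine integral_congr_ae (ae_of_all _ fun x => ?_)
  change (f.1 x + h.1 x) * _ = _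
  ring

theorem wickLp_smul (a : TestFn) (c : ℝ) (f : TestFn) : R.wickLp a (c • f) = c • R.wickLp a f := by
  rw [wickLp, wickLp, ← MemLp.toLp_const_smul]
  refine MemLp.toLp_congr _ _ (ae_of_all _ fun φ => ?_)
  rw [Pi.smul_apply, wickInt, wickInt, smul_eq_mul, ← integral_const_mul]
  refine integral_congr_ae (ae_of_all _ fun x => ?_)
  change (c * f.1 x) * _ = _
  ring

include hK

/-- Up to an arbitrarily small error in `L²(μ)`, the smeared Wick squares are eventually equal to a
random variable that does not depend on the mollifiers. -/
theorem exists_approx_wickLp (f : TestFn) {ε : ℝ} (hε : 0 < ε) :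
    ∃ X : Lp ℝ 2 μ, ∀ a, IsMollifierSeq a → ∀ᶠ n in atTop, ‖R.wickLp (a n) f - X‖ < ε := by
  obtain ⟨ι, b, l, hb, hl⟩ := R.exists_eigenbasis hK f
  have h1 : ∀ᶠ s : Finset ι in atTop, 2 * (hsNormSq K f - ∑ i ∈ s, l i ^ 2) < ε ^ 2 := by
    have h2 : Tendsto (fun s : Finset ι => 2 * (hsNormSq K f - ∑ i ∈ s, l i ^ 2)) atTop
        (𝓝 (2 * (hsNormSq K f - hsNormSq K f))) :=
      (Tendsto.const_sub _ (show Tendsto _ _ _ from hl)).const_mul 2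
    rw [sub_self, mul_zero] at h2
    exact h2.eventually_lt_const (by positivity)
  obtain ⟨s, hs⟩ := h1.exists
  refine ⟨(R.gaussian.memLp_chaosSum (fun i => (b i).2) l s).toLp _, fun a ha => ?_⟩
  filter_upwards [(R.tendsto_integral_sub_chaosSum hK ha f b l hb s).eventually_lt_const hs]
    with n hn
  rw [← norm_toLp_sub_toLp_sq (R.memLp_wickInt (a n) f)
    (R.gaussian.memLp_chaosSum (fun i => (b i).2) l s)] at hn
  exact lt_of_pow_lt_pow_left₀ 2 hε.le hn

theorem exists_tendsto_wickLp (f : TestFn) :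
    ∃ Y : Lp ℝ 2 μ, ∀ a, IsMollifierSeq a → Tendsto (fun n => R.wickLp (a n) f) atTop (𝓝 Y) := by
  obtain ⟨a₀, ha₀⟩ := exists_isMollifierSeq
  have hc : CauchySeq fun n => R.wickLp (a₀ n) f := by
    rw [Metric.cauchySeq_iff']
    intro ε hε
    obtain ⟨X, hX⟩ := R.exists_approx_wickLp hK f (half_pos hε)
    obtain ⟨N, hN⟩ := eventually_atTop.1 (hX a₀ ha₀)
    refine ⟨N, fun n hn => (dist_triangle_right _ _ X).trans_lt ?_⟩
    rw [dist_eq_norm, dist_eq_norm]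
    linarith [hN n hn, hN N le_rfl]
  obtain ⟨Y, hY⟩ := cauchySeq_tendsto_of_complete hc
  refine ⟨Y, fun a ha => ?_⟩
  rw [Metric.tendsto_nhds]
  intro ε hε
  obtain ⟨X, hX⟩ := R.exists_approx_wickLp hK f (show 0 < ε / 3 by positivity)
  filter_upwards [hX a ha, hX a₀ ha₀, Metric.tendsto_nhds.1 hY (ε / 3) (by positivity)]
    with n h1 h2 h3
  rw [← dist_eq_norm] at h1 h2
  have h4 := dist_triangle (R.wickLp (a n) f) X Y
  have h5 := dist_triangle_left X Y (R.wickLp (a₀ n) f)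
  linarith

theorem exists_wickLimit : ∃ W : TestFn →ₗ[ℝ] Lp ℝ 2 μ, ∀ a, IsMollifierSeq a → ∀ f,
    Tendsto (fun n => R.wickLp (a n) f) atTop (𝓝 (W f)) := by
  choose Y hY using R.exists_tendsto_wickLp hK
  obtain ⟨a, ha⟩ := exists_isMollifierSeq
  refine ⟨{ toFun := Y, map_add' := fun f h => ?_, map_smul' := fun c f => ?_ },
    fun a ha f => hY f a ha⟩
  · refine tendsto_nhds_unique (hY (f + h) a ha) ?_
    simp only [wickLp_add]
    exact (hY f a ha).add (hY h a ha)
  · refine tendsto_nhds_unique (hY (c • f) a ha) ?_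
    simp only [wickLp_smul]
    exact (hY f a ha).const_smul c

/-- The smeared Wick square `∫ f :φ²:`, as an element of `L²(μ)`. -/
def wickLimit : TestFn →ₗ[ℝ] Lp ℝ 2 μ := (R.exists_wickLimit hK).choose

theorem tendsto_wickLp {a : ℕ → TestFn} (ha : IsMollifierSeq a) (f : TestFn) :
    Tendsto (fun n => R.wickLp (a n) f) atTop (𝓝 (R.wickLimit hK f)) :=
  (R.exists_wickLimit hK).choose_spec a ha f

/-- The chaos expansion of the smeared Wick square in an eigenbasis of `J f Jᵀ`. -/
theorem integral_wickLimit_sub_chaosSum (f : TestFn) {ι : Type} (b : HilbertBasis ι ℝ R.H)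
    (l : ι → ℝ) (hb : ∀ i, sandwich R.J f (b i) = l i • b i) (s : Finset ι) :
    ∫ φ, (R.wickLimit hK f φ - chaosSum (fun i => (b i : Lp ℝ 2 μ)) l s φ) ^ 2 ∂μ
      = 2 * (hsNormSq K f - ∑ i ∈ s, l i ^ 2) := by
  obtain ⟨a, ha⟩ := exists_isMollifierSeq
  have hX := R.gaussian.memLp_chaosSum (fun i => (b i).2) l s
  have h1 := (((R.tendsto_wickLp hK ha f).sub_const (hX.toLp _)).norm.pow 2)
  have h2 := R.tendsto_integral_sub_chaosSum hK ha f b l hb s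
  simp only [wickLp, norm_toLp_sub_toLp_sq] at h1
  have h3 := tendsto_nhds_unique h1 h2
  rw [← h3, ← Lp.toLp_coeFn (R.wickLimit hK f) (Lp.memLp _), norm_toLp_sub_toLp_sq,
    Lp.toLp_coeFn]

theorem norm_wickLimit_sq_le (f : TestFn) :
    ‖R.wickLimit hK f‖ ^ 2 ≤ 2 * (∑' j, (lam K j)⁻¹ ^ 2) * ‖ofT f‖ ^ 2 := by
  obtain ⟨ι, b, l, hb, hl⟩ := R.exists_eigenbasis hK f
  have h := R.integral_wickLimit_sub_chaosSum hK f b l hb ∅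
  simp only [chaosSum, Finset.sum_empty, sub_zero] at h
  rw [← norm_sq_L2_eq] at h
  rw [h, mul_assoc]
  exact mul_le_mul_of_nonneg_left (summable_hsTerm_and_le hK f).2 zero_le_two

end GaussianRealization

/-! ### The Wick square as a random distribution -/

theorem norm_pi_single_one (i : Fin 2) : ‖(Pi.single i 1 : Fin 2 → ℝ)‖ = 1 := by
  rw [Pi.norm_single, norm_one]

/-- Second partial derivatives are bounded by the norm of the second Fréchet derivative, in the form
used in the definition of `Distr`. -/
theorem abs_pderiv_pderiv_le {f : TestFn} {M : ℝ} (i : Fin 2)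
    (hM : ∀ z : Fin 2 → ℝ, ‖iteratedFDeriv ℝ 2 (fun y : Fin 2 → ℝ => f.1 (proj y)) z‖ ≤ M) (x : T2) :
    |(pderiv i (pderiv i f)).1 x| ≤ M := by
  obtain ⟨z, rfl⟩ := isOpenQuotientMap_proj.surjective x
  set F : (Fin 2 → ℝ) → ℝ := fun y => f.1 (proj y)
  have hF : ContDiff ℝ ∞ F := contDiff_testFn f
  have hd : DifferentiableAt ℝ (fderiv ℝ F) z :=
    ((hF.fderiv_right (m := ∞) (by simp)).differentiable (by simp)).differentiableAt
  have h1 : (fun y => (pderiv i f).1 (proj y)) = fun y => fderiv ℝ F y (Pi.single i 1) :=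
    funext fun y => pderiv_proj i f y
  rw [pderiv_proj, h1, fderiv_clm_apply hd (differentiableAt_const _)]
  simp only [fderiv_fun_const, Pi.zero_apply, ContinuousLinearMap.comp_zero, zero_add,
    ContinuousLinearMap.flip_apply]
  have h2 := (fderiv ℝ (fderiv ℝ F) z).le_opNorm (Pi.single i 1)
  have h3 := (fderiv ℝ (fderiv ℝ F) z (Pi.single i 1)).le_opNorm (Pi.single i 1)
  rw [norm_pi_single_one, mul_one] at h2 h3
  refine (h3.trans h2).trans ?_
  rw [← norm_iteratedFDeriv_one, norm_iteratedFDeriv_fderiv]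
  exact hM z

theorem norm_ofT_massive_le {K : ℝ} (hK : 0 < K) {f : TestFn} {M : ℝ}
    (hM : ∀ m ≤ 2, ∀ x : Fin 2 → ℝ,
      ‖iteratedFDeriv ℝ m (fun y : Fin 2 → ℝ => f.1 (proj y)) x‖ ≤ M) :
    ‖ofT (massive K f)‖ ≤ (K + 2) * M := by
  have hM0 : 0 ≤ M := (norm_nonneg _).trans (hM 0 (by norm_num) 0)
  refine norm_ofT_le (by positivity) fun x => ?_
  have h0 : |f.1 x| ≤ M := by
    obtain ⟨z, rfl⟩ := isOpenQuotientMap_proj.surjective x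
    have := hM 0 (by norm_num) z
    rwa [norm_iteratedFDeriv_zero] at this
  rw [massive_apply, laplacian_eq_lap, lap_apply, Fin.sum_univ_two]
  have h1 := abs_le.1 (abs_pderiv_pderiv_le 0 (hM 2 le_rfl) x)
  have h2 := abs_le.1 (abs_pderiv_pderiv_le 1 (hM 2 le_rfl) x)
  have h3 := abs_le.1 h0
  rw [abs_le]
  constructor <;> nlinarith

/-- The Cauchy–Schwarz inequality for the frame coefficients. The weights `λⱼ` are moved to the test
function, where they act as `-Δ + K`. -/
theorem summable_and_abs_tsum_le {K : ℝ} (hK : 0 < K) {q : Idx → ℝ}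
    (hq : Summable fun j => ((lam K j)⁻¹ * q j) ^ 2) (f : TestFn) :
    Summable (fun j => inner ℝ (ofT f) (frame j) * q j) ∧
      |∑' j, inner ℝ (ofT f) (frame j) * q j|
        ≤ √(∑' j, ((lam K j)⁻¹ * q j) ^ 2) * ‖ofT (massive K f)‖ := by
  have h1 := hasSum_frame_sq (ofT (massive K f))
  have e : ∀ j, inner ℝ (ofT f) (frame j) * q j
      = ((lam K j)⁻¹ * q j) * inner ℝ (ofT (massive K f)) (frame j) := fun j => by
    rw [inner_massive_frame]
    field_simp [(lam_pos hK j).ne']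
  simp only [e]
  have hs : Summable fun j => ((lam K j)⁻¹ * q j) * inner ℝ (ofT (massive K f)) (frame j) := by
    refine Summable.of_norm_bounded (hq.add h1.summable) fun j => ?_
    rw [Real.norm_eq_abs, abs_mul]
    nlinarith [sq_abs ((lam K j)⁻¹ * q j), sq_abs (inner ℝ (ofT (massive K f)) (frame j)),
      sq_nonneg (|(lam K j)⁻¹ * q j| - |inner ℝ (ofT (massive K f)) (frame j)|),
      sq_nonneg (|(lam K j)⁻¹ * q j| + |inner ℝ (ofT (massive K f)) (frame j)|)]
  refine ⟨hs, ?_⟩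
  rw [← Real.sqrt_sq (norm_nonneg (ofT (massive K f))),
    ← Real.sqrt_mul (tsum_nonneg fun j => sq_nonneg _)]
  refine Real.abs_le_sqrt (le_of_tendsto ((hs.hasSum : Tendsto _ _ _).pow 2)
    (Eventually.of_forall fun s => ?_))
  refine (Finset.sum_mul_sq_le_sq_mul_sq _ _ _).trans ?_
  exact mul_le_mul (hq.sum_le_tsum s fun _ _ => sq_nonneg _)
    (sum_le_hasSum s (fun _ _ => sq_nonneg _) h1) (Finset.sum_nonneg fun _ _ => sq_nonneg _)
    (tsum_nonneg fun _ => sq_nonneg _)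

/-- The distribution with slowly growing Fourier coefficients `q`. -/
def distrOfSummable {K : ℝ} (hK : 0 < K) {q : Idx → ℝ}
    (hq : Summable fun j => ((lam K j)⁻¹ * q j) ^ 2) : Distr :=
  ⟨{ toFun := fun f => ∑' j, inner ℝ (ofT f) (frame j) * q j
     map_add' := fun f h => by
      rw [← (summable_and_abs_tsum_le hK hq f).1.tsum_add (summable_and_abs_tsum_le hK hq h).1]
      refine tsum_congr fun j => ?_
      rw [map_add, inner_add_left, add_mul]
     map_smul' := fun c f => by
      rw [RingHom.id_apply, smul_eq_mul, ← tsum_mul_left]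
      refine tsum_congr fun j => ?_
      rw [map_smul, inner_smul_left, mul_assoc]
      rfl },
    2, √(∑' j, ((lam K j)⁻¹ * q j) ^ 2) * (K + 2), fun f M hM => by
      refine ((summable_and_abs_tsum_le hK hq f).2).trans ?_
      rw [mul_assoc]
      exact mul_le_mul_of_nonneg_left (norm_ofT_massive_le hK hM) (Real.sqrt_nonneg _)⟩

/-- The zero distribution. -/
def zeroDistr : Distr := ⟨0, 0, 0, fun f M _ => by simp⟩

open Classical in
/-- The distribution with Fourier coefficients `q`, or zero if they grow too fast. -/
def distrOfCoeff {K : ℝ} (hK : 0 < K) (q : Idx → ℝ) : Distr :=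
  if hq : Summable fun j => ((lam K j)⁻¹ * q j) ^ 2 then distrOfSummable hK hq else zeroDistr

open Classical in
theorem distrOfCoeff_pair {K : ℝ} (hK : 0 < K) (q : Idx → ℝ) (f : TestFn) :
    (distrOfCoeff hK q).pair f = if Summable fun j => ((lam K j)⁻¹ * q j) ^ 2 then
      ∑' j, inner ℝ (ofT f) (frame j) * q j else 0 := by
  by_cases h : Summable fun j => ((lam K j)⁻¹ * q j) ^ 2
  · rw [distrOfCoeff, dif_pos h, if_pos h]
    rfl
  · rw [distrOfCoeff, dif_neg h, if_neg h]
    rfl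

theorem measurable_distrOfCoeff {K : ℝ} (hK : 0 < K) {α : Type*} [MeasurableSpace α]
    {q : Idx → α → ℝ} (hq : ∀ j, Measurable (q j)) :
    Measurable fun x => distrOfCoeff hK fun j => q j x := by
  classical
  refine measurable_distr_iff fun f => ?_
  set G : Set α := {x | Summable fun j => ((lam K j)⁻¹ * q j x) ^ 2}
  have hG : MeasurableSet G := by
    have e : G = {x | ∑' j, ENNReal.ofReal (((lam K j)⁻¹ * q j x) ^ 2) ≠ ⊤} := by
      ext x
      have h1 : ∀ j, ‖((lam K j)⁻¹ * q j x) ^ 2‖ₑ = ENNReal.ofReal (((lam K j)⁻¹ * q j x) ^ 2) :=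
        fun j => Real.enorm_of_nonneg (sq_nonneg _)
      simp only [G, Set.mem_ofPred_eq, ← h1, tsum_enorm_ne_top_iff_summable_norm]
      exact summable_norm_iff.symm
    have hm : Measurable fun x => ∑' j, ENNReal.ofReal (((lam K j)⁻¹ * q j x) ^ 2) :=
      Measurable.tsum fun j => (((hq j).const_mul _).pow_const 2).ennreal_ofReal
    rw [e]
    exact (measurableSet_eq_fun hm measurable_const).compl
  refine measurable_of_tendsto_metrizable' (atTop : Filter (Finset Idx))
    (f := fun s => G.indicator fun x => ∑ j ∈ s, inner ℝ (ofT f) (frame j) * q j x)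
    (fun s => (Finset.measurable_sum s fun j _ => (hq j).const_mul _).indicator hG) ?_
  rw [tendsto_pi_nhds]
  intro x
  rw [distrOfCoeff_pair]
  by_cases hx : x ∈ G
  · simp only [Set.indicator_of_mem hx]
    rw [if_pos (show Summable _ from hx)]
    exact (summable_and_abs_tsum_le hK hx f).1.hasSum
  · simp only [Set.indicator_of_notMem hx]
    rw [if_neg (show ¬ Summable _ from hx)]
    exact tendsto_const_nhds

/-- The Fourier coefficients of a test function are absolutely summable, and its Fourier series
converges in `L²`. -/
theorem summable_abs_inner_frame (f : TestFn) :
    Summable (fun j => |inner ℝ (ofT f) (frame j)|) ∧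
      HasSum (fun j => inner ℝ (ofT f) (frame j) • frame j) (ofT f) := by
  have hs : Summable fun j => |inner ℝ (ofT f) (frame j)| := by
    refine Summable.of_nonneg_of_le (fun j => abs_nonneg _) (fun j => ?_)
      ((summable_lam_inv_sq one_pos).mul_right ‖ofT (massive 1 (massive 1 f))‖)
    have h1 := inner_massive_frame 1 (massive 1 f) j
    rw [inner_massive_frame 1 f] at h1
    have h2 : inner ℝ (ofT f) (frame j)
        = (lam 1 j)⁻¹ ^ 2 * inner ℝ (ofT (massive 1 (massive 1 f))) (frame j) := by
      rw [h1]
      field_simp [(lam_pos one_pos j).ne']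
    rw [h2, abs_mul, abs_of_nonneg (sq_nonneg _)]
    refine mul_le_mul_of_nonneg_left ?_ (sq_nonneg _)
    refine (abs_real_inner_le_norm _ _).trans ?_
    exact mul_le_of_le_one_right (norm_nonneg _) (norm_frame_le_one j)
  refine ⟨hs, ?_⟩
  have h1 : Summable fun j => inner ℝ (ofT f) (frame j) • frame j := by
    refine Summable.of_norm_bounded hs fun j => ?_
    rw [norm_smul, Real.norm_eq_abs]
    exact mul_le_of_le_one_right (abs_nonneg _) (norm_frame_le_one j)
  have h2 : ∑' j, inner ℝ (ofT f) (frame j) • frame j = ofT f := by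
    refine ext_inner_right ℝ fun v => ?_
    have h3 := h1.hasSum.mapL (innerSL ℝ v)
    have h4 := hasSum_frame (ofT f) v
    rw [real_inner_comm v, real_inner_comm v]
    rw [real_inner_comm v (ofT f)] at h4
    refine HasSum.unique (f := fun j => inner ℝ (ofT f) (frame j) * inner ℝ v (frame j)) ?_ h4
    have e : (fun j => inner ℝ (ofT f) (frame j) * inner ℝ v (frame j))
        = fun j => innerSL ℝ v (inner ℝ (ofT f) (frame j) • frame j) := funext fun j => by
      rw [map_smul]
      rfl
    rw [e]
    exact h3
  have h3 := h1.hasSum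
  rwa [h2] at h3

namespace GaussianRealization

variable {K : ℝ} (hK : 0 < K) {μ : Measure Distr} [IsProbabilityMeasure μ]
  (R : GaussianRealization K μ)

/-- The Wick square of the field: the random distribution whose Fourier coefficients are the Wick
squares smeared against the trigonometric functions. -/
def wickSquare (φ : Distr) : Distr := distrOfCoeff hK fun j => R.wickLimit hK (trig j) φ

theorem measurable_wickSquare : Measurable (R.wickSquare hK) :=
  measurable_distrOfCoeff hK fun j => (Lp.stronglyMeasurable (R.wickLimit hK (trig j))).measurable

theorem norm_wickLimit_le (f : TestFn) :
    ‖R.wickLimit hK f‖ ≤ √(2 * ∑' j, (lam K j)⁻¹ ^ 2) * ‖ofT f‖ := by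
  have h0 : 0 ≤ ∑' j, (lam K j)⁻¹ ^ 2 := tsum_nonneg fun _ => sq_nonneg _
  refine le_of_sq_le_sq ?_ (by positivity)
  rw [mul_pow, Real.sq_sqrt (by positivity)]
  exact R.norm_wickLimit_sq_le hK f

/-- The smeared Wick square is the sum of its Fourier series in `L²(μ)`. -/
theorem hasSum_wickLimit (f : TestFn) :
    HasSum (fun j => inner ℝ (ofT f) (frame j) • R.wickLimit hK (trig j)) (R.wickLimit hK f) := by
  set S := √(2 * ∑' j, (lam K j)⁻¹ ^ 2)
  have h1 : Tendsto (fun s : Finset Idx =>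
      S * ‖ofT f - ∑ j ∈ s, inner ℝ (ofT f) (frame j) • frame j‖) atTop (𝓝 0) := by
    have h2 : Tendsto (fun s : Finset Idx => ∑ j ∈ s, inner ℝ (ofT f) (frame j) • frame j) atTop
      (𝓝 (ofT f)) := (summable_abs_inner_frame f).2
    simpa using ((h2.const_sub (ofT f)).norm.const_mul S)
  have h3 : Tendsto (fun s : Finset Idx => R.wickLimit hK f
      - ∑ j ∈ s, inner ℝ (ofT f) (frame j) • R.wickLimit hK (trig j)) atTop (𝓝 0) := by
    refine squeeze_zero_norm (fun s => ?_) h1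
    have h4 := R.norm_wickLimit_le hK (f - ∑ j ∈ s, inner ℝ (ofT f) (frame j) • trig j)
    simp only [map_sub, map_sum, map_smul] at h4
    exact h4
  have h5 := h3.const_sub (R.wickLimit hK f)
  simp only [sub_sub_cancel, sub_zero] at h5
  exact h5

theorem wickSquare_pair_ae (f : TestFn) :
    (fun φ => (R.wickSquare hK φ).pair f) =ᵐ[μ] R.wickLimit hK f := by
  set S := √(2 * ∑' j, (lam K j)⁻¹ ^ 2)
  have hn : ∀ j, ‖R.wickLimit hK (trig j)‖ ≤ S := fun j => by
    refine (R.norm_wickLimit_le hK (trig j)).trans ?_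
    exact mul_le_of_le_one_right (Real.sqrt_nonneg _) (norm_frame_le_one j)
  -- The weighted Fourier coefficients are square summable, because their second moments are.
  have hG : ∀ᵐ φ ∂μ, Summable fun j => ((lam K j)⁻¹ * R.wickLimit hK (trig j) φ) ^ 2 := by
    have hi : ∀ j, Integrable (fun φ => ((lam K j)⁻¹ * R.wickLimit hK (trig j) φ) ^ 2) μ := fun j =>
      ((Lp.memLp (R.wickLimit hK (trig j))).const_mul _).integrable_sq
    have h1 : ∑' j, eLpNorm (fun φ => ((lam K j)⁻¹ * R.wickLimit hK (trig j) φ) ^ 2) 1 μ ≠ ⊤ := by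
      have e : ∀ j, eLpNorm (fun φ => ((lam K j)⁻¹ * R.wickLimit hK (trig j) φ) ^ 2) 1 μ
          = ‖(lam K j)⁻¹ ^ 2 * ‖R.wickLimit hK (trig j)‖ ^ 2‖ₑ := fun j => by
        rw [eLpNorm_one_eq_lintegral_enorm, Real.enorm_of_nonneg (by positivity), norm_sq_L2_eq,
          ← integral_const_mul]
        simp only [mul_pow]
        rw [ofReal_integral_eq_lintegral_ofReal]
        · exact lintegral_congr fun φ => Real.enorm_of_nonneg (by positivity)
        · simpa only [mul_pow] using hi j
        · exact ae_of_all _ fun φ => by positivity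
      simp only [e]
      rw [tsum_enorm_ne_top_iff_summable_norm]
      refine (Summable.of_nonneg_of_le (fun j => by positivity) (fun j => ?_)
        ((summable_lam_inv_sq hK).mul_right (S ^ 2))).norm
      gcongr
      exact hn j
    filter_upwards [summable_norm_of_tsum_eLpNorm_ne_top le_rfl (fun j => (hi j).1) h1] with φ hφ
    exact summable_norm_iff.1 hφ
  have hs : ∑' j, ‖inner ℝ (ofT f) (frame j) • R.wickLimit hK (trig j)‖ₑ ≠ ⊤ := by
    rw [tsum_enorm_ne_top_iff_summable_norm]
    refine Summable.of_nonneg_of_le (fun j => norm_nonneg _) (fun j => ?_)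
      ((summable_abs_inner_frame f).1.mul_right S)
    rw [norm_smul, Real.norm_eq_abs]
    exact mul_le_mul_of_nonneg_left (hn j) (abs_nonneg _)
  have hae := Lp.hasSum_coeFn_tsum hs
  rw [(R.hasSum_wickLimit hK f).tsum_eq] at hae
  have hsm : ∀ᵐ φ ∂μ, ∀ j, (inner ℝ (ofT f) (frame j) • R.wickLimit hK (trig j) : Lp ℝ 2 μ) φ
      = inner ℝ (ofT f) (frame j) * R.wickLimit hK (trig j) φ := by
    rw [ae_all_iff]
    exact fun j => Lp.coeFn_smul _ _
  filter_upwards [hG, hae, hsm] with φ h1 h2 h3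
  simp only [h3] at h2
  rw [wickSquare, distrOfCoeff_pair, if_pos h1, h2.tsum_eq]

theorem isWickSquare_wickSquare : IsWickSquare μ (R.wickSquare hK) := by
  refine ⟨R.measurable_wickSquare hK, fun a ha f => ?_⟩
  have h1 := R.tendsto_wickLp hK ha f
  rw [tendsto_iff_norm_sub_tendsto_zero] at h1
  have h2 := (ENNReal.continuous_ofReal.tendsto 0).comp h1
  rw [ENNReal.ofReal_zero] at h2
  refine h2.congr fun n => ?_
  rw [Function.comp, ofReal_norm, Lp.enorm_def]
  refine eLpNorm_congr_ae ?_
  filter_upwards [Lp.coeFn_sub (R.wickLp (a n) f) (R.wickLimit hK f), R.wickSquare_pair_ae hK f,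
    (R.memLp_wickInt (a n) f).coeFn_toLp] with φ h3 h4 h5
  rw [h3, Pi.sub_apply, h4, wickLp, h5]
  rfl

/-- The Wick square is unique up to null sets. -/
theorem pair_ae_of_isWickSquare {Q : Distr → Distr} (hQ : IsWickSquare μ Q) (f : TestFn) :
    (fun φ => (Q φ).pair f) =ᵐ[μ] R.wickLimit hK f := by
  obtain ⟨a, ha⟩ := exists_isMollifierSeq
  have h1 := hQ.2 a ha f
  have h2 := (R.isWickSquare_wickSquare hK).2 a ha f
  have hm : AEStronglyMeasurable (fun φ => (Q φ).pair f) μ :=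
    ((measurable_pair f).comp hQ.1).aestronglyMeasurable
  have hm' : AEStronglyMeasurable (fun φ => (R.wickSquare hK φ).pair f) μ :=
    ((measurable_pair f).comp (R.measurable_wickSquare hK)).aestronglyMeasurable
  have h3 : ∀ n, eLpNorm (fun φ => (R.wickSquare hK φ).pair f - (Q φ).pair f) 2 μ
      ≤ eLpNorm (fun φ => (∫ x, f.1 x * wickSqReg μ (a n) φ x ∂torusMeasure) - (Q φ).pair f) 2 μ
        + eLpNorm (fun φ => (∫ x, f.1 x * wickSqReg μ (a n) φ x ∂torusMeasure)
          - (R.wickSquare hK φ).pair f) 2 μ := fun n => by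
    have hw := (R.memLp_wickInt (a n) f).1
    refine le_trans (le_of_eq ?_) (eLpNorm_sub_le (hw.sub hm) (hw.sub hm') one_le_two)
    congr 1
    funext φ
    simp only [Pi.sub_apply]
    ring
  have h4 : eLpNorm (fun φ => (R.wickSquare hK φ).pair f - (Q φ).pair f) 2 μ = 0 := by
    have h5 := h1.add h2
    rw [add_zero] at h5
    exact le_antisymm (ge_of_tendsto' h5 h3) bot_le
  filter_upwards [(eLpNorm_eq_zero_iff (hm'.sub hm) two_ne_zero).1 h4, R.wickSquare_pair_ae hK f] with φ h6 h7
  rw [← h7]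
  exact (sub_eq_zero.1 h6).symm

end GaussianRealization

/-! ### Uniqueness of measures with given characteristic functional -/

/-- The σ-algebra on distributions is induced by the product σ-algebra under the map
`φ ↦ (⟨φ, f⟩)_f`, so a finite measure is determined by its finite-dimensional marginals, and these
by their characteristic functions. -/
theorem ext_of_integral_cexp_pair {μ ν : Measure Distr} [IsFiniteMeasure μ] [IsFiniteMeasure ν]
    (h : ∀ f : TestFn, ∫ φ, Complex.exp (Complex.I * (φ.pair f : ℂ)) ∂μ
      = ∫ φ, Complex.exp (Complex.I * (φ.pair f : ℂ)) ∂ν) : μ = ν := by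
  classical
  set Φ : Distr → TestFn → ℝ := fun φ f => φ.pair f
  have hΦ : Measurable Φ := measurable_pi_lambda _ measurable_pair
  have hcomap : (inferInstance : MeasurableSpace Distr) = MeasurableSpace.comap Φ MeasurableSpace.pi := by
    refine le_antisymm (iSup_le fun f => ?_) (measurable_iff_comap_le.1 hΦ)
    have h1 : @Measurable _ _ (MeasurableSpace.comap Φ MeasurableSpace.pi) (borel ℝ)
        fun φ : Distr => φ.pair f := by
      rw [← BorelSpace.measurable_eq (α := ℝ)]
      exact (measurable_pi_apply f).comp (comap_measurable Φ)
    exact measurable_iff_comap_le.1 h1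
  have hfd : ∀ I : Finset TestFn, (μ.map Φ).map I.restrict = (ν.map Φ).map I.restrict := by
    intro I
    have hr : Measurable (I.restrict ∘ Φ) := (Finset.measurable_restrict I).comp hΦ
    rw [Measure.map_map (Finset.measurable_restrict I) hΦ,
      Measure.map_map (Finset.measurable_restrict I) hΦ]
    refine Measure.ext_of_charFunDual (funext fun L => ?_)
    rw [charFunDual_apply, charFunDual_apply,
      integral_map hr.aemeasurable (by fun_prop), integral_map hr.aemeasurable (by fun_prop)]
    have e : ∀ φ : Distr, L ((I.restrict ∘ Φ) φ)
        = φ.pair (∑ i : I, L (Pi.single i 1) • (i : TestFn)) := fun φ => by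
      have h1 : (I.restrict ∘ Φ) φ = ∑ i : I, φ.pair i • (Pi.single i (1 : ℝ) : I → ℝ) := by
        rw [← pi_eq_sum_univ' ]
        rfl
      rw [h1, map_sum]
      change _ = φ.1 _
      rw [map_sum]
      refine Finset.sum_congr rfl fun i _ => ?_
      rw [map_smul, map_smul, smul_eq_mul, smul_eq_mul, mul_comm]
      rfl
    simp only [e]
    simpa only [mul_comm Complex.I] using h (∑ i : I, L (Pi.single i 1) • (i : TestFn))
  have hmap : μ.map Φ = ν.map Φ :=
    IsProjectiveLimit.unique (P := fun I => (ν.map Φ).map I.restrict) hfd fun _ => rfl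
  refine Measure.ext fun s hs => ?_
  have hs' : MeasurableSet[MeasurableSpace.comap Φ MeasurableSpace.pi] s := hcomap ▸ hs
  obtain ⟨t, ht, rfl⟩ := hs'
  rw [← Measure.map_apply hΦ ht, hmap, Measure.map_apply hΦ ht]

/-! ### The Schrödinger operator -/

/-- The Schrödinger equation in weak form, with the potential as a multiplication operator. -/
theorem schrodingerEq_add_iff {K : ℝ} {g : TestFn} {u w : T2 → ℝ} (hu : MemLp u 2 torusMeasure)
    (hw : MemLp w 2 torusMeasure) :
    SchrodingerEq (fun x => K + g.1 x) u w ↔ ∀ f : TestFn,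
      inner ℝ (hu.toLp u) (ofT (massive K f)) + inner ℝ (mulOp g (hu.toLp u)) (ofT f)
        = inner ℝ (hw.toLp w) (ofT f) := by
  rw [schrodingerEq_iff hu hw]
  refine forall_congr' fun f => ?_
  have h1 : ∫ x, u x * (-laplacian f.1 x + (K + g.1 x) * f.1 x) ∂torusMeasure
      = inner ℝ (hu.toLp u) (ofT (massive K f)) + inner ℝ (mulOp g (hu.toLp u)) (ofT f) := by
    have hi : ∀ h : TestFn, Integrable (fun x => u x * h.1 x) torusMeasure := fun h =>
      hu.integrable_mul (memLp_testFn h)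
    rw [inner_mulOp_comm, mulOp_ofT, inner_toLp_ofT, inner_toLp_ofT, ← integral_add (hi _) (hi _)]
    refine integral_congr_ae (ae_of_all _ fun x => ?_)
    simp only [massive_apply]
    change _ = _ + u x * (g.1 x * f.1 x)
    ring
  rw [h1, inner_toLp_ofT hw]

theorem schrodingerEq_coeFn_iff {K : ℝ} {g : TestFn} (u w : L2T) :
    SchrodingerEq (fun x => K + g.1 x) u w ↔ ∀ f : TestFn,
      inner ℝ u (ofT (massive K f)) + inner ℝ (mulOp g u) (ofT f) = inner ℝ w (ofT f) := by
  rw [schrodingerEq_add_iff (Lp.memLp u) (Lp.memLp w), Lp.toLp_coeFn, Lp.toLp_coeFn]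

theorem IsPositive.inner_pos {V : T2 → ℝ} (hV : IsPositive V) {u w : L2T}
    (h : SchrodingerEq V u w) (hu : u ≠ 0) : 0 < inner ℝ u w := by
  rw [inner_L2_eq]
  exact hV u w h fun h0 => hu ((Lp.eq_zero_iff_ae_eq_zero).2 h0)

/-- A strictly positive operator is injective. -/
theorem IsPositive.eq_of_schrodingerEq {K : ℝ} {g : TestFn}
    (hV : IsPositive fun x => K + g.1 x) {u v w : L2T}
    (hu : SchrodingerEq (fun x => K + g.1 x) u w) (hv : SchrodingerEq (fun x => K + g.1 x) v w) :
    u = v := by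
  rw [schrodingerEq_coeFn_iff] at hu hv
  have h : SchrodingerEq (fun x => K + g.1 x) (u - v : L2T) (0 : L2T) := by
    rw [schrodingerEq_coeFn_iff]
    intro f
    rw [map_sub, inner_sub_left, inner_sub_left, inner_zero_left]
    linarith [hu f, hv f]
  by_contra hne
  have := hV.inner_pos h (sub_ne_zero.2 hne)
  rw [inner_zero_right] at this
  exact lt_irrefl _ this

/-- `Jᵀ J` inverts `-Δ + K`. -/
theorem RealizesCovariance.inner_adjoint_massive {K : ℝ} (hK : 0 < K) {E : Type*}
    [NormedAddCommGroup E] [InnerProductSpace ℝ E] [CompleteSpace E] {J : L2T →L[ℝ] E}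
    (hJ : RealizesCovariance K J) (u : L2T) (f : TestFn) :
    inner ℝ (J.adjoint (J u)) (ofT (massive K f)) = inner ℝ u (ofT f) := by
  rw [ContinuousLinearMap.adjoint_inner_left]
  refine (hJ.hasSum_inner u (ofT (massive K f))).unique ?_
  have h := hasSum_frame u (ofT f)
  have e : (fun j => (lam K j)⁻¹ * (inner ℝ u (frame j) * inner ℝ (ofT (massive K f)) (frame j)))
      = fun j => inner ℝ u (frame j) * inner ℝ (ofT f) (frame j) := funext fun j => by
    rw [inner_massive_frame]
    field_simp [(lam_pos hK j).ne']
  rw [e]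
  exact h

section Eigenbasis

variable {K : ℝ} (hK : 0 < K) {E : Type*} [NormedAddCommGroup E] [InnerProductSpace ℝ E]
  [CompleteSpace E] {J : L2T →L[ℝ] E} (hJ : RealizesCovariance K J) {g : TestFn}
  (hpos : IsPositive fun x => K + g.1 x) {ι : Type*} {b : HilbertBasis ι ℝ E} {l : ι → ℝ}
  (hb : ∀ i, sandwich J g (b i) = l i • b i)
include hK hJ hpos hb

/-- Positivity of `-Δ + K + g` bounds the eigenvalues of `J g Jᵀ` from below by `-1`: an eigenvector
`b` of eigenvalue `l ≠ 0` yields `u = Jᵀ b` with `⟨u, (-Δ + K + g) u⟩ = 1 + l`. -/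
theorem one_add_eigenvalue_pos (i : ι) : 0 < 1 + l i := by
  by_cases hl : l i = 0
  · rw [hl]
    norm_num
  set u : L2T := J.adjoint (b i)
  have hgu : inner ℝ (mulOp g u) u = l i := by
    rw [← inner_sandwich, hb, inner_smul_basis_self]
  have hu : u ≠ 0 := fun h => hl (by rw [← hgu, h, inner_zero_right])
  have h1 : SchrodingerEq (fun x => K + g.1 x) u ((1 + (l i)⁻¹) • mulOp g u : L2T) := by
    rw [schrodingerEq_coeFn_iff]
    intro f
    have h2 := hJ.inner_adjoint_massive hK (mulOp g u) f
    have h3 : J (mulOp g u) = l i • b i := hb i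
    rw [h3, map_smul, inner_smul_left] at h2
    simp only [RCLike.conj_to_real] at h2
    rw [inner_smul_left, RCLike.conj_to_real, ← h2]
    change _ + l i * inner ℝ u _ = _ * (l i * inner ℝ u _)
    field_simp
    ring
  have h2 := hpos.inner_pos h1 hu
  rw [inner_smul_right, real_inner_comm, hgu, add_mul, inv_mul_cancel₀ hl] at h2
  linarith

/-- The covariance `(-Δ + K + g)⁻¹` in an eigenbasis of `J g Jᵀ`. -/
theorem integral_greenOp_mul (hl : Summable fun i => l i ^ 2) (f : TestFn) :
    ∫ x, greenOp (fun x => K + g.1 x) f.1 x * f.1 x ∂torusMeasure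
      = ∑' i, inner ℝ (b i) (J (ofT f)) ^ 2 / (1 + l i) := by
  have hl1 := one_add_eigenvalue_pos hK hJ hpos hb
  obtain ⟨c, hc, hcl⟩ := exists_spectral_gap hl hl1
  set η : ι → ℝ := fun i => inner ℝ (b i) (J (ofT f))
  have hη := (hasSum_inner_sq b (J (ofT f))).summable
  -- With `v = ∑ ηᵢ / (1 + lᵢ) bᵢ` one has `(1 + J g Jᵀ) v = J f`, and `Jᵀ v` solves the equation.
  have hmem : Memℓp (fun i => η i / (1 + l i)) 2 := by
    refine memℓp_gen ?_
    refine Summable.of_nonneg_of_le (fun i => by positivity) (fun i => ?_) (hη.mul_left (c⁻¹ ^ 2))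
    rw [ENNReal.toReal_ofNat, Real.rpow_ofNat, Real.norm_eq_abs, sq_abs, div_eq_inv_mul, mul_pow]
    exact mul_le_mul_of_nonneg_right
      (pow_le_pow_left₀ (inv_nonneg.2 (hl1 i).le) (inv_anti₀ hc (hcl i)) 2) (sq_nonneg _)
  set v : E := b.repr.symm ⟨fun i => η i / (1 + l i), hmem⟩
  have hv : ∀ i, inner ℝ (b i) v = η i / (1 + l i) := fun i => by
    rw [← b.repr_apply_apply, LinearIsometryEquiv.apply_symm_apply]
  have hsol : v + sandwich J g v = J (ofT f) := by
    refine b.repr.injective (lp.ext (funext fun i => ?_))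
    have hs : inner ℝ (b i) (sandwich J g v) = l i * inner ℝ (b i) v := by
      have h1 := isSymmetric_sandwich J g (b i) v
      change inner ℝ (sandwich J g (b i)) v = inner ℝ (b i) (sandwich J g v) at h1
      rw [← h1, hb, inner_smul_left, RCLike.conj_to_real]
    rw [b.repr_apply_apply, b.repr_apply_apply, inner_add_right, hs, hv]
    have := (hl1 i).ne'
    change _ = η i
    field_simp
  set u : L2T := J.adjoint v
  have hu : ∀ h : TestFn, inner ℝ u (ofT (massive K h)) + inner ℝ (mulOp g u) (ofT h)
      = inner ℝ (ofT f) (ofT h) := fun h => by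
    rw [← hJ.inner_adjoint_massive hK (ofT f), ← hsol, map_add, inner_add_left,
      ← hJ.inner_adjoint_massive hK (mulOp g u)]
    rfl
  have huS := (schrodingerEq_coeFn_iff (K := K) (g := g) u (ofT f)).2 hu
  have hex : SchrodingerEq (fun x => K + g.1 x) u f.1 := by
    rw [schrodingerEq_add_iff (Lp.memLp u) (memLp_testFn f), Lp.toLp_coeFn]
    exact hu
  have hG := schrodingerEq_greenOp ⟨_, hex⟩
  have hGS : SchrodingerEq (fun x => K + g.1 x) (hG.1.toLp _ : L2T) (ofT f) := by
    rw [schrodingerEq_coeFn_iff]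
    exact (schrodingerEq_add_iff hG.1 (memLp_testFn f)).1 hG
  have hGu := hpos.eq_of_schrodingerEq hGS huS
  rw [← inner_toLp_ofT hG.1, hGu, ContinuousLinearMap.adjoint_inner_left]
  have h1 := b.hasSum_inner_mul_inner v (J (ofT f))
  rw [← h1.tsum_eq]
  refine tsum_congr fun i => ?_
  rw [real_inner_comm, hv]
  change _ * η i = η i ^ 2 / _
  ring

end Eigenbasis

/-! ### The density -/

/-- The characteristic functional of the density `exp (-½ ∫ g :φ²:)`. -/
theorem GaussianRealization.integral_cexp_mul_exp {K : ℝ} (hK : 0 < K) {μ : Measure Distr}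
    [IsProbabilityMeasure μ] (R : GaussianRealization K μ) {g : TestFn}
    (hpos : IsPositive fun x => K + g.1 x) {X : Distr → ℝ} (hX : X =ᵐ[μ] R.wickLimit hK g)
    (f : TestFn) :
    Integrable (fun φ => Real.exp (-(1 / 2) * X φ)) μ ∧
    ∫ φ, Complex.exp (Complex.I * (φ.pair f : ℂ)) * (Real.exp (-(1 / 2) * X φ) : ℂ) ∂μ
      = ((∫ φ, Real.exp (-(1 / 2) * X φ) ∂μ : ℝ) : ℂ) * Complex.exp (-(1 / 2 : ℂ)
        * ((∫ x, greenOp (fun x => K + g.1 x) f.1 x * f.1 x ∂torusMeasure : ℝ) : ℂ)) := by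
  obtain ⟨ι, b, l, hb, hl⟩ := R.exists_eigenbasis hK g
  have hX2 : MemLp X 2 μ := (Lp.memLp _).ae_eq hX.symm
  have hXs : ∀ s : Finset ι, ∫ φ, (X φ - chaosSum (fun i => (b i : Lp ℝ 2 μ)) l s φ) ^ 2 ∂μ
      ≤ 2 * (∑' i, l i ^ 2 - ∑ i ∈ s, l i ^ 2) := fun s => by
    rw [hl.tsum_eq, ← R.integral_wickLimit_sub_chaosSum hK g b l hb s]
    refine le_of_eq (integral_congr_ae ?_)
    filter_upwards [hX] with φ hφ
    rw [hφ]
  have ho : Orthonormal ℝ fun i => (b i : Lp ℝ 2 μ) :=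
    b.orthonormal.comp_linearIsometry R.H.subtypeₗᵢ
  have h := R.gaussian.integral_cexp_mul_exp ho (fun i => (b i).2) hl.summable
    (one_add_eigenvalue_pos hK R.cov hpos hb) hX2 hXs (h := (R.J (ofT f) : Lp ℝ 2 μ))
    (hasSum_inner_sq b (R.J (ofT f)))
  refine ⟨h.1, Eq.trans (integral_congr_ae ?_) (h.2.trans ?_)⟩
  · filter_upwards [R.pair f] with φ hφ
    rw [hφ, mul_comm Complex.I]
  · rw [integral_greenOp_mul hK R.cov hpos hb hl.summable f, Complex.ofReal_exp]
    push_cast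
    rfl

theorem eq_withDensity {K : ℝ} (hK : 0 < K) {g : TestFn} (hpos : IsPositive fun x => K + g.1 x)
    {μ ν : Measure Distr} (hμ : IsFreeField K μ) (hν : IsGaussianField (fun x => K + g.1 x) ν)
    {Q : Distr → Distr} (hQ : IsWickSquare μ Q) :
    Integrable (fun φ => Real.exp (-(1 / 2) * (Q φ).pair g)) μ ∧
      0 < ∫ φ, Real.exp (-(1 / 2) * (Q φ).pair g) ∂μ ∧
      ν = μ.withDensity fun φ => ENNReal.ofReal (Real.exp (-(1 / 2) * (Q φ).pair g)
        / ∫ ψ, Real.exp (-(1 / 2) * (Q ψ).pair g) ∂μ) := by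
  have := hμ.1
  have := hν.1
  obtain ⟨R⟩ := exists_gaussianRealization hK hμ
  have key := R.integral_cexp_mul_exp hK hpos (R.pair_ae_of_isWickSquare hK hQ g)
  have hint := (key 0).1
  have hZ : 0 < ∫ φ, Real.exp (-(1 / 2) * (Q φ).pair g) ∂μ := integral_exp_pos hint
  refine ⟨hint, hZ, ?_⟩
  set Z := ∫ φ, Real.exp (-(1 / 2) * (Q φ).pair g) ∂μ
  set D : Distr → ℝ := fun φ => Real.exp (-(1 / 2) * (Q φ).pair g) / Z
  have hD0 : ∀ φ, 0 ≤ D φ := fun φ => by positivity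
  have hDm : Measurable D :=
    ((((measurable_pair g).comp hQ.1).const_mul _).exp).div_const _
  have hfin : IsFiniteMeasure (μ.withDensity fun φ => ENNReal.ofReal (D φ)) :=
    isFiniteMeasure_withDensity_ofReal (hint.div_const Z).2
  refine ext_of_integral_cexp_pair fun f => ?_
  rw [hν.2 f, integral_withDensity_eq_integral_toReal_smul hDm.ennreal_ofReal
    (ae_of_all _ fun φ => ENNReal.ofReal_lt_top)]
  have e : ∀ φ : Distr, (ENNReal.ofReal (D φ)).toReal • Complex.exp (Complex.I * (φ.pair f : ℂ))
      = (Z : ℂ)⁻¹ * (Complex.exp (Complex.I * (φ.pair f : ℂ))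
        * (Real.exp (-(1 / 2) * (Q φ).pair g) : ℂ)) := fun φ => by
    rw [ENNReal.toReal_ofReal (hD0 φ), Complex.real_smul]
    simp only [D]
    push_cast
    ring
  simp only [e]
  rw [integral_const_mul, (key f).2, ← mul_assoc, inv_mul_cancel₀, one_mul]
  exact_mod_cast hZ.ne'

end

end TorusField

theorem mainTheorem9 (K : ℝ) (hK : 0 < K) (g : TorusField.TestFn)
    (hpos : TorusField.IsPositive (fun x => K + g.1 x))
    (μ ν : Measure TorusField.Distr)
    (hμ : TorusField.IsFreeField K μ)
    (hν : TorusField.IsGaussianField (fun x => K + g.1 x) ν) :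
    (∃ Q, TorusField.IsWickSquare μ Q) ∧
    ∀ Q, TorusField.IsWickSquare μ Q →
      ν ≪ μ ∧
      Integrable (fun φ => Real.exp (-(1 / 2) * (Q φ).pair g)) μ ∧
      0 < ∫ φ, Real.exp (-(1 / 2) * (Q φ).pair g) ∂μ ∧
      ∀ᵐ φ ∂μ, 0 < ν.rnDeriv μ φ ∧ ν.rnDeriv μ φ < ⊤ ∧
        Real.log (ν.rnDeriv μ φ).toReal
          = -(1 / 2) * (Q φ).pair g
            - Real.log (∫ ψ, Real.exp (-(1 / 2) * (Q ψ).pair g) ∂μ) := by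
  have := hμ.1
  obtain ⟨R⟩ := TorusField.exists_gaussianRealization hK hμ
  refine ⟨⟨_, R.isWickSquare_wickSquare hK⟩, fun Q hQ => ?_⟩
  obtain ⟨hint, hZ, hdens⟩ := TorusField.eq_withDensity hK hpos hμ hν hQ
  have hm : Measurable fun φ => ENNReal.ofReal (Real.exp (-(1 / 2) * (Q φ).pair g)
      / ∫ ψ, Real.exp (-(1 / 2) * (Q ψ).pair g) ∂μ) :=
    ((((TorusField.measurable_pair g).comp hQ.1).const_mul _).exp.div_const _).ennreal_ofReal
  refine ⟨hdens ▸ withDensity_absolutelyContinuous _ _, hint, hZ, ?_⟩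
  have hrn := Measure.rnDeriv_withDensity μ hm
  rw [← hdens] at hrn
  filter_upwards [hrn] with φ hφ
  rw [hφ]
  refine ⟨ENNReal.ofReal_pos.2 (by positivity), ENNReal.ofReal_lt_top, ?_⟩
  rw [ENNReal.toReal_ofReal (by positivity), Real.log_div (Real.exp_ne_zero _) hZ.ne', Real.log_exp]
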